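/- Let $\mathbf J=\begin{bmatrix}0&1\\-1&0\end{bmatrix}$, let $m$ be even and $J=\mathbf J\otimes I_{m/2}$. Let $\Theta\in\mathbb R^{n\times n}$ be antisymmetric and nonsingular, $R=R^{\mathsf T}\in\mathbb R^{n\times n}$, $M\in\mathbb R^{m\times n}$, and suppose that $A=2\Theta(R+M^{\mathsf T}JM)$ is Hurwitz; put $B=2\Theta M^{\mathsf T}$. These are the parameters of an open quantum harmonic oscillator $dX=AX\,dt+B\,dW$, $[X(t),X(t)^{\mathsf T}]=2i\Theta$, driven by an $m$-channel quantum Wiener process $W$ with $[W(s),W(t)^{\mathsf T}]=2i\min(s,t)J$. Let $V\in\mathbb C^{n\times n}$ be the solution of $AV+VA^{\mathsf T}+B(I_m+iJ)B^{\mathsf T}=0$, and let $$K(\tau)=e^{\tau A}V\ (\tau\ge 0),\qquad K(\tau)=Ve^{-\tau A^{\mathsf T}}\ (\tau<0).$$ Let $T>0$, let $\mathcal K$ be the integral operator $(\mathcal Kg)(s)=\int_0^TK(s-t)g(t)\,dt$ on $L^2([0,T],\mathbb C^n)$ with the inner product $\langle f,g\rangle=\int_0^Tf(t)^*g(t)\,dt$,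 and let $h_k=\varphi_k+i\psi_k$, $k=0,1,2,\dots$, be an orthonormal sequence of eigenfunctions of $\mathcal K$, $\int_0^TK(s-t)h_k(t)\,dt=\mu_kh_k(s)$ for all $0\le s\le T$, exhaustive in the sense that $\mathcal Kg=0$ for every $g\in L^2([0,T],\mathbb C^n)$ orthogonal to all $h_k$. Let $\zeta_k=(\xi_k,\eta_k)^{\mathsf T}$, $k=0,1,2,\dots$, be pairs of self-adjoint operators on a complex Hilbert space with the canonical commutation relations $[\zeta_j,\zeta_k^{\mathsf T}]=2i\delta_{jk}\mathbf J$ (in the Weyl form). Suppose that with respect to a density operator $\rho$ (with $\mathbf E\,\xi=\operatorname{Tr}(\rho\,\xi)$) the $\zeta_k$ are statistically independent and each is in the Gaussian quantum state with zero mean and quantum covariance matrix $\Gamma=I_2+i\mathbf J$, that is, $\mathbf E e^{iu^{\mathsf T}\zeta_k}=e^{-\frac12u^{\mathsf T}\Gamma u}$ for all $u\in\mathbb R^2$. Put $\gamma_k=\xi_k+i\eta_k$ and $$X(t)=\sum_{k=0}^{\infty}\sqrt{\mu_k}\,\operatorname{Re}(h_k(t)\gamma_k)=\sum_{k=0}^\infty\sqrt{\mu_k}\,(\varphi_k(t)\xi_k-\psi_k(t)\eta_k),\qquad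 0\le t\le T.$$ Then the process $X$ has the invariant multipoint Gaussian quantum state of the system variables of the oscillator driven by vacuum input fields. In detail: 1. For every $t\in[0,T]$ the series for $X(t)$ converges in mean square, and $\mathbf E X(t)=0$, $\mathbf E(X(s)X(t)^{\mathsf T})=K(s-t)$ for all $s,t\in[0,T]$. 2. On the closed subspace generated from the ensemble vectors of $\rho$ by the Weyl operators of the $\zeta_k$, the exponentials of the partial sums converge strongly to the exponentials $e^{i\sum_ju_j^{\mathsf T}X(t_j)}$ (strongly continuous one-parameter groups with the generators $\sum_ju_j^{\mathsf T}X(t_j)$), and for all $t_1,\dots,t_N\in[0,T]$, $u_1,\dots,u_N\in\mathbb R^n$, $$\mathbf E e^{i\sum_ju_j^{\mathsf T}X(t_j)}=e^{-\frac12\sum_{j,k}u_j^{\mathsf T}K(t_j-t_k)u_k},\qquad \mathbf E\big(e^{iu_1^{\mathsf T}X(t_1)}\cdots e^{iu_N^{\mathsf T}X(t_N)}\big)=e^{-\frac12\sum_ju_j^{\mathsf T}K(0)u_j-\sum_{j<k}u_j^{\mathsf T}K(t_j-t_k)u_k}.$$ 3. Both expectations coincide with those for the solution $e^{tA}X_0+\int_0^te^{(t-s)A}B\,dW(s)$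 of the oscillator equation, whenever $W$ is in the vacuum state, $\mathbf E e^{i\int g^{\mathsf T}dW}=e^{-\frac12\|g\|^2}$ for $g\in L^2([0,\infty),\mathbb R^m)$, independent of $X_0$, and the state of the system variables does not depend on time. 4. For every $f\in L^2([0,T],\mathbb R^n)$, the exponentials $e^{i\int_0^Tf(t)^{\mathsf T}X(t)\,dt}$ are defined in the same way, and $$\mathbf E e^{i\int_0^Tf(t)^{\mathsf T}X(t)\,dt}=e^{-\frac12\langle f,\mathcal Kf\rangle}.$$ -/

import Mathlib

open MeasureTheory Filter Topology Matrix
open scoped InnerProductSpace ComplexConjugate Kronecker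

noncomputable section

/-! ### Matrices and the covariance kernel -/

/-- A real matrix regarded as a complex one. -/
def cmat {ι κ : Type*} (M : Matrix ι κ ℝ) : Matrix ι κ ℂ := M.map Complex.ofReal

/-- A real vector regarded as a complex one. -/
def cvec {ι : Type*} (u : ι → ℝ) : ι → ℂ := fun a => (u a : ℂ)

/-- The number `uᵀ M v` for a complex matrix `M` and real vectors `u`, `v`. -/
def bil {ι : Type*} [Fintype ι] (M : Matrix ι ι ℂ) (u v : ι → ℝ) : ℂ :=
  cvec u ⬝ᵥ (M *ᵥ cvec v)

/-- The basic antisymmetric matrix of order two. -/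
def bJ : Matrix (Fin 2) (Fin 2) ℝ := !![0, 1; -1, 0]

/-- The CCR matrix `𝐉 ⊗ I` of a quantum Wiener process with `2 ν` components. -/
def fieldJ (ν : ℕ) : Matrix (Fin 2 × Fin ν) (Fin 2 × Fin ν) ℝ :=
  bJ ⊗ₖ (1 : Matrix (Fin ν) (Fin ν) ℝ)

/-- The quantum Ito matrix `I + i J` of the quantum Wiener process. -/
def itoMatrix (ν : ℕ) : Matrix (Fin 2 × Fin ν) (Fin 2 × Fin ν) ℂ :=
  1 + Complex.I • cmat (fieldJ ν)

/-- The covariance matrix `I₂ + i 𝐉`. -/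
def pairCov : Matrix (Fin 2) (Fin 2) ℂ := 1 + Complex.I • cmat bJ

/-- All eigenvalues have negative real parts. -/
def IsHurwitz {n : ℕ} (A : Matrix (Fin n) (Fin n) ℝ) : Prop :=
  ∀ z ∈ spectrum ℂ (cmat A), z.re < 0

/-- Parameters of an open quantum harmonic oscillator with `n` system variables and `2 ν` input
fields: the CCR matrix `Θ`, the energy matrix `R` and the coupling matrix `M`. -/
structure OQHO (n ν : ℕ) where
  Θ : Matrix (Fin n) (Fin n) ℝ
  R : Matrix (Fin n) (Fin n) ℝ
  M : Matrix (Fin 2 × Fin ν) (Fin n) ℝ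
  antisymm : Θᵀ = -Θ
  nonsing : IsUnit Θ.det
  symm : Rᵀ = R

/-- The drift matrix `A = 2 Θ (R + Mᵀ J M)`. -/
def OQHO.A {n ν : ℕ} (S : OQHO n ν) : Matrix (Fin n) (Fin n) ℝ :=
  (2 : ℝ) • (S.Θ * (S.R + S.Mᵀ * fieldJ ν * S.M))

/-- The dispersion matrix `B = 2 Θ Mᵀ`. -/
def OQHO.B {n ν : ℕ} (S : OQHO n ν) : Matrix (Fin n) (Fin 2 × Fin ν) ℝ :=
  (2 : ℝ) • (S.Θ * S.Mᵀ)

/-- The kernel `K(τ) = exp(τ A) V` for `τ ≥ 0`, and `K(τ) = V exp(-τ Aᵀ)` for `τ < 0`. -/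
def covKernel {n : ℕ} (A : Matrix (Fin n) (Fin n) ℝ) (V : Matrix (Fin n) (Fin n) ℂ) (τ : ℝ) :
    Matrix (Fin n) (Fin n) ℂ :=
  if 0 ≤ τ then cmat (NormedSpace.exp (τ • A)) * V else V * cmat (NormedSpace.exp ((-τ) • Aᵀ))

/-- The inner product `∫₀ᵀ f(t)* g(t) dt`. -/
def ipT {n : ℕ} (T : ℝ) (f g : ℝ → Fin n → ℂ) : ℂ :=
  ∫ t in Set.Icc 0 T, star (f t) ⬝ᵥ g t

/-- The integral operator `(𝒦 g)(s) = ∫₀ᵀ K(s - t) g(t) dt`. -/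
def covOp {n : ℕ} (T : ℝ) (K : ℝ → Matrix (Fin n) (Fin n) ℂ) (g : ℝ → Fin n → ℂ) (s : ℝ) :
    Fin n → ℂ :=
  ∫ t in Set.Icc 0 T, K (s - t) *ᵥ g t

/-- `f` is square integrable over `[0, T]`. -/
def SqInt {E : Type*} [NormedAddCommGroup E] (T : ℝ) (f : ℝ → E) : Prop :=
  MemLp f 2 (volume.restrict (Set.Icc 0 T))

/-- The sequences `μ`, `h` list the eigenvalues (with multiplicities) and orthonormal
eigenfunctions of the integral operator `𝒦`. The last field says that the list is exhaustive up to
eigenfunctions for the eigenvalue zero, which may or may not be listed. -/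
structure IsEigenSystem {n : ℕ} (T : ℝ) (K : ℝ → Matrix (Fin n) (Fin n) ℂ)
    (μ : ℕ → ℝ) (h : ℕ → ℝ → Fin n → ℂ) : Prop where
  sqInt : ∀ k, SqInt T (h k)
  orthonormal : ∀ j k, ipT T (h j) (h k) = if j = k then 1 else 0
  eigen : ∀ k, ∀ s ∈ Set.Icc 0 T, covOp T K (h k) s = (μ k : ℂ) • h k s
  exhaustive : ∀ g : ℝ → Fin n → ℂ, SqInt T g → (∀ k, ipT T (h k) g = 0) →
    ∀ s ∈ Set.Icc 0 T, covOp T K g s = 0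

/-! ### Quantum states -/

section Hilbert

variable {H : Type*} [NormedAddCommGroup H] [InnerProductSpace ℂ H] [CompleteSpace H]

/-- A density operator `ρ = ∑ j, w j |v j⟩⟨v j|`, given as a countable convex combination of
projections onto unit vectors. -/
structure DensityOp (H : Type*) [NormedAddCommGroup H] [InnerProductSpace ℂ H] where
  w : ℕ → ℝ
  v : ℕ → H
  w_nonneg : ∀ j, 0 ≤ w j
  w_sum : HasSum w 1
  v_unit : ∀ j, ‖v j‖ = 1

/-- The expectation `Tr (ρ F) = ∑ j, w j ⟨v j, F v j⟩` of an everywhere defined operator. -/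
def DensityOp.expect (ρ : DensityOp H) (F : H → H) : ℂ :=
  ∑' j, (ρ.w j : ℂ) * ⟪ρ.v j, F (ρ.v j)⟫_ℂ

/-- The value of a partially defined operator, extended by zero outside the domain. -/
def evalAt (Y : H →ₗ.[ℂ] H) (x : H) : H :=
  open Classical in if hx : x ∈ Y.domain then Y ⟨x, hx⟩ else 0

/-- All vectors of the ensemble that occur with a nonzero weight are in the domain. -/
def DensityOp.InDomain (ρ : DensityOp H) (Y : H →ₗ.[ℂ] H) : Prop :=
  ∀ j, ρ.w j ≠ 0 → ρ.v j ∈ Y.domain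

/-- `𝔼 Y = c`. -/
def DensityOp.HasMean (ρ : DensityOp H) (Y : H →ₗ.[ℂ] H) (c : ℂ) : Prop :=
  ρ.InDomain Y ∧ HasSum (fun j => (ρ.w j : ℂ) * ⟪ρ.v j, evalAt Y (ρ.v j)⟫_ℂ) c

/-- `𝔼 (Y Z) = c` for symmetric operators `Y`, `Z`, where `⟨v, Y Z v⟩` is read as
`⟨Y v, Z v⟩`. -/
def DensityOp.HasCov (ρ : DensityOp H) (Y Z : H →ₗ.[ℂ] H) (c : ℂ) : Prop :=
  ρ.InDomain Y ∧ ρ.InDomain Z ∧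
    HasSum (fun j => (ρ.w j : ℂ) * ⟪evalAt Y (ρ.v j), evalAt Z (ρ.v j)⟫_ℂ) c

/-- Mean square convergence `𝔼 ((Yₙ - Y)† (Yₙ - Y)) → 0`. -/
def DensityOp.MSTendsto (ρ : DensityOp H) (Yn : ℕ → H →ₗ.[ℂ] H) (Y : H →ₗ.[ℂ] H) : Prop :=
  (∀ N, ρ.InDomain (Yn N)) ∧ ρ.InDomain Y ∧ ∃ r : ℕ → ℝ,
    (∀ N, HasSum (fun j => ρ.w j * ‖evalAt (Yn N) (ρ.v j) - evalAt Y (ρ.v j)‖ ^ 2) (r N)) ∧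
    Tendsto r atTop (𝓝 0)

/-- The strong sum of a series of unbounded operators: its domain consists of those vectors in all
the domains at which the partial sums converge. -/
def opSeries (Y : ℕ → H →ₗ.[ℂ] H) : H →ₗ.[ℂ] H where
  domain :=
    { carrier := {x | (∀ k, x ∈ (Y k).domain) ∧
        ∃ y, Tendsto (fun N => ∑ k ∈ Finset.range N, evalAt (Y k) x) atTop (𝓝 y)}
      zero_mem' := by
        refine ⟨fun k => (Y k).domain.zero_mem, 0, ?_⟩
        have h0 : ∀ k, evalAt (Y k) (0 : H) = 0 := by
          intro k
          unfold evalAt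
          rw [dif_pos (Y k).domain.zero_mem]
          exact (Y k).map_zero
        simp [h0]
      add_mem' := by
        rintro x y ⟨hx, a, ha⟩ ⟨hy, b, hb⟩
        refine ⟨fun k => (Y k).domain.add_mem (hx k) (hy k), a + b, ?_⟩
        refine (ha.add hb).congr fun N => ?_
        rw [← Finset.sum_add_distrib]
        refine Finset.sum_congr rfl fun k _ => ?_
        unfold evalAt
        rw [dif_pos (hx k), dif_pos (hy k), dif_pos ((Y k).domain.add_mem (hx k) (hy k))]
        exact ((Y k).map_add ⟨x, hx k⟩ ⟨y, hy k⟩).symm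
      smul_mem' := by
        rintro c x ⟨hx, a, ha⟩
        refine ⟨fun k => (Y k).domain.smul_mem c (hx k), c • a, ?_⟩
        refine (ha.const_smul c).congr fun N => ?_
        rw [Finset.smul_sum]
        refine Finset.sum_congr rfl fun k _ => ?_
        unfold evalAt
        rw [dif_pos (hx k), dif_pos ((Y k).domain.smul_mem c (hx k))]
        exact ((Y k).map_smul c ⟨x, hx k⟩).symm }
  toFun :=
    { toFun := fun x => limUnder atTop (fun N => ∑ k ∈ Finset.range N, evalAt (Y k) (x : H))
      map_add' := by
        rintro ⟨x, hx, a, ha⟩ ⟨y, hy, b, hb⟩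
        rw [Tendsto.limUnder_eq ha, Tendsto.limUnder_eq hb]
        refine Tendsto.limUnder_eq ((ha.add hb).congr fun N => ?_)
        rw [← Finset.sum_add_distrib]
        refine Finset.sum_congr rfl fun k _ => ?_
        change _ = evalAt (Y k) (x + y)
        unfold evalAt
        rw [dif_pos (hx k), dif_pos (hy k), dif_pos ((Y k).domain.add_mem (hx k) (hy k))]
        exact ((Y k).map_add ⟨x, hx k⟩ ⟨y, hy k⟩).symm
      map_smul' := by
        rintro c ⟨x, hx, a, ha⟩
        rw [Tendsto.limUnder_eq ha]
        refine Tendsto.limUnder_eq ((ha.const_smul c).congr fun N => ?_)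
        rw [Finset.smul_sum]
        refine Finset.sum_congr rfl fun k _ => ?_
        change _ = evalAt (Y k) (c • x)
        unfold evalAt
        rw [dif_pos (hx k), dif_pos ((Y k).domain.smul_mem c (hx k))]
        exact ((Y k).map_smul c ⟨x, hx k⟩).symm }

/-! ### Canonical commutation relations in the Weyl form -/

/-- A representation of the Weyl CCRs over a real vector space `E` with a form `σ`: unitary
operators `op x = exp(i Φ(x))`, depending strongly continuously on `x` along lines, where the
self-adjoint operators `Φ(x)` have the commutators `[Φ(x), Φ(y)] = 2 i σ(x, y)`. -/
structure WeylSystem (E : Type*) [AddCommGroup E] [Module ℝ E] (σ : E → E → ℝ)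
    (H : Type*) [NormedAddCommGroup H] [InnerProductSpace ℂ H] [CompleteSpace H] where
  op : E → H →L[ℂ] H
  unitary_op : ∀ x, op x ∈ unitary (H →L[ℂ] H)
  op_mul : ∀ x y, op x * op y = Complex.exp (-(Complex.I * (σ x y : ℂ))) • op (x + y)
  continuous_op : ∀ x z, Continuous fun s : ℝ => op (s • x) z

/-- The self-adjoint operator `Φ(x)`: the generator of the strongly continuous unitary group
`s ↦ op (s x) = exp(i s Φ(x))`, with its natural domain. -/
def WeylSystem.gen {E : Type*} [AddCommGroup E] [Module ℝ E] {σ : E → E → ℝ}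
    (W : WeylSystem E σ H) (x : E) : H →ₗ.[ℂ] H where
  domain :=
    { carrier := {z | DifferentiableAt ℝ (fun s : ℝ => W.op (s • x) z) 0}
      zero_mem' := by simp
      add_mem' := by
        intro a b ha hb
        simpa using DifferentiableAt.fun_add ha hb
      smul_mem' := by
        intro c a ha
        simpa using DifferentiableAt.fun_const_smul ha c }
  toFun :=
    { toFun := fun z => (-Complex.I) • deriv (fun s : ℝ => W.op (s • x) (z : H)) 0
      map_add' := by
        rintro ⟨a, ha⟩ ⟨b, hb⟩
        have : deriv (fun s : ℝ => W.op (s • x) (a + b)) 0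
            = deriv (fun s : ℝ => W.op (s • x) a) 0 + deriv (fun s : ℝ => W.op (s • x) b) 0 := by
          simpa using deriv_fun_add ha hb
        simp only [AddMemClass.mk_add_mk]
        rw [this, smul_add]
      map_smul' := by
        rintro c ⟨a, ha⟩
        have : deriv (fun s : ℝ => W.op (s • x) (c • a)) 0
            = c • deriv (fun s : ℝ => W.op (s • x) a) 0 := by
          simpa using deriv_fun_const_smul c ha
        simp only [SetLike.mk_smul_mk, RingHom.id_apply]
        rw [this, smul_comm] }

/-! ### A sequence of position-momentum pairs -/

/-- Coefficients of finite linear combinations `∑ k, u kᵀ ζ k`. -/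
abbrev SeqCoef := ℕ →₀ (Fin 2 → ℝ)

/-- The form `∑ k, u kᵀ 𝐉 v k`, which encodes `[ζ j, ζ kᵀ] = 2 i δ_{jk} 𝐉`. -/
def seqForm (u v : SeqCoef) : ℝ := u.sum fun k a => a ⬝ᵥ (bJ *ᵥ v k)

/-- A sequence of pairs `ζ k = (ξ k, η k)` of self-adjoint operators with the CCRs
`[ζ j, ζ kᵀ] = 2 i δ_{jk} 𝐉`; here `op u = exp(i ∑ k, u kᵀ ζ k)`. -/
abbrev PairSystem (H : Type*) [NormedAddCommGroup H] [InnerProductSpace ℂ H] [CompleteSpace H] :=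
  WeylSystem SeqCoef seqForm H

namespace PairSystem

variable (W : PairSystem H) (ρ : DensityOp H)

/-- The operators `ζ k 0 = ξ k` and `ζ k 1 = η k`. -/
def ζ (k : ℕ) (b : Fin 2) : H →ₗ.[ℂ] H := W.gen (Finsupp.single k (Pi.single b 1))

/-- The annihilation operator `γ k = ξ k + i η k`. -/
def γ (k : ℕ) : H →ₗ.[ℂ] H := W.ζ k 0 + Complex.I • W.ζ k 1

/-- The adjoint `γ k† = ξ k - i η k` (on the common domain of `ξ k` and `η k`). -/
def γdag (k : ℕ) : H →ₗ.[ℂ] H := W.ζ k 0 + (-Complex.I) • W.ζ k 1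

/-- `Re (c γ k) = (c γ k + (c γ k)†) / 2`. -/
def reγ (c : ℂ) (k : ℕ) : H →ₗ.[ℂ] H :=
  (1 / 2 : ℂ) • (c • W.γ k + (conj c) • W.γdag k)

/-- The pairs `ζ k` are statistically independent: their joint characteristic function
factorizes. -/
def Independent : Prop :=
  ∀ u : SeqCoef, ρ.expect (W.op u) =
    ∏ k ∈ u.support, ρ.expect (W.op (Finsupp.single k (u k)))

/-- `ζ k` is in the Gaussian quantum state with zero mean and quantum covariance matrix `Γ`. -/
def IsGaussian (Γ : Matrix (Fin 2) (Fin 2) ℂ) (k : ℕ) : Prop :=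
  ∀ a : Fin 2 → ℝ, ρ.expect (W.op (Finsupp.single k a)) = Complex.exp (-(bil Γ a a / 2))

/-- The truncation of a sequence of coefficients to its first `N` members. -/
def trunc (c : ℕ → Fin 2 → ℝ) (N : ℕ) : SeqCoef :=
  ∑ k ∈ Finset.range N, Finsupp.single k (c k)

/-- The exponential `exp(i ∑ k, c kᵀ ζ k)` of an infinite series, as the strong limit of the
exponentials of the partial sums. -/
def expSeries (c : ℕ → Fin 2 → ℝ) (x : H) : H :=
  limUnder atTop fun N => W.op (trunc c N) x

/-- The vectors obtained from the ensemble of the state by the Weyl operators. -/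
def coherent : Set H := {x | ∃ u j, ρ.w j ≠ 0 ∧ x = W.op u (ρ.v j)}

/-- The closed subspace generated from the state by the operators `ζ k`. The state does not see
anything outside this subspace, on which infinite series need not converge. -/
def space : Submodule ℂ H := (Submodule.span ℂ (coherent W ρ)).topologicalClosure

/-- On the subspace generated by the state, the exponentials of the partial sums of
`∑ k, s c kᵀ ζ k` converge strongly for every real `s`, and the limits form a strongly continuous
group of isometries `exp(i s Y)`, whose generator agrees with `Y` on the vectors of `coherent`. -/
structure Exponentiates (c : ℕ → Fin 2 → ℝ) (Y : H → H) : Prop where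
  tendsto : ∀ s : ℝ, ∀ x ∈ space W ρ,
    Tendsto (fun N => W.op (trunc (s • c) N) x) atTop (𝓝 (expSeries W (s • c) x))
  maps : ∀ s : ℝ, ∀ x ∈ space W ρ, expSeries W (s • c) x ∈ space W ρ
  norm : ∀ s : ℝ, ∀ x ∈ space W ρ, ‖expSeries W (s • c) x‖ = ‖x‖
  group : ∀ s t : ℝ, ∀ x ∈ space W ρ,
    expSeries W ((s + t) • c) x = expSeries W (s • c) (expSeries W (t • c) x)
  cont : ∀ x ∈ space W ρ, Continuous fun s : ℝ => expSeries W (s • c) x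
  gen : ∀ x ∈ coherent W ρ,
    HasDerivAt (fun s : ℝ => expSeries W (s • c) x) (Complex.I • Y x) 0

/-- The `k`-th term `√μ_k Re (h_k(t) γ_k)`, `a`-th entry. -/
def qklTerm {n : ℕ} (μ : ℕ → ℝ) (h : ℕ → ℝ → Fin n → ℂ) (t : ℝ) (a : Fin n) (k : ℕ) :
    H →ₗ.[ℂ] H :=
  ((√(μ k) : ℝ) : ℂ) • W.reγ (h k t a) k

/-- The `a`-th entry of the process `X(t) = ∑ k, √μ_k Re (h_k(t) γ_k)`. -/
def qkl {n : ℕ} (μ : ℕ → ℝ) (h : ℕ → ℝ → Fin n → ℂ) (t : ℝ) (a : Fin n) : H →ₗ.[ℂ] H :=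
  opSeries (W.qklTerm μ h t a)

end PairSystem

end Hilbert

/-- The coefficients of `uᵀ X(t) = ∑ k, √μ_k (uᵀ φ_k(t) ξ_k - uᵀ ψ_k(t) η_k)`, where
`h_k = φ_k + i ψ_k`. -/
def qklCoef {n : ℕ} (μ : ℕ → ℝ) (h : ℕ → ℝ → Fin n → ℂ) (t : ℝ) (u : Fin n → ℝ) :
    ℕ → Fin 2 → ℝ :=
  fun k => ![√(μ k) * ∑ a, u a * (h k t a).re, -(√(μ k) * ∑ a, u a * (h k t a).im)]

/-- The coefficients of `∫₀ᵀ f(t)ᵀ X(t) dt`. -/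
def qklIntCoef {n : ℕ} (T : ℝ) (μ : ℕ → ℝ) (h : ℕ → ℝ → Fin n → ℂ) (f : ℝ → Fin n → ℝ) :
    ℕ → Fin 2 → ℝ :=
  fun k b => ∫ t in Set.Icc 0 T, qklCoef μ h t (f t) k b

/-! ### Multipoint characteristic functions -/

/-- The ordered multipoint function `𝔼 (exp(i u₁ᵀ X(t₁)) ⋯ exp(i u_Nᵀ X(t_N)))`, where
`ex t u` stands for `exp(i uᵀ X(t))`. -/
def orderedQCF {n : ℕ} {H : Type*} [NormedAddCommGroup H] [InnerProductSpace ℂ H]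
    [CompleteSpace H] (ρ : DensityOp H) (ex : ℝ → (Fin n → ℝ) → H → H)
    (l : List (ℝ × (Fin n → ℝ))) : ℂ :=
  ρ.expect fun x => l.foldr (fun p y => ex p.1 p.2 y) x

/-- The exponent `½ ∑ⱼ uⱼᵀ K(0) uⱼ + ∑_{j<k} uⱼᵀ K(tⱼ - t_k) u_k`. -/
def orderedExponent {n : ℕ} (K : ℝ → Matrix (Fin n) (Fin n) ℂ) : List (ℝ × (Fin n → ℝ)) → ℂ
  | [] => 0
  | p :: l => bil (K 0) p.2 p.2 / 2 + (l.map fun q => bil (K (p.1 - q.1)) p.2 q.2).sum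
      + orderedExponent K l

/-- The exponent `½ ∑_{j,k} uⱼᵀ K(tⱼ - t_k) u_k`. -/
def jointExponent {n : ℕ} (K : ℝ → Matrix (Fin n) (Fin n) ℂ) (l : List (ℝ × (Fin n → ℝ))) : ℂ :=
  (l.map fun p => (l.map fun q => bil (K (p.1 - q.1)) p.2 q.2).sum).sum / 2

/-! ### The oscillator driven by the quantum Wiener process -/

/-- The space `L²([0,∞), ℝ^{2ν})` of integrands for the quantum Wiener process. -/
abbrev FieldSpace (ν : ℕ) : Type :=
  Lp (EuclideanSpace ℝ (Fin 2 × Fin ν)) 2 (volume.restrict (Set.Ici (0 : ℝ)))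

namespace OQHO

variable {n ν : ℕ} (S : OQHO n ν)

/-- The form encoding `[X₀, X₀ᵀ] = 2 i Θ`, `[X₀, W(t)ᵀ] = 0`, `[dW, dWᵀ] = 2 i J dt`. -/
def form (x y : (Fin n → ℝ) × FieldSpace ν) : ℝ :=
  x.1 ⬝ᵥ (S.Θ *ᵥ y.1) +
    ∫ s in Set.Ici (0 : ℝ), (x.2 s).ofLp ⬝ᵥ (fieldJ ν *ᵥ (y.2 s).ofLp)

/-- Initial system variables `X₀` and a quantum Wiener process `W` on a common Hilbert space; here
`op (x, g) = exp(i (xᵀ X₀ + ∫₀^∞ g(s)ᵀ dW(s)))`. -/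
abbrev Model (H : Type*) [NormedAddCommGroup H] [InnerProductSpace ℂ H] [CompleteSpace H] :=
  WeylSystem ((Fin n → ℝ) × FieldSpace ν) S.form H

/-- The function `s ↦ Bᵀ exp((t - s) Aᵀ) u` on `(0, t]`, extended by zero. -/
def respFun (t : ℝ) (u : Fin n → ℝ) : ℝ → EuclideanSpace ℝ (Fin 2 × Fin ν) :=
  (Set.Ioc 0 t).indicator fun s =>
    WithLp.toLp 2 (S.Bᵀ *ᵥ (NormedSpace.exp ((t - s) • S.Aᵀ) *ᵥ u))

open scoped Matrix.Norms.Operator in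
theorem continuous_exp_smul {n : ℕ} (A : Matrix (Fin n) (Fin n) ℝ) (t : ℝ) :
    Continuous fun s : ℝ => NormedSpace.exp ((t - s) • A) := by
  have h : Continuous fun x : Matrix (Fin n) (Fin n) ℝ => NormedSpace.exp x :=
    NormedSpace.exp_continuous
  exact h.comp (by fun_prop)

theorem memLp_respFun (t : ℝ) (u : Fin n → ℝ) :
    MemLp (S.respFun t u) 2 (volume.restrict (Set.Ici (0 : ℝ))) := by
  have hc : Continuous fun s : ℝ => (WithLp.toLp 2
      (S.Bᵀ *ᵥ (NormedSpace.exp ((t - s) • S.Aᵀ) *ᵥ u)) :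
      EuclideanSpace ℝ (Fin 2 × Fin ν)) := by
    refine (PiLp.continuous_toLp 2 _).comp ?_
    exact Continuous.matrix_mulVec continuous_const
      (Continuous.matrix_mulVec (continuous_exp_smul _ t) continuous_const)
  unfold respFun
  rw [memLp_indicator_iff_restrict measurableSet_Ioc]
  obtain ⟨C, hC⟩ := (isCompact_Icc (a := (0 : ℝ)) (b := t)).exists_bound_of_continuousOn
    hc.continuousOn
  have hfin : IsFiniteMeasure
      ((volume.restrict (Set.Ici (0 : ℝ))).restrict (Set.Ioc 0 t)) := by
    refine ⟨?_⟩
    rw [Measure.restrict_apply_univ]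
    exact lt_of_le_of_lt (Measure.restrict_apply_le _ _) (by simp)
  refine MemLp.of_bound hc.aestronglyMeasurable C ?_
  filter_upwards [ae_restrict_mem measurableSet_Ioc] with s hs
  exact hC s ⟨hs.1.le, hs.2⟩

/-- The element representing `uᵀ X(t)` for the solution
`X(t) = exp(t A) X₀ + ∫₀ᵗ exp((t - s) A) B dW(s)` of `dX = A X dt + B dW`. -/
def elem (t : ℝ) (u : Fin n → ℝ) : (Fin n → ℝ) × FieldSpace ν :=
  (NormedSpace.exp (t • S.Aᵀ) *ᵥ u, (S.memLp_respFun t u).toLp _)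

/-- The input fields are in the vacuum state, independent of the initial system variables, and the
state of the system variables is invariant in time. -/
structure IsInvariantVacuum {H : Type*} [NormedAddCommGroup H] [InnerProductSpace ℂ H]
    [CompleteSpace H] (Z : S.Model H) (ρ : DensityOp H) : Prop where
  vacuum : ∀ g : FieldSpace ν, ρ.expect (Z.op (0, g)) = Complex.exp (-((‖g‖ : ℂ) ^ 2 / 2))
  product : ∀ (x : Fin n → ℝ) (g : FieldSpace ν),
    ρ.expect (Z.op (x, g)) = ρ.expect (Z.op (x, 0)) * ρ.expect (Z.op (0, g))
  invariant : ∀ t : ℝ, 0 ≤ t → ∀ u : Fin n → ℝ,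
    ρ.expect (Z.op (S.elem t u)) = ρ.expect (Z.op (S.elem 0 u))

end OQHO

end

/-! The whole state is encoded in complex inner products: real parts are covariances, imaginary
parts are commutators. It suffices to represent both processes by Hilbert space vectors with the
same Gram matrix `K(s - t)`, and to know that each state has the characteristic function `exp(-‖z‖²
/ 2)` in terms of the representing vector `z`.

On the oscillator side, `I + iJ` is twice an orthogonal projection and `A` is Hurwitz, so that `V`
is positive semidefinite and factors as `Dᴴ D`, with imaginary part `Θ`. The map `feature` then
turns the commutation form into the imaginary part of an inner product (`im_inner_feature`), and
integrating the Lyapunov equation up to `min s t` shows that the vectors of the system variables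
have the Gram matrix `K(s - t)` (`inner_feature_elem`).

Mercer's expansion follows from this factorization. If `Φ` integrates a function against the feature
vectors `F t a`, then `𝒦 = Φ* Φ`; the normalized vectors `Φ h_k` with `μ_k ≠ 0` are orthonormal, and
exhaustiveness puts every `F t a` into their closed span. Parseval's identity for two such vectors
is Mercer's expansion, pointwise (`mercer`). Hence the sequences `√μ_k conj(h_k(t))` are in `ℓ²` and
again have the Gram matrix `K(s - t)`.

On the side of the pairs, independence and Gaussianity give the vacuum characteristic function.
Together with the Weyl relations it makes the Weyl operators, applied to the purified state, produce
normalized coherent vectors: their inner products are those of Fock space (`inner_purified`).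
Convergence and derivatives of the exponentials can therefore be read off from Gram matrices. The
derivatives at the state form an isometric copy of `ℓ²` (`oneParticle`), which yields the domains,
means, covariances and mean square convergence. An explicit quadratic remainder
(`norm_purified_sub_le`) is uniform in the truncation and identifies the generators of the limiting
groups.

Ordered products of exponentials only add phases `Im ⟨z_j, z_k⟩`, which combine with the norm of the
sum into the ordered exponent. For the oscillator, the law of the initial variables is forced by
invariance: as time tends to infinity the initial contribution disappears and only the noise
variance remains (`expect_op_initial`). -/

noncomputable section

/-! ### Decay of the exponential of a Hurwitz matrix. -/

section MatrixExponential

variable {n : ℕ}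

-- The exponential series terminates on a vector killed by a power of the matrix. Applied to `A - z`
-- on the generalized eigenspace of `A` for `z`.
open scoped Matrix.Norms.Operator in
theorem exp_smul_mulVec_of_pow_mulVec_eq_zero (N : Matrix (Fin n) (Fin n) ℂ) (k : ℕ)
    (x : Fin n → ℂ) (hx : (N ^ k) *ᵥ x = 0) (t : ℝ) :
    NormedSpace.exp (t • N) *ᵥ x
      = ∑ j ∈ Finset.range k, ((t : ℂ) ^ j * ((j.factorial : ℂ))⁻¹) • ((N ^ j) *ᵥ x) := by
  have h1 := NormedSpace.exp_series_hasSum_exp' (𝕂 := ℂ) (t • N)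
  let L : Matrix (Fin n) (Fin n) ℂ →L[ℂ] (Fin n → ℂ) :=
    LinearMap.toContinuousLinearMap ((Matrix.mulVecBilin ℂ ℂ).flip x)
  have h2 := h1.mapL L
  have h3 : ∀ j, L (((j.factorial : ℂ))⁻¹ • (t • N) ^ j)
      = ((t : ℂ) ^ j * ((j.factorial : ℂ))⁻¹) • ((N ^ j) *ᵥ x) := by
    intro j
    change (((j.factorial : ℂ))⁻¹ • (t • N) ^ j) *ᵥ x = _
    rw [smul_pow, ← Complex.coe_smul, smul_smul, Matrix.smul_mulVec, Complex.ofReal_pow, mul_comm]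
  simp_rw [h3] at h2
  refine h2.unique (hasSum_sum_of_ne_finset_zero ?_)
  intro j hj
  have : k ≤ j := by simpa using hj
  have h0 : (N ^ j) *ᵥ x = 0 := by
    rw [← Nat.sub_add_cancel this, pow_add, ← Matrix.mulVec_mulVec, hx, Matrix.mulVec_zero]
  rw [h0, smul_zero]

theorem tendsto_cexp_mul_pow {z : ℂ} (hz : z.re < 0) (j : ℕ) :
    Tendsto (fun t : ℝ => Complex.exp (t * z) * (t : ℂ) ^ j) atTop (𝓝 0) := by
  rw [tendsto_zero_iff_norm_tendsto_zero]
  have h := Real.tendsto_pow_mul_exp_neg_atTop_nhds_zero j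
  -- Substitute `-t Re z` into the real limit `s ^ j * exp(-s) → 0`; the constant factor undoes the
  -- scaling of the power.
  have h2 := (h.comp (tendsto_id.atTop_mul_const (neg_pos.2 hz))).const_mul (((-z.re)⁻¹) ^ j)
  rw [mul_zero] at h2
  refine h2.congr' ?_
  filter_upwards [eventually_ge_atTop 0] with t ht
  have hz' : -z.re ≠ 0 := (neg_pos.2 hz).ne'
  simp only [Function.comp, norm_mul, Complex.norm_exp, norm_pow, Complex.norm_real,
    Real.norm_eq_abs, abs_of_nonneg ht, id, Complex.mul_re, Complex.ofReal_re,
    Complex.ofReal_im, zero_mul, sub_zero, mul_neg, neg_neg]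
  rw [mul_comm (Real.exp _), ← mul_assoc]
  congr 1
  rw [← mul_pow]
  congr 1
  field_simp [hz.ne]

theorem exp_smul_eq_of_sub_scalar (A : Matrix (Fin n) (Fin n) ℂ) (z : ℂ) (t : ℝ) :
    NormedSpace.exp (t • A)
      = Complex.exp (t * z) • NormedSpace.exp (t • (A - algebraMap ℂ _ z)) := by
  have h1 : t • A = t • (A - algebraMap ℂ _ z) + algebraMap ℂ _ (t * z) := by
    rw [smul_sub, map_mul, ← Algebra.smul_def, Complex.coe_smul, sub_add_cancel]
  rw [h1, Matrix.exp_add_of_commute _ _ (Algebra.commutes (A := Matrix (Fin n) (Fin n) ℂ) _ _).symm]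
  have h2 : (algebraMap ℂ (Matrix (Fin n) (Fin n) ℂ)) (t * z) = Matrix.diagonal fun _ => t * z :=
    rfl
  rw [h2, Matrix.exp_diagonal, Pi.exp_def]
  simp only [← Complex.exp_eq_exp_ℂ]
  ext i j
  rw [Matrix.mul_diagonal, Matrix.smul_apply, smul_eq_mul, mul_comm]

/-- The generalized eigenvectors span the space, and on each of them `exp(t A)` acts as `exp(t z)`
times a polynomial in `t`. -/
theorem tendsto_exp_smul_mulVec (A : Matrix (Fin n) (Fin n) ℂ)
    (hA : ∀ z ∈ spectrum ℂ A, z.re < 0) (x : Fin n → ℂ) :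
    Tendsto (fun t : ℝ => NormedSpace.exp (t • A) *ᵥ x) atTop (𝓝 0) := by
  have hx : x ∈ (⨆ z : ℂ, Module.End.maxGenEigenspace (Matrix.toLin' A) z) := by
    rw [Module.End.iSup_maxGenEigenspace_eq_top]; trivial
  refine Submodule.iSup_induction _ (motive := fun x => Tendsto
    (fun t : ℝ => NormedSpace.exp (t • A) *ᵥ x) atTop (𝓝 0)) hx ?_ ?_ ?_
  · intro z x hx
    obtain ⟨k, hk⟩ := (Module.End.mem_maxGenEigenspace _ _ _).1 hx
    have hN : ((A - algebraMap ℂ _ z) ^ k) *ᵥ x = 0 := by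
      have e : Matrix.toLin' A - z • 1 = Matrix.toLin' (A - algebraMap ℂ _ z) := by
        rw [map_sub, Algebra.algebraMap_eq_smul_one, map_smul, Matrix.toLin'_one]; rfl
      rw [e, ← Matrix.toLin'_pow, Matrix.toLin'_apply] at hk
      exact hk
    by_cases hz : z ∈ spectrum ℂ A
    · simp_rw [exp_smul_eq_of_sub_scalar A z, Matrix.smul_mulVec,
        exp_smul_mulVec_of_pow_mulVec_eq_zero _ k x hN, Finset.smul_sum, smul_smul, ← mul_assoc]
      have : (0 : Fin n → ℂ) = ∑ j ∈ Finset.range k, ((0 : ℂ) * ((j.factorial : ℂ))⁻¹) •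
          (((A - algebraMap ℂ _ z) ^ j) *ᵥ x) := by simp
      rw [this]
      exact tendsto_finsetSum _ fun j _ =>
        ((tendsto_cexp_mul_pow (hA z hz) j).mul_const _).smul_const _
    -- For `z` outside the spectrum, `(A - z) ^ k` is invertible and the generalized eigenspace is
    -- zero.
    · rw [spectrum.notMem_iff, ← IsUnit.neg_iff, neg_sub] at hz
      have := hz.pow k
      have h0 : x = 0 := by
        apply Matrix.mulVec_injective_of_isUnit this
        simpa using hN
      simp [h0]
  · simp
  · intro x y hx hy
    simpa [Matrix.mulVec_add] using hx.add hy

/-- The complexified propagator `exp(t A)`. -/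
def cexpm (A : Matrix (Fin n) (Fin n) ℝ) (t : ℝ) : Matrix (Fin n) (Fin n) ℂ :=
  cmat (NormedSpace.exp (t • A))

theorem cmat_mul {ι κ l : Type*} [Fintype κ] (M : Matrix ι κ ℝ) (N : Matrix κ l ℝ) :
    cmat (M * N) = cmat M * cmat N :=
  Matrix.map_mul (f := Complex.ofRealHom)

theorem cmat_transpose {ι κ : Type*} (M : Matrix ι κ ℝ) : cmat Mᵀ = (cmat M)ᵀ := rfl

theorem cmat_conjTranspose {ι κ : Type*} (M : Matrix ι κ ℝ) : (cmat M)ᴴ = (cmat M)ᵀ := by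
  ext; simp [cmat]

theorem cexpm_zero (A : Matrix (Fin n) (Fin n) ℝ) : cexpm A 0 = 1 := by
  simp [cexpm, cmat, NormedSpace.exp_zero]

theorem exp_smul_transpose (A : Matrix (Fin n) (Fin n) ℝ) (t : ℝ) :
    NormedSpace.exp (t • Aᵀ) = (NormedSpace.exp (t • A))ᵀ := by
  rw [← Matrix.exp_transpose, Matrix.transpose_smul]

theorem cmat_exp_transpose (A : Matrix (Fin n) (Fin n) ℝ) (t : ℝ) :
    cmat (NormedSpace.exp (t • Aᵀ)) = (cexpm A t)ᵀ := by
  rw [exp_smul_transpose]; rfl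

open scoped Matrix.Norms.Operator in
theorem cexpm_eq (A : Matrix (Fin n) (Fin n) ℝ) (t : ℝ) :
    cexpm A t = NormedSpace.exp (t • cmat A) := by
  have hc : Continuous (Complex.ofRealHom.mapMatrix : Matrix (Fin n) (Fin n) ℝ →+* _) :=
    continuous_id.matrix_map Complex.continuous_ofReal
  have := NormedSpace.map_exp (Complex.ofRealHom.mapMatrix : Matrix (Fin n) (Fin n) ℝ →+* _) hc
    (t • A)
  refine this.trans ?_
  congr 1
  ext i j
  simp [cmat]

open scoped Matrix.Norms.Operator in
theorem hasDerivAt_cexpm (A : Matrix (Fin n) (Fin n) ℝ) (t : ℝ) :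
    HasDerivAt (cexpm A) (cexpm A t * cmat A) t := by
  have h : cexpm A = fun t => NormedSpace.exp (t • cmat A) := funext (cexpm_eq A)
  rw [h]
  exact hasDerivAt_exp_smul_const (𝕂 := ℝ) (cmat A) t

theorem hasDerivAt_cexpm_entry (A : Matrix (Fin n) (Fin n) ℝ) (t : ℝ) (a b : Fin n) :
    HasDerivAt (fun t => cexpm A t a b) ((cexpm A t * cmat A) a b) t := by
  open scoped Matrix.Norms.Operator in
  exact ((Matrix.entryLinearMap ℝ ℂ a b).toContinuousLinearMap.hasFDerivAt).comp_hasDerivAt t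
    (hasDerivAt_cexpm A t)

theorem continuous_cexpm (A : Matrix (Fin n) (Fin n) ℝ) : Continuous (cexpm A) :=
  continuous_matrix fun a b =>
    continuous_iff_continuousAt.2 fun t => (hasDerivAt_cexpm_entry A t a b).continuousAt

theorem tendsto_cexpm {A : Matrix (Fin n) (Fin n) ℝ} (hA : IsHurwitz A) :
    Tendsto (cexpm A) atTop (𝓝 0) := by
  refine tendsto_pi_nhds.2 fun a => tendsto_pi_nhds.2 fun b => ?_
  have h := tendsto_exp_smul_mulVec (cmat A) hA (Pi.single b 1)
  rw [tendsto_pi_nhds] at h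
  simpa [cexpm_eq] using h a

/-! ### The Lyapunov equation and the Ito matrix. -/

section Lyapunov

variable {A : Matrix (Fin n) (Fin n) ℝ}

-- Differentiation brings out the Lyapunov operator between the propagators, which the Lyapunov
-- equation replaces by its source term.
open scoped Matrix.Norms.Operator in
theorem hasDerivAt_propagated (A : Matrix (Fin n) (Fin n) ℝ) (X : Matrix (Fin n) (Fin n) ℂ)
    (s t r : ℝ) (a b : Fin n) :
    HasDerivAt (fun r => (cexpm A (s - r) * X * (cexpm A (t - r))ᵀ) a b)
      ((-(cexpm A (s - r) * (cmat A * X + X * (cmat A)ᵀ) * (cexpm A (t - r))ᵀ)) a b) r := by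
  have h1 : HasDerivAt (fun r => cexpm A (s - r)) (-(cexpm A (s - r) * cmat A)) r := by
    exact HasDerivAt.comp_const_sub s r (hasDerivAt_cexpm A (s - r))
  have h2 : HasDerivAt (fun r => cexpm A (t - r)) (-(cexpm A (t - r) * cmat A)) r := by
    exact HasDerivAt.comp_const_sub t r (hasDerivAt_cexpm A (t - r))
  let L := (Matrix.transposeLinearEquiv (Fin n) (Fin n) ℝ ℂ).toLinearMap.toContinuousLinearMap
  have h3 : HasDerivAt (fun r => (cexpm A (t - r))ᵀ) (-(cexpm A (t - r) * cmat A))ᵀ r :=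
    L.hasFDerivAt.comp_hasDerivAt r h2
  have h4 := (h1.mul_const X).mul h3
  have h5 := ((Matrix.entryLinearMap ℝ ℂ a b).toContinuousLinearMap.hasFDerivAt).comp_hasDerivAt r h4
  refine h5.congr_deriv ?_
  change (-(cexpm A (s - r) * cmat A) * X * (cexpm A (t - r))ᵀ
    + cexpm A (s - r) * X * (-(cexpm A (t - r) * cmat A))ᵀ) a b = _
  refine congrFun (congrFun ?_ a) b
  simp only [Matrix.transpose_neg, Matrix.transpose_mul, Matrix.mul_add, Matrix.add_mul,
    Matrix.neg_mul, Matrix.mul_neg, Matrix.mul_assoc, neg_add]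
  rfl

theorem continuous_propagated (A : Matrix (Fin n) (Fin n) ℝ) (X : Matrix (Fin n) (Fin n) ℂ)
    (s t : ℝ) : Continuous fun r => cexpm A (s - r) * X * (cexpm A (t - r))ᵀ :=
  ((((continuous_cexpm A).comp (continuous_const.sub continuous_id)).matrix_mul
    continuous_const)).matrix_mul
    ((continuous_cexpm A).comp (continuous_const.sub continuous_id)).matrix_transpose

/-- Fundamental theorem of calculus. Different `s` and `t` are needed for two-time covariances; with
`Q = 0` it gives a conservation law. -/
theorem integral_propagated {X Q : Matrix (Fin n) (Fin n) ℂ}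
    (hX : cmat A * X + X * (cmat A)ᵀ + Q = 0) (s t m : ℝ) (a b : Fin n) :
    ∫ r in (0 : ℝ)..m, (cexpm A (s - r) * Q * (cexpm A (t - r))ᵀ) a b
      = (cexpm A (s - m) * X * (cexpm A (t - m))ᵀ) a b - (cexpm A s * X * (cexpm A t)ᵀ) a b := by
  have hQ : Q = -(cmat A * X + X * (cmat A)ᵀ) := (neg_eq_of_add_eq_zero_right hX).symm
  have h := intervalIntegral.integral_eq_sub_of_hasDerivAt (a := 0) (b := m)
    (fun r _ => hasDerivAt_propagated A X s t r a b) ?_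
  · rw [sub_zero, sub_zero] at h
    rw [← h, hQ]
    simp only [Matrix.mul_neg, Matrix.neg_mul]
  · refine Continuous.intervalIntegrable ?_ _ _
    exact (continuous_propagated A _ s t).neg.matrix_elem a b

theorem tendsto_propagated (hA : IsHurwitz A) (X : Matrix (Fin n) (Fin n) ℂ) :
    Tendsto (fun t => cexpm A t * X * (cexpm A t)ᵀ) atTop (𝓝 0) := by
  have hc : Continuous fun M : Matrix (Fin n) (Fin n) ℂ => M * X * Mᵀ :=
    (continuous_id.matrix_mul continuous_const).matrix_mul continuous_id.matrix_transpose
  have h := (hc.tendsto 0).comp (tendsto_cexpm hA)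
  rw [Matrix.zero_mul, Matrix.zero_mul] at h
  exact h

/-- A homogeneous solution is unchanged by propagation, while propagation drives every matrix to
zero. -/
theorem lyapunov_unique (hA : IsHurwitz A) {X : Matrix (Fin n) (Fin n) ℂ}
    (hX : cmat A * X + X * (cmat A)ᵀ = 0) : X = 0 := by
  have h : ∀ t, cexpm A t * X * (cexpm A t)ᵀ = X := by
    intro t
    ext a b
    have := integral_propagated (A := A) (X := X) (Q := 0) (by rw [hX, add_zero]) t t t a b
    simp only [Matrix.mul_zero, Matrix.zero_mul, Matrix.zero_apply, intervalIntegral.integral_zero,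
      sub_self, cexpm_zero, Matrix.one_mul, Matrix.transpose_one, Matrix.mul_one] at this
    exact (sub_eq_zero.1 this.symm).symm
  refine tendsto_nhds_unique ?_ (tendsto_propagated hA X)
  simp_rw [h]
  exact tendsto_const_nhds

theorem bJ_mul_self : bJ * bJ = -1 := by
  ext i j; fin_cases i <;> fin_cases j <;> simp [bJ, Matrix.mul_apply]

theorem bJ_transpose : bJᵀ = -bJ := by
  ext i j; fin_cases i <;> fin_cases j <;> simp [bJ]

theorem fieldJ_mul_self (ν : ℕ) : fieldJ ν * fieldJ ν = -1 := by
  unfold fieldJ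
  rw [← Matrix.mul_kronecker_mul, bJ_mul_self, Matrix.one_mul, ← neg_one_smul ℝ,
    Matrix.smul_kronecker, Matrix.one_kronecker_one, neg_one_smul]

theorem fieldJ_transpose (ν : ℕ) : (fieldJ ν)ᵀ = -fieldJ ν := by
  unfold fieldJ
  rw [← Matrix.kroneckerMap_transpose, bJ_transpose, Matrix.transpose_one, ← neg_one_smul ℝ,
    Matrix.smul_kronecker, neg_one_smul]

theorem cmat_neg {ι κ : Type*} (M : Matrix ι κ ℝ) : cmat (-M) = -cmat M := by
  ext; simp [cmat]

theorem cmat_one {ι : Type*} [DecidableEq ι] : cmat (1 : Matrix ι ι ℝ) = 1 := by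
  ext i j; simp [cmat, Matrix.one_apply]; split_ifs <;> simp

theorem itoMatrix_conjTranspose (ν : ℕ) : (itoMatrix ν)ᴴ = itoMatrix ν := by
  unfold itoMatrix
  rw [Matrix.conjTranspose_add, Matrix.conjTranspose_one, Matrix.conjTranspose_smul,
    cmat_conjTranspose, ← cmat_transpose, fieldJ_transpose, cmat_neg]
  simp

/-- As `J² = -1`, half of the Hermitian matrix `I + iJ` is a projection. This gives both its
positivity and its square root `2^(-1/2) (I + iJ)`. -/
theorem itoMatrix_mul_self (ν : ℕ) : itoMatrix ν * itoMatrix ν = (2 : ℂ) • itoMatrix ν := by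
  have h : cmat (fieldJ ν) * cmat (fieldJ ν) = -1 := by
    rw [← cmat_mul, fieldJ_mul_self, cmat_neg, cmat_one]
  have h2 : Complex.I • cmat (fieldJ ν) * Complex.I • cmat (fieldJ ν) = 1 := by
    rw [Matrix.smul_mul, Matrix.mul_smul, h, smul_smul, Complex.I_mul_I, neg_one_smul, neg_neg]
  unfold itoMatrix
  rw [Matrix.add_mul, Matrix.mul_add, Matrix.mul_add, h2, two_smul, Matrix.one_mul,
    Matrix.one_mul, Matrix.mul_one]
  abel

end Lyapunov

end MatrixExponential

/-! ### The stationary covariance and the one-particle space of the oscillator. -/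

section StationaryCovariance

variable {n ν : ℕ} (S : OQHO n ν)

theorem cmat_add {ι κ : Type*} (M N : Matrix ι κ ℝ) : cmat (M + N) = cmat M + cmat N := by
  ext; simp [cmat]

/-- Preservation of the commutation relations by the dynamics: `Θ` satisfies the Lyapunov equation
whose source is the imaginary part of the source for `V`. -/
theorem OQHO.physical_realizability :
    S.A * S.Θ + S.Θ * S.Aᵀ + S.B * fieldJ ν * S.Bᵀ = 0 := by
  unfold OQHO.A OQHO.B
  simp only [Matrix.transpose_smul, Matrix.transpose_mul, Matrix.transpose_add, S.antisymm, S.symm,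
    fieldJ_transpose, Matrix.transpose_transpose, Matrix.smul_mul, Matrix.mul_smul,
    Matrix.mul_add, Matrix.add_mul, Matrix.mul_neg, Matrix.neg_mul, smul_add, smul_neg, smul_smul,
    Matrix.mul_assoc]
  module

variable {S} {V : Matrix (Fin n) (Fin n) ℂ}

/-- The source is Hermitian, so `Vᴴ` solves the same equation, and solutions are unique. -/
theorem isHermitian_of_lyapunov (hA : IsHurwitz S.A)
    (hV : cmat S.A * V + V * (cmat S.A)ᵀ + cmat S.B * itoMatrix ν * (cmat S.B)ᵀ = 0) :
    V.IsHermitian := by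
  have h := congrArg Matrix.conjTranspose hV
  simp only [Matrix.conjTranspose_add, Matrix.conjTranspose_mul, ← cmat_transpose,
    cmat_conjTranspose, Matrix.transpose_transpose, itoMatrix_conjTranspose,
    Matrix.conjTranspose_zero] at h
  have h2 := lyapunov_unique hA (X := Vᴴ - V) (by
    rw [Matrix.mul_sub, Matrix.sub_mul]
    simp only [← cmat_transpose, Matrix.mul_assoc] at h hV ⊢
    have := congrArg₂ (· - ·) h hV
    simp only [sub_zero] at this
    rw [← this]
    abel)
  exact sub_eq_zero.1 h2

/-- Both sides solve the Lyapunov equation with source `2i B J Bᵀ`, the right-hand side by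
`physical_realizability`. -/
theorem sub_transpose_of_lyapunov (hA : IsHurwitz S.A)
    (hV : cmat S.A * V + V * (cmat S.A)ᵀ + cmat S.B * itoMatrix ν * (cmat S.B)ᵀ = 0) :
    V - Vᵀ = (2 * Complex.I) • cmat S.Θ := by
  have h := congrArg Matrix.transpose hV
  have hJ : (itoMatrix ν)ᵀ = itoMatrix ν - (2 * Complex.I) • cmat (fieldJ ν) := by
    unfold itoMatrix
    rw [Matrix.transpose_add, Matrix.transpose_one, Matrix.transpose_smul, ← cmat_transpose,
      fieldJ_transpose, cmat_neg]
    module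
  have hT := congrArg cmat S.physical_realizability
  have hz : cmat (0 : Matrix (Fin n) (Fin n) ℝ) = 0 := by ext; simp [cmat]
  simp only [cmat_add, cmat_mul, hz] at hT
  simp only [Matrix.transpose_add, Matrix.transpose_mul, Matrix.transpose_transpose, hJ,
    Matrix.transpose_zero, Matrix.mul_sub, Matrix.sub_mul, Matrix.mul_smul, Matrix.smul_mul] at h
  have h2 := lyapunov_unique hA (X := V - Vᵀ - (2 * Complex.I) • cmat S.Θ) (by
    simp only [Matrix.mul_sub, Matrix.sub_mul, Matrix.mul_smul, Matrix.smul_mul]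
    simp only [← cmat_transpose, Matrix.mul_assoc] at h hV hT ⊢
    have e := congrArg₂ (· - ·) (congrArg₂ (· - ·) hV h)
      (congrArg ((2 * Complex.I) • ·) hT)
    simp only [sub_zero, smul_zero] at e
    rw [← e]
    module)
  exact sub_eq_zero.1 h2

theorem cvec_real_dot {ι : Type*} [Fintype ι] (u v : ι → ℝ) :
    cvec u ⬝ᵥ cvec v = ((u ⬝ᵥ v : ℝ) : ℂ) := by
  simp [cvec, dotProduct]

theorem cmat_mulVec_cvec {ι κ : Type*} [Fintype κ] (M : Matrix ι κ ℝ) (v : κ → ℝ) :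
    cmat M *ᵥ cvec v = cvec (M *ᵥ v) := by
  ext i; simp [cmat, cvec, Matrix.mulVec, dotProduct]

theorem bil_swap (M : Matrix (Fin n) (Fin n) ℂ) (u v : Fin n → ℝ) :
    bil M u v = bil Mᵀ v u := by
  unfold bil
  rw [Matrix.mulVec_transpose, Matrix.dotProduct_mulVec, dotProduct_comm]

theorem conj_bil {M : Matrix (Fin n) (Fin n) ℂ} (hM : M.IsHermitian) (u v : Fin n → ℝ) :
    conj (bil M u v) = bil M v u := by
  have hs : ∀ w : Fin n → ℝ, star (cvec w) = cvec w := fun w => by ext i; simp [cvec]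
  have h : conj (bil M u v) = star (cvec u ⬝ᵥ (M *ᵥ cvec v)) := rfl
  rw [h, ← Matrix.star_dotProduct_star, Matrix.star_mulVec, hM.eq, hs, hs, bil,
    Matrix.dotProduct_mulVec]

theorem im_bil_of_lyapunov (hA : IsHurwitz S.A)
    (hV : cmat S.A * V + V * (cmat S.A)ᵀ + cmat S.B * itoMatrix ν * (cmat S.B)ᵀ = 0)
    (u v : Fin n → ℝ) : (bil V u v).im = u ⬝ᵥ (S.Θ *ᵥ v) := by
  have h1 := conj_bil (isHermitian_of_lyapunov hA hV) u v
  rw [bil_swap V v u] at h1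
  have h2 : bil V u v - bil Vᵀ u v = 2 * Complex.I * ((u ⬝ᵥ (S.Θ *ᵥ v) : ℝ) : ℂ) := by
    unfold bil
    rw [← dotProduct_sub, ← Matrix.sub_mulVec, sub_transpose_of_lyapunov hA hV, Matrix.smul_mulVec,
      cmat_mulVec_cvec, dotProduct_smul, cvec_real_dot, smul_eq_mul]
  rw [← h1] at h2
  have h3 := congrArg Complex.im h2
  simp only [Complex.sub_im, Complex.conj_im, Complex.mul_im, Complex.mul_re, Complex.I_re,
    Complex.I_im, Complex.ofReal_re, Complex.ofReal_im, Complex.re_ofNat, Complex.im_ofNat] at h3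
  linarith

open scoped ComplexOrder in
theorem itoMatrix_form_nonneg (y : Fin 2 × Fin ν → ℂ) :
    0 ≤ star y ⬝ᵥ (itoMatrix ν *ᵥ y) := by
  have h : itoMatrix ν = (2⁻¹ : ℂ) • ((itoMatrix ν)ᴴ * itoMatrix ν) := by
    rw [itoMatrix_conjTranspose, itoMatrix_mul_self, smul_smul, inv_mul_cancel₀ two_ne_zero,
      one_smul]
  rw [h, Matrix.smul_mulVec, dotProduct_smul, ← Matrix.mulVec_mulVec, Matrix.dotProduct_mulVec,
    ← Matrix.star_mulVec, smul_eq_mul]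
  exact mul_nonneg (by rw [inv_nonneg]; exact zero_le_two) (dotProduct_star_self_nonneg _)

theorem integral_propagated_form {A : Matrix (Fin n) (Fin n) ℝ} {X Q : Matrix (Fin n) (Fin n) ℂ}
    (hX : cmat A * X + X * (cmat A)ᵀ + Q = 0) (s t m : ℝ) (x y : Fin n → ℂ) :
    ∫ r in (0 : ℝ)..m, x ⬝ᵥ ((cexpm A (s - r) * Q * (cexpm A (t - r))ᵀ) *ᵥ y)
      = x ⬝ᵥ ((cexpm A (s - m) * X * (cexpm A (t - m))ᵀ) *ᵥ y)
        - x ⬝ᵥ ((cexpm A s * X * (cexpm A t)ᵀ) *ᵥ y) := by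
  have hcont : ∀ a b, IntervalIntegrable
      (fun r => (cexpm A (s - r) * Q * (cexpm A (t - r))ᵀ) a b) volume 0 m :=
    fun a b => ((continuous_propagated A Q s t).matrix_elem a b).intervalIntegrable _ _
  simp only [dotProduct, Matrix.mulVec]
  rw [intervalIntegral.integral_finsetSum, ← Finset.sum_sub_distrib]
  · refine Finset.sum_congr rfl fun a _ => ?_
    rw [intervalIntegral.integral_const_mul, ← mul_sub, intervalIntegral.integral_finsetSum,
      ← Finset.sum_sub_distrib]
    · congr 1
      refine Finset.sum_congr rfl fun b _ => ?_
      rw [intervalIntegral.integral_mul_const, integral_propagated hX, ← sub_mul]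
    · exact fun b _ => (hcont a b).mul_const _
  · intro a _
    refine IntervalIntegrable.const_mul ?_ _
    have := IntervalIntegrable.sum Finset.univ (fun b _ => (hcont a b).mul_const (y b))
    refine this.congr ?_
    intro r _
    simp

-- The form of `V` exceeds that of `exp(tA) V exp(tAᵀ)` by an integral of nonnegative Ito forms, and
-- the propagated term vanishes as `t → ∞`.
open scoped ComplexOrder in
theorem posSemidef_of_lyapunov (hA : IsHurwitz S.A)
    (hV : cmat S.A * V + V * (cmat S.A)ᵀ + cmat S.B * itoMatrix ν * (cmat S.B)ᵀ = 0) :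
    V.PosSemidef := by
  refine Matrix.PosSemidef.of_dotProduct_mulVec_nonneg (isHermitian_of_lyapunov hA hV) fun x => ?_
  set Q := cmat S.B * itoMatrix ν * (cmat S.B)ᵀ with hQ
  have hnn : ∀ r t, 0 ≤ star x ⬝ᵥ ((cexpm S.A (t - r) * Q * (cexpm S.A (t - r))ᵀ) *ᵥ x) := by
    intro r t
    have e : cexpm S.A (t - r) * Q * (cexpm S.A (t - r))ᵀ
        = ((cmat S.B)ᵀ * (cexpm S.A (t - r))ᵀ)ᴴ * itoMatrix ν *
          ((cmat S.B)ᵀ * (cexpm S.A (t - r))ᵀ) := by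
      rw [Matrix.conjTranspose_mul, ← cmat_transpose, cmat_conjTranspose, cexpm, ← cmat_transpose,
        cmat_conjTranspose, hQ]
      simp only [Matrix.mul_assoc, cmat_transpose, Matrix.transpose_transpose]
    rw [e, ← Matrix.mulVec_mulVec, ← Matrix.mulVec_mulVec, Matrix.dotProduct_mulVec,
      ← Matrix.star_mulVec]
    exact itoMatrix_form_nonneg _
  have hlim : Tendsto (fun t => star x ⬝ᵥ ((cexpm S.A t * V * (cexpm S.A t)ᵀ) *ᵥ x)) atTop
      (𝓝 0) := by
    have hc : Continuous fun M : Matrix (Fin n) (Fin n) ℂ => star x ⬝ᵥ (M *ᵥ x) := by fun_prop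
    have h := (hc.tendsto 0).comp (tendsto_propagated hA V)
    rw [Matrix.zero_mulVec, dotProduct_zero] at h
    exact h
  have hle : ∀ t, 0 ≤ t → star x ⬝ᵥ ((cexpm S.A t * V * (cexpm S.A t)ᵀ) *ᵥ x)
      ≤ star x ⬝ᵥ (V *ᵥ x) := by
    intro t ht
    have hI : ∫ r in (0 : ℝ)..t, star x ⬝ᵥ ((cexpm S.A (t - r) * Q * (cexpm S.A (t - r))ᵀ) *ᵥ x)
        = star x ⬝ᵥ (V *ᵥ x) - star x ⬝ᵥ ((cexpm S.A t * V * (cexpm S.A t)ᵀ) *ᵥ x) := by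
      rw [integral_propagated_form hV]
      simp [cexpm_zero]
    rw [← sub_nonneg, ← hI, intervalIntegral.integral_of_le ht]
    exact integral_nonneg fun r => hnn r t
  exact le_of_tendsto hlim ((eventually_ge_atTop 0).mono hle)

/-- One formula for both signs of `s - t`, since one of the two propagators is the identity. It
yields continuity across the diagonal and matches integration up to `min s t`. -/
theorem covKernel_eq (A : Matrix (Fin n) (Fin n) ℝ) (V : Matrix (Fin n) (Fin n) ℂ) (s t : ℝ) :
    covKernel A V (s - t)
      = cexpm A (s - min s t) * V * (cexpm A (t - min s t))ᵀ := by
  unfold covKernel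
  split_ifs with h
  · rw [min_eq_right (sub_nonneg.1 h), sub_self, cexpm_zero, Matrix.transpose_one, Matrix.mul_one]
    rfl
  · rw [min_eq_left (sub_neg.1 (not_le.1 h)).le, sub_self, cexpm_zero, Matrix.one_mul,
      cmat_exp_transpose, neg_sub]

theorem continuous_covKernel (A : Matrix (Fin n) (Fin n) ℝ) (V : Matrix (Fin n) (Fin n) ℂ) :
    Continuous fun p : ℝ × ℝ => covKernel A V (p.1 - p.2) := by
  simp_rw [covKernel_eq]
  have h := continuous_cexpm A
  exact ((h.comp (by fun_prop)).matrix_mul continuous_const).matrix_mul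
    (h.comp (by fun_prop)).matrix_transpose

/-- The real-linear map `x ↦ 2^(-1/2) (I + i J) x`, which turns the quantum Ito form into a complex
inner product. -/
def itoRoot (ν : ℕ) : EuclideanSpace ℝ (Fin 2 × Fin ν) →L[ℝ] EuclideanSpace ℂ (Fin 2 × Fin ν) :=
  LinearMap.toContinuousLinearMap
    { toFun := fun x => WithLp.toLp 2 (((√2)⁻¹ : ℝ) • (itoMatrix ν *ᵥ cvec x.ofLp))
      map_add' := fun x y => by
        have : cvec (x + y).ofLp = cvec x.ofLp + cvec y.ofLp := by ext i; simp [cvec]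
        rw [this, Matrix.mulVec_add, smul_add, WithLp.toLp_add]
      map_smul' := fun c x => by
        have : cvec (c • x).ofLp = c • cvec x.ofLp := by ext i; simp [cvec]
        rw [this, Matrix.mulVec_smul, smul_comm, WithLp.toLp_smul, RingHom.id_apply] }

theorem itoRoot_apply (x : EuclideanSpace ℝ (Fin 2 × Fin ν)) :
    itoRoot ν x = WithLp.toLp 2 (((√2)⁻¹ : ℝ) • (itoMatrix ν *ᵥ cvec x.ofLp)) := rfl

theorem star_cvec {ι : Type*} (w : ι → ℝ) : star (cvec w) = cvec w := by ext i; simp [cvec]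

theorem inner_itoRoot (x y : EuclideanSpace ℝ (Fin 2 × Fin ν)) :
    ⟪itoRoot ν x, itoRoot ν y⟫_ℂ = cvec x.ofLp ⬝ᵥ (itoMatrix ν *ᵥ cvec y.ofLp) := by
  rw [EuclideanSpace.inner_eq_star_dotProduct, itoRoot_apply, itoRoot_apply, star_smul,
    dotProduct_smul, smul_dotProduct, dotProduct_comm, Matrix.star_mulVec, star_cvec,
    itoMatrix_conjTranspose, ← Matrix.dotProduct_mulVec, Matrix.mulVec_mulVec, itoMatrix_mul_self,
    Matrix.smul_mulVec, dotProduct_smul, smul_smul, star_trivial, ← mul_inv, Real.mul_self_sqrt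
    zero_le_two, ← Complex.coe_smul, smul_smul]
  simp

/-- The real part is the vacuum covariance of the fields, the imaginary part their commutator. -/
theorem inner_itoRoot' (x y : EuclideanSpace ℝ (Fin 2 × Fin ν)) :
    ⟪itoRoot ν x, itoRoot ν y⟫_ℂ = ((⟪x, y⟫_ℝ : ℝ) : ℂ)
      + ((x.ofLp ⬝ᵥ (fieldJ ν *ᵥ y.ofLp) : ℝ) : ℂ) * Complex.I := by
  rw [inner_itoRoot, itoMatrix, Matrix.add_mulVec, Matrix.one_mulVec, dotProduct_add,
    Matrix.smul_mulVec, cmat_mulVec_cvec, dotProduct_smul, cvec_real_dot, cvec_real_dot,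
    smul_eq_mul, mul_comm Complex.I, EuclideanSpace.inner_eq_star_dotProduct, star_trivial,
    dotProduct_comm]

theorem integrable_dot_fieldJ (g g' : FieldSpace ν) :
    Integrable (fun s => (g s).ofLp ⬝ᵥ (fieldJ ν *ᵥ (g' s).ofLp))
      (volume.restrict (Set.Ici (0 : ℝ))) := by
  let J : EuclideanSpace ℝ (Fin 2 × Fin ν) →L[ℝ] EuclideanSpace ℝ (Fin 2 × Fin ν) :=
    LinearMap.toContinuousLinearMap (Matrix.toEuclideanLin (fieldJ ν))
  refine (L2.integrable_inner (𝕜 := ℝ) g (J.compLp g')).congr ?_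
  filter_upwards [J.coeFn_compLp g'] with s hs
  rw [hs, EuclideanSpace.inner_eq_star_dotProduct, star_trivial, dotProduct_comm]
  rfl

theorem inner_compLp_itoRoot (g g' : FieldSpace ν) :
    ⟪(itoRoot ν).compLp g, (itoRoot ν).compLp g'⟫_ℂ
      = ∫ s in Set.Ici (0 : ℝ), ⟪itoRoot ν (g s), itoRoot ν (g' s)⟫_ℂ := by
  rw [L2.inner_def]
  refine integral_congr_ae ?_
  filter_upwards [(itoRoot ν).coeFn_compLp g, (itoRoot ν).coeFn_compLp g'] with s h1 h2
  rw [h1, h2]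

theorem inner_compLp_itoRoot' (g g' : FieldSpace ν) :
    ⟪(itoRoot ν).compLp g, (itoRoot ν).compLp g'⟫_ℂ
      = ((⟪g, g'⟫_ℝ : ℝ) : ℂ) + ((∫ s in Set.Ici (0 : ℝ),
          (g s).ofLp ⬝ᵥ (fieldJ ν *ᵥ (g' s).ofLp) : ℝ) : ℂ) * Complex.I := by
  rw [inner_compLp_itoRoot]
  simp_rw [inner_itoRoot']
  rw [integral_add (L2.integrable_inner (𝕜 := ℝ) g g').ofReal
    ((integrable_dot_fieldJ g g').ofReal.mul_const _), integral_mul_const, integral_complex_ofReal,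
    integral_complex_ofReal, L2.inner_def]

/-- The one-particle Hilbert space of the oscillator and its input fields. -/
abbrev FeatureSpace (n ν : ℕ) : Type :=
  WithLp 2 (EuclideanSpace ℂ (Fin n) ×
    Lp (EuclideanSpace ℂ (Fin 2 × Fin ν)) 2 (volume.restrict (Set.Ici (0 : ℝ))))

/-- The real-linear one-particle map `(x, g) ↦ (D x, 2^(-1/2) (I + i J) g)`. -/
def feature (D : Matrix (Fin n) (Fin n) ℂ) (ν : ℕ) :
    (Fin n → ℝ) × FieldSpace ν →ₗ[ℝ] FeatureSpace n ν where
  toFun f := WithLp.toLp 2 (WithLp.toLp 2 (D *ᵥ cvec f.1), (itoRoot ν).compLp f.2)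
  map_add' f g := by
    have : cvec (f + g).1 = cvec f.1 + cvec g.1 := by ext i; simp [cvec]
    have h := map_add ((itoRoot ν).compLpL 2 (volume.restrict (Set.Ici (0 : ℝ)))) f.2 g.2
    rw [this, Matrix.mulVec_add]
    exact congrArg (WithLp.toLp 2) (Prod.ext rfl h)
  map_smul' c f := by
    have : cvec (c • f).1 = c • cvec f.1 := by ext i; simp [cvec]
    have h := map_smul ((itoRoot ν).compLpL 2 (volume.restrict (Set.Ici (0 : ℝ)))) c f.2
    rw [this, Matrix.mulVec_smul]
    exact congrArg (WithLp.toLp 2) (Prod.ext rfl h)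

theorem inner_feature {D : Matrix (Fin n) (Fin n) ℂ} (hD : V = Dᴴ * D)
    (f g : (Fin n → ℝ) × FieldSpace ν) :
    ⟪feature D ν f, feature D ν g⟫_ℂ
      = bil V f.1 g.1 + ⟪(itoRoot ν).compLp f.2, (itoRoot ν).compLp g.2⟫_ℂ := by
  change ⟪(WithLp.toLp 2 (D *ᵥ cvec f.1) : EuclideanSpace ℂ (Fin n)),
    WithLp.toLp 2 (D *ᵥ cvec g.1)⟫_ℂ + _ = _
  congr 1
  rw [EuclideanSpace.inner_eq_star_dotProduct, dotProduct_comm, Matrix.star_mulVec, star_cvec, bil,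
    hD, ← Matrix.dotProduct_mulVec, Matrix.mulVec_mulVec]

/-- The two responses share the noise on `(0, min s t]` only. There the Lyapunov equation makes the
integrand an exact derivative: its boundary term at `0` cancels the contribution of the initial
variables, and the one at `min s t` is the kernel. -/
theorem inner_feature_elem {D : Matrix (Fin n) (Fin n) ℂ} (hD : V = Dᴴ * D)
    (hV : cmat S.A * V + V * (cmat S.A)ᵀ + cmat S.B * itoMatrix ν * (cmat S.B)ᵀ = 0)
    {s t : ℝ} (hs : 0 ≤ s) (ht : 0 ≤ t) (u v : Fin n → ℝ) :
    ⟪feature D ν (S.elem s u), feature D ν (S.elem t v)⟫_ℂ = bil (covKernel S.A V (s - t)) u v := by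
  rw [inner_feature hD, inner_compLp_itoRoot]
  have h1 : bil V (S.elem s u).1 (S.elem t v).1
      = cvec u ⬝ᵥ ((cexpm S.A s * V * (cexpm S.A t)ᵀ) *ᵥ cvec v) := by
    change cvec (_ *ᵥ u) ⬝ᵥ (V *ᵥ cvec (_ *ᵥ v)) = _
    rw [← cmat_mulVec_cvec, ← cmat_mulVec_cvec, cmat_exp_transpose, cmat_exp_transpose,
      Matrix.mulVec_transpose, ← Matrix.dotProduct_mulVec, Matrix.mulVec_mulVec,
      Matrix.mulVec_mulVec, Matrix.mul_assoc]
  have h2 : ∫ r in Set.Ici (0 : ℝ),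
        ⟪itoRoot ν ((S.elem s u).2 r), itoRoot ν ((S.elem t v).2 r)⟫_ℂ
      = ∫ r in (0 : ℝ)..(min s t), cvec u ⬝ᵥ ((cexpm S.A (s - r) *
          (cmat S.B * itoMatrix ν * (cmat S.B)ᵀ) * (cexpm S.A (t - r))ᵀ) *ᵥ cvec v) := by
    rw [intervalIntegral.integral_of_le (le_min hs ht)]
    have e : (volume.restrict (Set.Ioc 0 (min s t))) =
        (volume.restrict (Set.Ici (0 : ℝ))).restrict (Set.Ioc 0 (min s t)) := by
      rw [Measure.restrict_restrict measurableSet_Ioc, Set.inter_eq_left.2]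
      exact fun r hr => hr.1.le
    rw [e, ← integral_indicator measurableSet_Ioc]
    refine integral_congr_ae ?_
    filter_upwards [(S.memLp_respFun s u).coeFn_toLp, (S.memLp_respFun t v).coeFn_toLp]
      with r h1 h2
    change ⟪itoRoot ν (((S.memLp_respFun s u).toLp _ : FieldSpace ν) r),
      itoRoot ν (((S.memLp_respFun t v).toLp _ : FieldSpace ν) r)⟫_ℂ = _
    rw [h1, h2]
    unfold OQHO.respFun
    by_cases hr1 : r ∈ Set.Ioc 0 s
    · by_cases hr2 : r ∈ Set.Ioc 0 t
      · have hr : r ∈ Set.Ioc 0 (min s t) := ⟨hr1.1, le_min hr1.2 hr2.2⟩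
        rw [Set.indicator_of_mem hr1, Set.indicator_of_mem hr2, Set.indicator_of_mem hr,
          inner_itoRoot, ← cmat_mulVec_cvec, ← cmat_mulVec_cvec, ← cmat_mulVec_cvec,
          ← cmat_mulVec_cvec, cmat_exp_transpose, cmat_exp_transpose, cmat_transpose,
          Matrix.mulVec_transpose, Matrix.mulVec_transpose, ← Matrix.dotProduct_mulVec,
          ← Matrix.dotProduct_mulVec]
        simp only [Matrix.mulVec_mulVec, Matrix.mul_assoc]
      · have hr : r ∉ Set.Ioc 0 (min s t) := fun h => hr2 ⟨h.1, h.2.trans (min_le_right _ _)⟩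
        rw [Set.indicator_of_notMem hr2, Set.indicator_of_notMem hr, map_zero, inner_zero_right]
    · have hr : r ∉ Set.Ioc 0 (min s t) := fun h => hr1 ⟨h.1, h.2.trans (min_le_left _ _)⟩
      rw [Set.indicator_of_notMem hr1, Set.indicator_of_notMem hr, map_zero, inner_zero_left]
  rw [h1, h2, integral_propagated_form hV, covKernel_eq]
  unfold bil
  ring

theorem im_inner_feature {D : Matrix (Fin n) (Fin n) ℂ} (hD : V = Dᴴ * D) (hA : IsHurwitz S.A)
    (hV : cmat S.A * V + V * (cmat S.A)ᵀ + cmat S.B * itoMatrix ν * (cmat S.B)ᵀ = 0)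
    (f g : (Fin n → ℝ) × FieldSpace ν) :
    (⟪feature D ν f, feature D ν g⟫_ℂ).im = S.form f g := by
  rw [inner_feature hD, Complex.add_im, im_bil_of_lyapunov hA hV, inner_compLp_itoRoot']
  simp [OQHO.form]

end StationaryCovariance

/-! ### Mercer's expansion from a factorization of the kernel. -/

section Mercer

/-- Expand `‖f y - f x‖²` into four inner products, which cancel in the limit. -/
theorem continuousOn_of_continuousOn_inner {X E : Type*} [TopologicalSpace X]
    [NormedAddCommGroup E] [InnerProductSpace ℂ E] {f : X → E} {s : Set X}
    (h : ContinuousOn (fun p : X × X => ⟪f p.1, f p.2⟫_ℂ) (s ×ˢ s)) : ContinuousOn f s := by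
  intro x hx
  have hd : Tendsto (fun y => ‖f y - f x‖ ^ 2) (𝓝[s] x) (𝓝 0) := by
    have e : ∀ y, ‖f y - f x‖ ^ 2 = (⟪f y, f y⟫_ℂ - ⟪f y, f x⟫_ℂ - ⟪f x, f y⟫_ℂ + ⟪f x, f x⟫_ℂ).re := by
      intro y
      rw [← inner_self_eq_norm_sq (𝕜 := ℂ), inner_sub_sub_self]
      rfl
    simp_rw [e]
    have hc : ∀ g : X → X × X, Continuous g → (∀ y ∈ s, g y ∈ s ×ˢ s) →
        Tendsto (fun y => ⟪f (g y).1, f (g y).2⟫_ℂ) (𝓝[s] x)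
          (𝓝 ⟪f (g x).1, f (g x).2⟫_ℂ) := fun g hg hgs =>
      (h.comp hg.continuousOn hgs) x hx
    have h1 := hc (fun y => (y, y)) (by fun_prop) fun y hy => ⟨hy, hy⟩
    have h2 := hc (fun y => (y, x)) (by fun_prop) fun y hy => ⟨hy, hx⟩
    have h3 := hc (fun y => (x, y)) (by fun_prop) fun y hy => ⟨hx, hy⟩
    have h4 := (Complex.continuous_re.tendsto _).comp
      (((h1.sub h2).sub h3).add_const ⟪f x, f x⟫_ℂ)
    simpa [Function.comp_def] using h4
  have hd2 := (Real.continuous_sqrt.tendsto _).comp hd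
  rw [Real.sqrt_zero] at hd2
  rw [ContinuousWithinAt, tendsto_iff_norm_sub_tendsto_zero]
  refine hd2.congr fun y => ?_
  simp [Real.sqrt_sq (norm_nonneg _)]

/-- Parseval's identity when only `y` need lie in the closed span of `v`, as `hy` says: the residue
of `x` after projection is orthogonal to every `v i`, hence to `y`. -/
theorem hasSum_inner_mul_inner_of_orthonormal {ι E : Type*} [NormedAddCommGroup E]
    [InnerProductSpace ℂ E] [CompleteSpace E] {v : ι → E} (hv : Orthonormal ℂ v) (x y : E)
    (hy : ∀ w, (∀ i, ⟪v i, w⟫_ℂ = 0) → ⟪y, w⟫_ℂ = 0) :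
    HasSum (fun i => ⟪y, v i⟫_ℂ * ⟪v i, x⟫_ℂ) ⟪y, x⟫_ℂ := by
  have hs : Summable fun i => ⟪v i, x⟫_ℂ • v i :=
    (hv.orthogonalFamily.summable_iff_norm_sq_summable fun i => ⟪v i, x⟫_ℂ).2
      (hv.inner_products_summable x)
  obtain ⟨p, hp⟩ := hs
  have hi : ∀ z, HasSum (fun i => ⟪z, v i⟫_ℂ * ⟪v i, x⟫_ℂ) ⟪z, p⟫_ℂ := by
    intro z
    refine (hp.mapL (innerSL ℂ z)).congr_fun ?_
    intro i
    simp [mul_comm]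
  have h0 : ⟪y, x - p⟫_ℂ = 0 := by
    refine hy _ fun j => ?_
    have h1 := hi (v j)
    have h2 : HasSum (fun i => ⟪v j, v i⟫_ℂ * ⟪v i, x⟫_ℂ) (⟪v j, v j⟫_ℂ * ⟪v j, x⟫_ℂ) :=
      hasSum_single j fun i hi => by rw [hv.2 (Ne.symm hi), zero_mul]
    rw [inner_sub_right, h1.unique h2, inner_self_eq_norm_sq_to_K, hv.1 j]
    simp
  rw [inner_sub_right, sub_eq_zero] at h0
  rw [h0]
  exact hi y

variable {n : ℕ} {E : Type*} [NormedAddCommGroup E] [InnerProductSpace ℂ E] [CompleteSpace E]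

/-- The vector `∫₀ᵀ ∑ a, g_a(t) F_a(t) dt`. -/
def synthesis (T : ℝ) (F : ℝ → Fin n → E) (g : ℝ → Fin n → ℂ) : E :=
  ∫ t in Set.Icc 0 T, ∑ a, g t a • F t a

variable {T : ℝ} {F : ℝ → Fin n → E} (hF : ∀ a, ContinuousOn (fun t => F t a) (Set.Icc 0 T))

theorem SqInt.integrableOn {G : Type*} [NormedAddCommGroup G] {g : ℝ → G} (hg : SqInt T g) :
    IntegrableOn g (Set.Icc 0 T) :=
  MemLp.integrable one_le_two hg

theorem SqInt.integrableOn_apply {g : ℝ → Fin n → ℂ} (hg : SqInt T g) (a : Fin n) :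
    IntegrableOn (fun t => g t a) (Set.Icc 0 T) :=
  Integrable.eval hg.integrableOn a

include hF

theorem integrableOn_synthesis {g : ℝ → Fin n → ℂ} (hg : SqInt T g) :
    IntegrableOn (fun t => ∑ a, g t a • F t a) (Set.Icc 0 T) :=
  integrable_finsetSum _ fun a _ =>
    IntegrableOn.smul_continuousOn (hg.integrableOn_apply a) (hF a) isCompact_Icc

theorem inner_synthesis_right {g : ℝ → Fin n → ℂ} (hg : SqInt T g) (y : E) :
    ⟪y, synthesis T F g⟫_ℂ = ∫ t in Set.Icc 0 T, ∑ a, g t a * ⟪y, F t a⟫_ℂ := by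
  unfold synthesis
  rw [← integral_inner (integrableOn_synthesis hF hg)]
  simp_rw [inner_sum, inner_smul_right]

theorem inner_synthesis_left {g : ℝ → Fin n → ℂ} (hg : SqInt T g) (y : E) :
    ⟪synthesis T F g, y⟫_ℂ = ipT T g fun t a => ⟪F t a, y⟫_ℂ := by
  rw [← inner_conj_symm, inner_synthesis_right hF hg, ← integral_conj]
  unfold ipT dotProduct
  refine integral_congr_ae (ae_of_all _ fun t => ?_)
  simp [inner_conj_symm]

variable {K : ℝ → Matrix (Fin n) (Fin n) ℂ}
  (hK : ∀ s ∈ Set.Icc 0 T, ∀ t ∈ Set.Icc 0 T, ∀ a b, ⟪F s a, F t b⟫_ℂ = K (s - t) a b)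

include hK

theorem covOp_eq_inner_synthesis {g : ℝ → Fin n → ℂ} (hg : SqInt T g) {s : ℝ}
    (hs : s ∈ Set.Icc 0 T) (a : Fin n) : covOp T K g s a = ⟪F s a, synthesis T F g⟫_ℂ := by
  have hae : ∀ a, (fun t => (K (s - t) *ᵥ g t) a) =ᵐ[volume.restrict (Set.Icc 0 T)]
      fun t => ∑ b, g t b * ⟪F s a, F t b⟫_ℂ := by
    intro a
    filter_upwards [ae_restrict_mem measurableSet_Icc] with t ht
    simp only [Matrix.mulVec, dotProduct]
    refine Finset.sum_congr rfl fun b _ => ?_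
    rw [hK s hs t ht, mul_comm]
  unfold covOp
  rw [eval_integral, inner_synthesis_right hF hg]
  · exact integral_congr_ae (hae a)
  · intro a
    refine Integrable.congr ?_ (hae a).symm
    have := (integrableOn_synthesis hF hg).const_inner (𝕜 := ℂ) (F s a)
    simpa only [inner_sum, inner_smul_right] using this

/-- The factorization `𝒦 = Φ* Φ` with `Φ` the map `synthesis`. It makes the images of the
eigenfunctions orthogonal, with squared norms `μ k`. -/
theorem inner_synthesis_synthesis {f g : ℝ → Fin n → ℂ} (hf : SqInt T f) (hg : SqInt T g) :
    ⟪synthesis T F f, synthesis T F g⟫_ℂ = ipT T f (covOp T K g) := by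
  rw [inner_synthesis_left hF hf]
  unfold ipT
  refine setIntegral_congr_fun measurableSet_Icc fun t ht => ?_
  simp only [dotProduct]
  refine Finset.sum_congr rfl fun a _ => ?_
  rw [covOp_eq_inner_synthesis hF hK hg ht]

variable {μ : ℕ → ℝ} {h : ℕ → ℝ → Fin n → ℂ} (hμh : IsEigenSystem T K μ h)

include hμh

theorem inner_synthesis_eigen (j k : ℕ) :
    ⟪synthesis T F (h j), synthesis T F (h k)⟫_ℂ = if j = k then (μ k : ℂ) else 0 := by
  rw [inner_synthesis_synthesis hF hK (hμh.sqInt j) (hμh.sqInt k)]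
  have : ipT T (h j) (covOp T K (h k)) = (μ k : ℂ) * ipT T (h j) (h k) := by
    unfold ipT
    rw [← integral_const_mul]
    refine setIntegral_congr_fun measurableSet_Icc fun t ht => ?_
    simp only [hμh.eigen k t ht, dotProduct_smul, smul_eq_mul]
  rw [this, hμh.orthonormal]
  split_ifs <;> simp

theorem IsEigenSystem.nonneg (k : ℕ) : 0 ≤ μ k := by
  have h1 := inner_synthesis_eigen hF hK hμh k k
  rw [if_pos rfl, inner_self_eq_norm_sq_to_K] at h1
  have h2 : ‖synthesis T F (h k)‖ ^ 2 = μ k := Complex.ofReal_injective (by simpa using h1)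
  rw [← h2]
  positivity

theorem inner_feature_synthesis_eigen {s : ℝ} (hs : s ∈ Set.Icc 0 T) (a : Fin n) (k : ℕ) :
    ⟪F s a, synthesis T F (h k)⟫_ℂ = μ k * h k s a := by
  rw [← covOp_eq_inner_synthesis hF hK (hμh.sqInt k) hs, hμh.eigen k s hs]
  rfl

/-- Let `g = Φ* x`. It is orthogonal to all `h k`, so `𝒦 g = 0` by exhaustiveness and hence `Φ g =
0`. Then `⟨g, g⟩ = ⟨Φ g, x⟩ = 0`, and `g` vanishes. -/
theorem inner_eq_zero_of_forall_synthesis (hT : 0 < T) {x : E}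
    (hx : ∀ k, ⟪synthesis T F (h k), x⟫_ℂ = 0) {s : ℝ} (hs : s ∈ Set.Icc 0 T) (a : Fin n) :
    ⟪F s a, x⟫_ℂ = 0 := by
  set g : ℝ → Fin n → ℂ := fun t a => ⟪F t a, x⟫_ℂ with hgdef
  have hgc : ContinuousOn g (Set.Icc 0 T) := continuousOn_pi.2 fun a =>
    (hF a).inner continuousOn_const
  have hg : SqInt T g := by
    obtain ⟨C, hC⟩ := isCompact_Icc.exists_bound_of_continuousOn hgc
    refine MemLp.of_bound (hgc.aestronglyMeasurable measurableSet_Icc) C ?_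
    filter_upwards [ae_restrict_mem measurableSet_Icc] with t ht using hC t ht
  have h1 : ∀ s ∈ Set.Icc 0 T, covOp T K g s = 0 := hμh.exhaustive g hg fun k => by
    rw [← inner_synthesis_left hF (hμh.sqInt k)]
    exact hx k
  have h2 : ⟪synthesis T F g, synthesis T F g⟫_ℂ = 0 := by
    rw [inner_synthesis_synthesis hF hK hg hg]
    unfold ipT
    refine (setIntegral_congr_fun measurableSet_Icc (g := fun _ => 0) fun t ht => ?_).trans
      (integral_zero _ _)
    simp [h1 t ht]
  have h3 : ipT T g g = 0 := by
    rw [← inner_synthesis_left hF hg, inner_self_eq_zero.1 h2, inner_zero_left]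
  have h4 : ∀ t, star (g t) ⬝ᵥ g t = ((∑ a, ‖g t a‖ ^ 2 : ℝ) : ℂ) := by
    intro t
    simp [dotProduct, Complex.conj_mul']
  have hgs : ContinuousOn (fun t => ∑ a, ‖g t a‖ ^ 2) (Set.Icc 0 T) :=
    continuousOn_finsetSum _ fun a _ => ((continuousOn_pi.1 hgc a).norm).pow 2
  have h5 : ∫ t in Set.Icc 0 T, ∑ a, ‖g t a‖ ^ 2 = 0 := by
    unfold ipT at h3
    simp_rw [h4] at h3
    rw [integral_complex_ofReal] at h3
    exact_mod_cast h3
  rw [setIntegral_eq_zero_iff_of_nonneg_ae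
    (ae_of_all _ fun t => Finset.sum_nonneg fun a _ => sq_nonneg _)
    (hgs.integrableOn_compact isCompact_Icc)] at h5
  -- Almost everywhere becomes everywhere by continuity; this requires an interval of positive
  -- length.
  have h6 := Measure.eqOn_Icc_of_ae_eq volume hT.ne h5 hgs continuousOn_const hs
  have h7 := (Finset.sum_eq_zero_iff_of_nonneg fun a _ => sq_nonneg _).1 h6 a (Finset.mem_univ a)
  exact norm_eq_zero.1 (pow_eq_zero_iff two_ne_zero |>.1 h7)

/-- Mercer's expansion of the kernel. -/
theorem mercer (hT : 0 < T) {s t : ℝ} (hs : s ∈ Set.Icc 0 T) (ht : t ∈ Set.Icc 0 T)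
    (a b : Fin n) :
    HasSum (fun k => (√(μ k) * h k s a) * conj (√(μ k) * h k t b)) (K (s - t) a b) := by
  -- Indices with `μ k = 0` are dropped because their images are zero and cannot be normalized.
  set v : {k // μ k ≠ 0} → E := fun k => (((√(μ k))⁻¹ : ℝ) : ℂ) • synthesis T F (h k)
  have hpos : ∀ k : {k // μ k ≠ 0}, 0 < √(μ k) := fun k =>
    Real.sqrt_pos.2 (lt_of_le_of_ne (hμh.nonneg hF hK k) (Ne.symm k.2))
  have hsq : ∀ k, √(μ k) * √(μ k) = μ k := fun k => Real.mul_self_sqrt (hμh.nonneg hF hK k)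
  have hv : Orthonormal ℂ v := by
    rw [orthonormal_iff_ite]
    intro j k
    rw [inner_smul_left, inner_smul_right, inner_synthesis_eigen hF hK hμh]
    by_cases hjk : j = k
    · subst hjk
      have h1 := (hpos j).ne'
      have h2 : (√(μ j))⁻¹ * ((√(μ j))⁻¹ * μ j) = 1 := by
        nth_rewrite 3 [← hsq]
        field_simp
      rw [if_pos rfl, if_pos rfl, Complex.conj_ofReal]
      exact_mod_cast h2
    · rw [if_neg hjk, if_neg (fun h => hjk (Subtype.ext h))]
      simp
  have hin : ∀ s ∈ Set.Icc 0 T, ∀ a, ∀ k : {k // μ k ≠ 0},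
      ⟪F s a, v k⟫_ℂ = √(μ k) * h k s a := by
    intro s hs a k
    have h1 := (hpos k).ne'
    have h2 : (√(μ k))⁻¹ * μ k = √(μ k) := by
      nth_rewrite 2 [← hsq]
      field_simp
    rw [inner_smul_right, inner_feature_synthesis_eigen hF hK hμh hs, ← mul_assoc,
      ← Complex.ofReal_mul, h2]
  have hsum := hasSum_inner_mul_inner_of_orthonormal hv (F t b) (F s a) fun w hw =>
    inner_eq_zero_of_forall_synthesis hF hK hμh hT (x := w) (fun k => by
      by_cases hk : μ k = 0
      · have h1 := inner_synthesis_eigen hF hK hμh k k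
        rw [if_pos rfl, hk, Complex.ofReal_zero, inner_self_eq_zero] at h1
        rw [h1, inner_zero_left]
      · have h1 := hw ⟨k, hk⟩
        rw [inner_smul_left] at h1
        refine (mul_eq_zero.1 h1).resolve_left ?_
        rw [Complex.conj_ofReal]
        exact_mod_cast (inv_pos.2 (hpos ⟨k, hk⟩)).ne') hs a
  rw [hK s hs t ht] at hsum
  -- The omitted indices return with zero terms, owing to the factor `√(μ k)`.
  rw [← hasSum_subtype_iff_of_support_subset (s := {k | μ k ≠ 0})]
  · refine hsum.congr_fun fun k => ?_
    rw [hin s hs, ← inner_conj_symm (v k), hin t ht]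
    rfl
  · intro k hk hk0
    apply hk
    simp [hk0]

end Mercer

/-! ### Square summable coefficients of the process. -/

section Coefficients

variable {n : ℕ} {E : Type*} [NormedAddCommGroup E] [InnerProductSpace ℂ E] [CompleteSpace E]

/-- Mercer's theorem as a feature map with values in `ℓ²`. -/
theorem exists_coefficients {T : ℝ} (hT : 0 < T) {F : ℝ → Fin n → E}
    {K : ℝ → Matrix (Fin n) (Fin n) ℂ}
    (hKc : ∀ a b, Continuous fun p : ℝ × ℝ => K (p.1 - p.2) a b)
    (hK : ∀ s ∈ Set.Icc 0 T, ∀ t ∈ Set.Icc 0 T, ∀ a b, ⟪F s a, F t b⟫_ℂ = K (s - t) a b)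
    {μ : ℕ → ℝ} {h : ℕ → ℝ → Fin n → ℂ} (hμh : IsEigenSystem T K μ h) :
    ∃ ζ : ℝ → Fin n → lp (fun _ : ℕ => ℂ) 2,
      (∀ a, ContinuousOn (fun t => ζ t a) (Set.Icc 0 T)) ∧
      (∀ t ∈ Set.Icc 0 T, ∀ a k, ζ t a k = √(μ k) * conj (h k t a)) ∧
      ∀ s ∈ Set.Icc 0 T, ∀ t ∈ Set.Icc 0 T, ∀ a b, ⟪ζ s a, ζ t b⟫_ℂ = K (s - t) a b := by
  classical
  have hF : ∀ a, ContinuousOn (fun t => F t a) (Set.Icc 0 T) := fun a => by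
    refine continuousOn_of_continuousOn_inner ((hKc a a).continuousOn.congr fun p hp => ?_)
    exact hK p.1 hp.1 p.2 hp.2 a a
  have hm : ∀ t ∈ Set.Icc 0 T, ∀ a, Memℓp (fun k => (√(μ k) * conj (h k t a) : ℂ)) 2 := by
    intro t ht a
    have h1 := (mercer hF hK hμh hT ht ht a a).summable
    refine memℓp_gen (h1.norm.congr fun k => ?_)
    simp [sq]
  -- The expansion is available on `[0, T]` only; elsewhere the value is immaterial. The conjugate
  -- compensates for the inner product being conjugate-linear in its first argument.
  let ζ : ℝ → Fin n → lp (fun _ : ℕ => ℂ) 2 := fun t a =>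
    if ht : t ∈ Set.Icc 0 T then ⟨_, hm t ht a⟩ else 0
  have hζ : ∀ t ∈ Set.Icc 0 T, ∀ a k, ζ t a k = √(μ k) * conj (h k t a) := by
    intro t ht a k
    simp only [ζ, dif_pos ht]
  have hζK : ∀ s ∈ Set.Icc 0 T, ∀ t ∈ Set.Icc 0 T, ∀ a b, ⟪ζ s a, ζ t b⟫_ℂ = K (s - t) a b := by
    intro s hs t ht a b
    refine (lp.hasSum_inner (ζ s a) (ζ t b)).unique ?_
    refine (mercer hF hK hμh hT hs ht a b).congr_fun fun k => ?_
    rw [hζ s hs, hζ t ht]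
    simp [mul_comm]
  refine ⟨ζ, fun a => ?_, hζ, hζK⟩
  refine continuousOn_of_continuousOn_inner ((hKc a a).continuousOn.congr fun p hp => ?_)
  exact hζK p.1 hp.1 p.2 hp.2 a a

end Coefficients

/-! ### Limits and derivatives from inner products. -/

section HilbertDerivative

variable {E : Type*} [NormedAddCommGroup E] [InnerProductSpace ℂ E]

/-- A single limit of the Gram matrix along the product filter makes `‖x i - x j‖²` tend to `c - c -
c + c = 0`. -/
theorem exists_tendsto_of_tendsto_inner [CompleteSpace E] {ι : Type*} {l : Filter ι} [l.NeBot]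
    {x : ι → E} {c : ℂ} (h : Tendsto (fun p : ι × ι => ⟪x p.1, x p.2⟫_ℂ) (l ×ˢ l) (𝓝 c)) :
    ∃ y, Tendsto x l (𝓝 y) := by
  refine cauchy_map_iff_exists_tendsto.1 (cauchy_map_iff.2 ⟨inferInstance, ?_⟩)
  rw [tendsto_uniformity_iff_dist_tendsto_zero]
  have hfst : Tendsto (fun p : ι × ι => (p.1, p.1)) (l ×ˢ l) (l ×ˢ l) :=
    tendsto_fst.prodMk tendsto_fst
  have hsnd : Tendsto (fun p : ι × ι => (p.2, p.2)) (l ×ˢ l) (l ×ˢ l) :=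
    tendsto_snd.prodMk tendsto_snd
  have hswap : Tendsto (fun p : ι × ι => (p.2, p.1)) (l ×ˢ l) (l ×ˢ l) :=
    tendsto_snd.prodMk tendsto_fst
  have h1 := (Complex.continuous_re.tendsto _).comp
    ((((h.comp hfst).sub h).sub (h.comp hswap)).add (h.comp hsnd))
  have h2 := (Real.continuous_sqrt.tendsto _).comp h1
  simp only [sub_self, zero_sub, neg_add_cancel, Complex.zero_re, Real.sqrt_zero] at h2
  refine h2.congr fun p => ?_
  rw [dist_eq_norm, ← Real.sqrt_sq (norm_nonneg (x p.1 - x p.2)),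
    ← inner_self_eq_norm_sq (𝕜 := ℂ), inner_sub_sub_self]
  rfl

/-- The difference quotients have inner products `(exp(c s t) - 1) / (s t)`, which tend to `c`;
hence they converge. -/
theorem differentiableAt_of_inner_eq_cexp [CompleteSpace E] {f : ℝ → E} {c : ℂ}
    (h : ∀ s t : ℝ, ⟪f s, f t⟫_ℂ = Complex.exp (c * (s * t))) : DifferentiableAt ℝ f 0 := by
  have hd : HasDerivAt (fun w : ℂ => Complex.exp (c * w)) c 0 := by
    simpa using ((hasDerivAt_id (0 : ℂ)).const_mul c).cexp
  rw [hasDerivAt_iff_tendsto_slope] at hd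
  have hp : Tendsto (fun p : ℝ × ℝ => ((p.1 : ℂ) * p.2)) (𝓝[≠] 0 ×ˢ 𝓝[≠] 0) (𝓝[≠] 0) := by
    refine tendsto_nhdsWithin_iff.2 ⟨?_, ?_⟩
    · have hc : Continuous fun p : ℝ × ℝ => ((p.1 : ℂ) * p.2) := by fun_prop
      have h0 := hc.tendsto (0, 0)
      rw [nhds_prod_eq] at h0
      simp only [Complex.ofReal_zero, mul_zero] at h0
      exact h0.mono_left (Filter.prod_mono nhdsWithin_le_nhds nhdsWithin_le_nhds)
    · have := (eventually_mem_nhdsWithin (a := (0 : ℝ)) (s := {0}ᶜ)).prod_mk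
        (eventually_mem_nhdsWithin (a := (0 : ℝ)) (s := {0}ᶜ))
      filter_upwards [this] with p hp
      simpa using hp
  have hs : Tendsto (fun p : ℝ × ℝ => ⟪slope f 0 p.1, slope f 0 p.2⟫_ℂ)
      (𝓝[≠] 0 ×ˢ 𝓝[≠] 0) (𝓝 c) := by
    refine (hd.comp hp).congr fun p => ?_
    simp only [slope, Function.comp_apply, vsub_eq_sub, sub_zero, smul_eq_mul, mul_zero,
      Complex.exp_zero]
    rw [← Complex.coe_smul, ← Complex.coe_smul, inner_smul_left, inner_smul_right, inner_sub_left,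
      inner_sub_right, inner_sub_right, h, h, h, h, Complex.conj_ofReal]
    simp only [Complex.ofReal_zero, mul_zero, zero_mul, Complex.exp_zero, Complex.ofReal_inv,
      mul_inv]
    ring
  obtain ⟨y, hy⟩ := exists_tendsto_of_tendsto_inner hs
  exact (hasDerivAt_iff_tendsto_slope.2 hy).differentiableAt

/-- First-order Taylor estimate for a normalized coherent vector `x` near the vacuum `o`, with
one-particle direction `y`. The constant is explicit, so the bound survives limits of truncations.
-/
theorem norm_sub_smul_sq_le {x o y : E} {c s : ℝ} (hc : 0 ≤ c) (hx : ‖x‖ = 1) (ho : ‖o‖ = 1)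
    (hxo : ⟪x, o⟫_ℂ = Real.exp (-(s ^ 2 * c / 2)))
    (hxy : ⟪x, y⟫_ℂ = ((s * c * Real.exp (-(s ^ 2 * c / 2)) : ℝ) : ℂ)) (hoy : ⟪o, y⟫_ℂ = 0)
    (hy : ‖y‖ ^ 2 = c) : ‖x - o - s • y‖ ≤ s ^ 2 * c := by
  have h1 : 1 - s ^ 2 * c / 2 ≤ Real.exp (-(s ^ 2 * c / 2)) := by
    have := Real.add_one_le_exp (-(s ^ 2 * c / 2))
    linarith
  have hsc : 0 ≤ s ^ 2 * c := mul_nonneg (sq_nonneg _) hc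
  refine abs_le_of_sq_le_sq' ?_ hsc |>.2
  rw [← Complex.coe_smul, norm_sub_sq (𝕜 := ℂ), norm_sub_sq (𝕜 := ℂ), inner_smul_right,
    inner_sub_left, hxo, hxy, hoy, hx, ho, norm_smul, mul_pow, hy, Complex.norm_real,
    Real.norm_eq_abs, sq_abs, sub_zero, ← Complex.ofReal_mul]
  simp only [RCLike.re_to_complex,
    Complex.ofReal_re]
  -- With `q = s² c` and `E = exp(-q / 2)` the squared norm is `2 + q - 2 (1 + q) E`, and `E ≥ 1 - q
  -- / 2` bounds it by `q²`.
  nlinarith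

/-- Strong convergence of norm-contracting operators extends from a set to its closed span. -/
theorem exists_tendsto_of_span [CompleteSpace E] {ι : Type*} {l : Filter ι} [l.NeBot]
    {U : ι → E → E} {S : Set E}
    (hadd : ∀ i, ∀ x ∈ (Submodule.span ℂ S).topologicalClosure,
      ∀ y ∈ (Submodule.span ℂ S).topologicalClosure, U i (x + y) = U i x + U i y)
    (hsmul : ∀ i, ∀ (c : ℂ), ∀ x ∈ (Submodule.span ℂ S).topologicalClosure,
      U i (c • x) = c • U i x)
    (hnorm : ∀ i, ∀ x ∈ (Submodule.span ℂ S).topologicalClosure, ‖U i x‖ ≤ ‖x‖)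
    (hS : ∀ x ∈ S, ∃ y, Tendsto (fun i => U i x) l (𝓝 y)) :
    ∀ x ∈ (Submodule.span ℂ S).topologicalClosure, ∃ y, Tendsto (fun i => U i x) l (𝓝 y) := by
  have hle := (Submodule.span ℂ S).le_topologicalClosure
  have h1 : ∀ x ∈ Submodule.span ℂ S, ∃ y, Tendsto (fun i => U i x) l (𝓝 y) := by
    intro x hx
    induction hx using Submodule.span_induction with
    | mem x hx => exact hS x hx
    | zero =>
      refine ⟨0, tendsto_const_nhds.congr fun i => ?_⟩
      have := hsmul i 0 0 (Submodule.zero_mem _)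
      rw [zero_smul, zero_smul] at this
      exact this.symm
    | add x y hx hy hx' hy' =>
      obtain ⟨a, ha⟩ := hx'
      obtain ⟨b, hb⟩ := hy'
      exact ⟨a + b, (ha.add hb).congr fun i => (hadd i x (hle hx) y (hle hy)).symm⟩
    | smul c x hx hx' =>
      obtain ⟨a, ha⟩ := hx'
      exact ⟨c • a, (ha.const_smul c).congr fun i => (hsmul i c x (hle hx)).symm⟩
  intro x hx
  refine cauchy_map_iff_exists_tendsto.1 (Metric.cauchy_iff.2 ⟨inferInstance, fun ε hε => ?_⟩)
  obtain ⟨x', hx', hd⟩ := Metric.mem_closure_iff.1 hx (ε / 4) (by positivity)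
  have hc := (Metric.cauchy_iff.1 (cauchy_map_iff_exists_tendsto.2 (h1 x' hx'))).2 (ε / 2)
    (by positivity)
  obtain ⟨t, ht, htd⟩ := hc
  rw [mem_map] at ht
  refine ⟨(fun i => U i x) '' ((fun i => U i x') ⁻¹' t), Filter.image_mem_map ht, ?_⟩
  rintro _ ⟨i, hi, rfl⟩ _ ⟨j, hj, rfl⟩
  have hsub : ∀ i, dist (U i x) (U i x') < ε / 4 := by
    intro i
    have hm : x - x' ∈ (Submodule.span ℂ S).topologicalClosure :=
      Submodule.sub_mem _ hx (hle hx')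
    have e := hadd i (x - x') hm x' (hle hx')
    rw [sub_add_cancel] at e
    rw [e, dist_eq_norm, add_sub_cancel_right]
    refine (hnorm i _ hm).trans_lt ?_
    rwa [← dist_eq_norm]
  calc dist (U i x) (U j x)
      ≤ dist (U i x) (U i x') + dist (U i x') (U j x') + dist (U j x') (U j x) :=
        dist_triangle4 _ _ _ _
    _ < ε / 4 + ε / 2 + ε / 4 := by
        rw [dist_comm (U j x')]
        exact add_lt_add (add_lt_add (hsub i) (htd _ hi _ hj)) (hsub j)
    _ = ε := by ring

end HilbertDerivative

/-! ### Real coefficient pairs as complex square summable sequences. -/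

section Coefficients

/-- The complex number `a + i b` of a pair of real coefficients. -/
def pairC (a : Fin 2 → ℝ) : ℂ := a 0 + a 1 * Complex.I

/-- The finitely supported sequence of complex coefficients as an element of `ℓ²`. -/
def coefC : SeqCoef →ₗ[ℝ] lp (fun _ : ℕ => ℂ) 2 where
  toFun u := ⟨fun k => pairC (u k), by
    refine memℓp_gen (summable_of_ne_finset_zero (s := u.support) fun k hk => ?_)
    simp [pairC, Finsupp.notMem_support_iff.1 hk]⟩
  map_add' u v := by
    ext k
    simp only [pairC, Finsupp.add_apply, Pi.add_apply, lp.coeFn_add]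
    push_cast
    ring
  map_smul' c u := by
    ext k
    simp only [pairC, Finsupp.smul_apply, Pi.smul_apply, smul_eq_mul, lp.coeFn_smul,
      RingHom.id_apply, Complex.real_smul]
    push_cast
    ring

theorem coefC_apply (u : SeqCoef) (k : ℕ) : coefC u k = pairC (u k) := rfl

theorem inner_coefC (u : SeqCoef) (z : lp (fun _ : ℕ => ℂ) 2) :
    ⟪coefC u, z⟫_ℂ = ∑ k ∈ u.support, conj (pairC (u k)) * z k := by
  refine (lp.hasSum_inner (coefC u) z).unique ?_
  have : (fun k => ⟪coefC u k, z k⟫_ℂ) = fun k => conj (pairC (u k)) * z k := by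
    funext k
    simp [coefC_apply, mul_comm]
  rw [this]
  refine hasSum_sum_of_ne_finset_zero fun k hk => ?_
  simp [pairC, Finsupp.notMem_support_iff.1 hk]

/-- With a pair read as `a 0 + i a 1`, the matrix `𝐉` becomes the imaginary part of `conj a * b`. -/
theorem seqForm_eq_im_inner (u v : SeqCoef) : seqForm u v = (⟪coefC u, coefC v⟫_ℂ).im := by
  rw [inner_coefC, Complex.im_sum]
  unfold seqForm Finsupp.sum
  refine Finset.sum_congr rfl fun k _ => ?_
  rw [coefC_apply]
  simp [pairC, bJ, dotProduct, Matrix.mulVec, Fin.sum_univ_two]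

theorem norm_coefC_sq (u : SeqCoef) :
    ‖coefC u‖ ^ 2 = ∑ k ∈ u.support, ((u k 0) ^ 2 + (u k 1) ^ 2) := by
  rw [← inner_self_eq_norm_sq (𝕜 := ℂ), inner_coefC, map_sum]
  refine Finset.sum_congr rfl fun k _ => ?_
  rw [coefC_apply]
  simp [pairC]
  ring

/-- The antisymmetric part `i 𝐉` does not contribute on the diagonal. -/
theorem bil_pairCov_self (a : Fin 2 → ℝ) : bil pairCov a a = ((a 0 ^ 2 + a 1 ^ 2 : ℝ) : ℂ) := by
  simp [bil, pairCov, cvec, cmat, bJ, dotProduct, Matrix.mulVec, Fin.sum_univ_two,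
    Matrix.one_apply]
  ring

theorem coefC_single (k : ℕ) (a : Fin 2 → ℝ) :
    coefC (Finsupp.single k a) = lp.single 2 k (pairC a) := by
  ext j
  rw [coefC_apply, lp.single_apply]
  by_cases h : k = j
  · subst h; simp
  · rw [Finsupp.single_eq_of_ne (Ne.symm h), Pi.single_eq_of_ne (Ne.symm h)]
    simp [pairC]

theorem PairSystem.trunc_add (c d : ℕ → Fin 2 → ℝ) (N : ℕ) :
    PairSystem.trunc (c + d) N = PairSystem.trunc c N + PairSystem.trunc d N := by
  simp [PairSystem.trunc, Finset.sum_add_distrib]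

theorem PairSystem.trunc_smul (s : ℝ) (c : ℕ → Fin 2 → ℝ) (N : ℕ) :
    PairSystem.trunc (s • c) N = s • PairSystem.trunc c N := by
  simp [PairSystem.trunc, Finset.smul_sum]

/-- The sequence of pairs `c` has the square summable complex form `z`. -/
def IsCoef (c : ℕ → Fin 2 → ℝ) (z : lp (fun _ : ℕ => ℂ) 2) : Prop := ∀ k, z k = pairC (c k)

theorem IsCoef.add {c d : ℕ → Fin 2 → ℝ} {z w : lp (fun _ : ℕ => ℂ) 2} (hc : IsCoef c z)
    (hd : IsCoef d w) : IsCoef (c + d) (z + w) := by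
  intro k
  simp only [lp.coeFn_add, Pi.add_apply, hc k, hd k, pairC]
  push_cast
  ring

theorem IsCoef.smul {c : ℕ → Fin 2 → ℝ} {z : lp (fun _ : ℕ => ℂ) 2} (hc : IsCoef c z) (s : ℝ) :
    IsCoef (s • c) (s • z) := by
  intro k
  simp only [lp.coeFn_smul, Pi.smul_apply, hc k, pairC, smul_eq_mul, Complex.real_smul]
  push_cast
  ring

theorem IsCoef.zero : IsCoef 0 0 := by
  intro k
  simp [pairC]

theorem IsCoef.tendsto {c : ℕ → Fin 2 → ℝ} {z : lp (fun _ : ℕ => ℂ) 2} (hc : IsCoef c z) :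
    Tendsto (fun N => coefC (PairSystem.trunc c N)) atTop (𝓝 z) := by
  have h := (lp.hasSum_single (p := 2) (by simp) z).tendsto_sum_nat
  refine h.congr fun N => ?_
  unfold PairSystem.trunc
  rw [map_sum]
  refine Finset.sum_congr rfl fun k _ => ?_
  rw [coefC_single, hc k]

end Coefficients

/-! ### Weyl operators and expectations. -/

section Weyl

variable {E : Type*} [AddCommGroup E] [Module ℝ E] {σ : E → E → ℝ}
  {H : Type*} [NormedAddCommGroup H] [InnerProductSpace ℂ H] [CompleteSpace H]

theorem WeylSystem.norm_op (W : WeylSystem E σ H) (u : E) (x : H) : ‖W.op u x‖ = ‖x‖ := by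
  have h := W.unitary_op u
  have h2 : (W.op u).adjoint (W.op u x) = x := by
    have := congrArg (fun L : H →L[ℂ] H => L x) (Unitary.star_mul_self_of_mem h)
    simpa [ContinuousLinearMap.star_eq_adjoint] using this
  have h3 : ⟪W.op u x, W.op u x⟫_ℂ = ⟪x, x⟫_ℂ := by
    rw [← ContinuousLinearMap.adjoint_inner_left, h2]
  rw [← sq_eq_sq₀ (norm_nonneg _) (norm_nonneg _), ← inner_self_eq_norm_sq (𝕜 := ℂ), h3,
    inner_self_eq_norm_sq]

theorem WeylSystem.op_op (W : WeylSystem E σ H) (u v : E) (x : H) :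
    W.op u (W.op v x) = Complex.exp (-(Complex.I * (σ u v : ℂ))) • W.op (u + v) x :=
  congrArg (fun L : H →L[ℂ] H => L x) (W.op_mul u v)

/-- `W.op 0` is idempotent by the Weyl relation and injective as an isometry. -/
theorem WeylSystem.op_zero_apply (W : WeylSystem E σ H) (h0 : σ 0 0 = 0) (x : H) :
    W.op 0 x = x := by
  have h1 := W.op_op 0 0 x
  rw [h0, add_zero, Complex.ofReal_zero, mul_zero, neg_zero, Complex.exp_zero, one_smul] at h1
  have h2 : W.op 0 (W.op 0 x - x) = 0 := by rw [map_sub, h1, sub_self]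
  have h3 := W.norm_op 0 (W.op 0 x - x)
  rw [h2, norm_zero] at h3
  exact sub_eq_zero.1 (norm_eq_zero.1 h3.symm)

variable (ρ : DensityOp H)

theorem DensityOp.hasSum_expect {F : H → H} (hF : ∀ j, ρ.w j ≠ 0 → ‖F (ρ.v j)‖ ≤ ‖ρ.v j‖) :
    HasSum (fun j => (ρ.w j : ℂ) * ⟪ρ.v j, F (ρ.v j)⟫_ℂ) (ρ.expect F) := by
  refine Summable.hasSum (Summable.of_norm_bounded ρ.w_sum.summable fun j => ?_)
  by_cases hj : ρ.w j = 0
  · simp [hj]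
  · rw [norm_mul, Complex.norm_real, Real.norm_eq_abs, abs_of_nonneg (ρ.w_nonneg j)]
    refine mul_le_of_le_one_right (ρ.w_nonneg j) ((norm_inner_le_norm _ _).trans ?_)
    rw [ρ.v_unit, one_mul, ← ρ.v_unit j]
    exact hF j hj

/-- Dominated convergence, with the weights as the summable bound. Only ensemble vectors of nonzero
weight matter. -/
theorem DensityOp.tendsto_expect {ι : Type*} {l : Filter ι} [l.NeBot] {F : ι → H → H} {G : H → H}
    (hF : ∀ i j, ρ.w j ≠ 0 → ‖F i (ρ.v j)‖ ≤ ‖ρ.v j‖)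
    (hG : ∀ j, ρ.w j ≠ 0 → Tendsto (fun i => F i (ρ.v j)) l (𝓝 (G (ρ.v j)))) :
    Tendsto (fun i => ρ.expect (F i)) l (𝓝 (ρ.expect G)) := by
  unfold DensityOp.expect
  refine tendsto_tsum_of_dominated_convergence ρ.w_sum.summable (fun j => ?_)
    (Eventually.of_forall fun i j => ?_)
  · by_cases hj : ρ.w j = 0
    · simp [hj]
    · exact (tendsto_const_nhds.inner (hG j hj)).const_mul _
  · by_cases hj : ρ.w j = 0
    · simp [hj]
    · rw [norm_mul, Complex.norm_real, Real.norm_eq_abs, abs_of_nonneg (ρ.w_nonneg j)]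
      refine mul_le_of_le_one_right (ρ.w_nonneg j) ((norm_inner_le_norm _ _).trans ?_)
      rw [ρ.v_unit, one_mul, ← ρ.v_unit j]
      exact hF i j hj

theorem DensityOp.expect_congr {F G : H → H} (h : ∀ j, ρ.w j ≠ 0 → F (ρ.v j) = G (ρ.v j)) :
    ρ.expect F = ρ.expect G := by
  unfold DensityOp.expect
  refine tsum_congr fun j => ?_
  by_cases hj : ρ.w j = 0
  · simp [hj]
  · rw [h j hj]

theorem DensityOp.expect_const_smul (c : ℂ) (F : H → H) :
    ρ.expect (fun x => c • F x) = c * ρ.expect F := by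
  unfold DensityOp.expect
  rw [← tsum_mul_left]
  refine tsum_congr fun j => ?_
  rw [inner_smul_right]
  ring

end Weyl

/-! ### The vacuum state and its coherent vectors. -/

namespace PairSystem

variable {H : Type*} [NormedAddCommGroup H] [InnerProductSpace ℂ H] [CompleteSpace H]
  (W : PairSystem H) (ρ : DensityOp H)

/-- The state has the characteristic function of the vacuum. -/
def IsVacuum : Prop :=
  ∀ u : SeqCoef, ρ.expect (W.op u) = Complex.exp (-((‖coefC u‖ ^ 2 / 2 : ℝ) : ℂ))

variable {W ρ}

theorem isVacuum_of_independent (hind : W.Independent ρ)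
    (hgauss : ∀ k, W.IsGaussian ρ pairCov k) : W.IsVacuum ρ := by
  intro u
  rw [hind u]
  simp_rw [fun k => hgauss k (u k), bil_pairCov_self]
  rw [← Complex.exp_sum, norm_coefC_sq]
  congr 1
  push_cast
  rw [Finset.sum_neg_distrib, Finset.sum_div]

theorem seqForm_self (u : SeqCoef) : seqForm u u = 0 := by
  rw [seqForm_eq_im_inner]
  exact inner_self_im (𝕜 := ℂ) _

theorem op_neg_op (W : PairSystem H) (u : SeqCoef) (x : H) : W.op (-u) (W.op u x) = x := by
  rw [W.op_op, neg_add_cancel, W.op_zero_apply (seqForm_self 0)]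
  have : seqForm (-u) u = 0 := by
    rw [seqForm_eq_im_inner, map_neg, inner_neg_left, Complex.neg_im, ← seqForm_eq_im_inner,
      seqForm_self, neg_zero]
  simp [this]

theorem inner_op_op (W : PairSystem H) (u u' : SeqCoef) (x y : H) :
    ⟪W.op u x, W.op u' y⟫_ℂ
      = Complex.exp (Complex.I * (seqForm u u' : ℂ)) * ⟪x, W.op (u' - u) y⟫_ℂ := by
  have h1 : ∀ x y, ⟪W.op (-u) x, W.op (-u) y⟫_ℂ = ⟪x, y⟫_ℂ := by
    intro x y
    rw [← ContinuousLinearMap.adjoint_inner_left]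
    have := congrArg (fun L : H →L[ℂ] H => L x)
      (Unitary.star_mul_self_of_mem (W.unitary_op (-u)))
    simp only [ContinuousLinearMap.star_eq_adjoint] at this
    exact congrArg (fun x => ⟪x, y⟫_ℂ) this
  rw [← h1, op_neg_op, W.op_op, inner_smul_right, neg_add_eq_sub]
  congr 2
  rw [seqForm_eq_im_inner, seqForm_eq_im_inner, map_neg, inner_neg_left]
  simp

variable (W ρ)

/-- The vector `op u` applied to the purification of the state. -/
def purified (u : SeqCoef) : lp (fun _ : ℕ => H) 2 :=
  ⟨fun j => ((√(ρ.w j) : ℝ) : ℂ) • W.op u (ρ.v j), by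
    refine memℓp_gen (ρ.w_sum.summable.congr fun j => ?_)
    simp [norm_smul, W.norm_op, ρ.v_unit, Real.sq_sqrt (ρ.w_nonneg j)]⟩

theorem purified_apply (u : SeqCoef) (j : ℕ) :
    purified W ρ u j = ((√(ρ.w j) : ℝ) : ℂ) • W.op u (ρ.v j) := rfl

variable {W ρ}

theorem lp_real_smul (s : ℝ) (x : lp (fun _ : ℕ => H) 2) : s • x = (s : ℂ) • x := rfl

theorem lp_complex_real_smul (s : ℝ) (x : lp (fun _ : ℕ => ℂ) 2) : s • x = (s : ℂ) • x := rfl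

theorem ofReal_sqrt_mul_sqrt_weight (ρ : DensityOp H) (j : ℕ) :
    ((√(ρ.w j) : ℝ) : ℂ) * ((√(ρ.w j) : ℝ) : ℂ) = ρ.w j := by
  rw [← Complex.ofReal_mul, Real.mul_self_sqrt (ρ.w_nonneg j)]

/-- The Weyl phase supplies the imaginary part of the exponent and the characteristic function of
`u' - u` the real part. A mixed state thus behaves as the Fock vacuum vector. -/
theorem inner_purified (hv : W.IsVacuum ρ) (u u' : SeqCoef) :
    ⟪purified W ρ u, purified W ρ u'⟫_ℂ
      = Complex.exp (⟪coefC u, coefC u'⟫_ℂ - ((‖coefC u‖ ^ 2 / 2 : ℝ) : ℂ)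
          - ((‖coefC u'‖ ^ 2 / 2 : ℝ) : ℂ)) := by
  have h1 := (ρ.hasSum_expect (F := W.op (u' - u)) fun j _ => (W.norm_op _ _).le).mul_left
    (Complex.exp (Complex.I * (seqForm u u' : ℂ)))
  have h2 : HasSum (fun j => ⟪purified W ρ u j, purified W ρ u' j⟫_ℂ)
      (Complex.exp (Complex.I * (seqForm u u' : ℂ)) * ρ.expect (W.op (u' - u))) := by
    refine h1.congr_fun fun j => ?_
    rw [purified_apply, purified_apply, inner_smul_left, inner_smul_right, inner_op_op,
      Complex.conj_ofReal, ← ofReal_sqrt_mul_sqrt_weight]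
    ring
  rw [(lp.hasSum_inner _ _).unique h2, hv, ← Complex.exp_add]
  congr 1
  rw [seqForm_eq_im_inner, map_sub, norm_sub_sq (𝕜 := ℂ), ← inner_conj_symm (coefC u') (coefC u)]
  simp only [RCLike.re_to_complex, Complex.conj_re]
  conv_rhs => rw [← Complex.re_add_im ⟪coefC u, coefC u'⟫_ℂ]
  push_cast
  ring

/-- Multiplication by `exp(s² ‖coefC u‖² / 2)` removes the normalization and leaves the exponential
vectors, with Gram matrix `exp(c s t)`. -/
theorem differentiableAt_purified (hv : W.IsVacuum ρ) (u : SeqCoef) :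
    DifferentiableAt ℝ (fun s : ℝ => purified W ρ (s • u)) 0 := by
  have h1 : DifferentiableAt ℝ (fun s : ℝ =>
      Real.exp (s ^ 2 * ‖coefC u‖ ^ 2 / 2) • purified W ρ (s • u)) 0 := by
    refine differentiableAt_of_inner_eq_cexp (c := ((‖coefC u‖ ^ 2 : ℝ) : ℂ)) fun s t => ?_
    rw [lp_real_smul, lp_real_smul, inner_smul_left, inner_smul_right,
      inner_purified hv, Complex.conj_ofReal, Complex.ofReal_exp, Complex.ofReal_exp,
      ← Complex.exp_add, ← Complex.exp_add, map_smul, map_smul, norm_smul, norm_smul,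
      lp_complex_real_smul, lp_complex_real_smul, inner_smul_left, inner_smul_right,
      inner_self_eq_norm_sq_to_K, mul_pow, mul_pow, Real.norm_eq_abs, Real.norm_eq_abs, sq_abs,
      sq_abs, Complex.conj_ofReal]
    congr 1
    push_cast
    simp only [Complex.coe_algebraMap]
    ring
  have h2 : DifferentiableAt ℝ (fun s : ℝ => Real.exp (-(s ^ 2 * ‖coefC u‖ ^ 2 / 2))) 0 := by
    fun_prop
  refine (h2.smul h1).congr_of_eventuallyEq (Eventually.of_forall fun s => ?_)
  simp only [Pi.smul_apply', smul_smul, ← Real.exp_add, neg_add_cancel, Real.exp_zero, one_smul]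

variable (W ρ)

/-- The derivative of `s ↦ purified (s u)` at zero. -/
def purifiedDeriv (u : SeqCoef) : lp (fun _ : ℕ => H) 2 :=
  deriv (fun s : ℝ => purified W ρ (s • u)) 0

variable {W ρ}

theorem hasDerivAt_purified (hv : W.IsVacuum ρ) (u : SeqCoef) :
    HasDerivAt (fun s : ℝ => purified W ρ (s • u)) (purifiedDeriv W ρ u) 0 :=
  (differentiableAt_purified hv u).hasDerivAt

theorem inner_purified_purifiedDeriv (hv : W.IsVacuum ρ) (u u' : SeqCoef) :
    ⟪purified W ρ u, purifiedDeriv W ρ u'⟫_ℂ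
      = ⟪coefC u, coefC u'⟫_ℂ * Complex.exp (-((‖coefC u‖ ^ 2 / 2 : ℝ) : ℂ)) := by
  have h1 := (hasDerivAt_const (0 : ℝ) (purified W ρ u)).inner ℂ (hasDerivAt_purified hv u')
  simp only [inner_zero_left, add_zero] at h1
  refine h1.unique ?_
  have e : (fun s : ℝ => ⟪purified W ρ u, purified W ρ (s • u')⟫_ℂ) = fun s : ℝ =>
      Complex.exp ((s : ℂ) * ⟪coefC u, coefC u'⟫_ℂ - ((‖coefC u‖ ^ 2 / 2 : ℝ) : ℂ)
        - (s : ℂ) ^ 2 * ((‖coefC u'‖ ^ 2 / 2 : ℝ) : ℂ)) := by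
    funext s
    rw [inner_purified hv, map_smul, lp_complex_real_smul, inner_smul_right, norm_smul,
      Complex.norm_real, mul_pow, Real.norm_eq_abs, sq_abs]
    congr 2
    push_cast
    ring
  rw [e]
  have h2 : HasDerivAt (fun s : ℂ =>
      Complex.exp (s * ⟪coefC u, coefC u'⟫_ℂ - ((‖coefC u‖ ^ 2 / 2 : ℝ) : ℂ)
        - s ^ 2 * ((‖coefC u'‖ ^ 2 / 2 : ℝ) : ℂ)))
      (⟪coefC u, coefC u'⟫_ℂ * Complex.exp (-((‖coefC u‖ ^ 2 / 2 : ℝ) : ℂ))) ((0 : ℝ) : ℂ) := by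
    have h3 := (((hasDerivAt_id (0 : ℂ)).mul_const ⟪coefC u, coefC u'⟫_ℂ).sub_const
      ((‖coefC u‖ ^ 2 / 2 : ℝ) : ℂ)).sub
      (((hasDerivAt_id (0 : ℂ)).pow 2).mul_const ((‖coefC u'‖ ^ 2 / 2 : ℝ) : ℂ))
    have h4 := h3.cexp
    simpa [mul_comm] using h4
  exact h2.comp_ofReal

theorem inner_purifiedDeriv (hv : W.IsVacuum ρ) (u u' : SeqCoef) :
    ⟪purifiedDeriv W ρ u, purifiedDeriv W ρ u'⟫_ℂ = ⟪coefC u, coefC u'⟫_ℂ := by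
  have h1 := (hasDerivAt_purified hv u).inner ℂ (hasDerivAt_const (0 : ℝ) (purifiedDeriv W ρ u'))
  simp only [inner_zero_right, zero_add] at h1
  refine h1.unique ?_
  have e : (fun s : ℝ => ⟪purified W ρ (s • u), purifiedDeriv W ρ u'⟫_ℂ) = fun s : ℝ =>
      (s : ℂ) * (⟪coefC u, coefC u'⟫_ℂ * Complex.exp (-((s : ℂ) ^ 2 * ((‖coefC u‖ ^ 2 / 2 : ℝ) : ℂ)))) := by
    funext s
    rw [inner_purified_purifiedDeriv hv, map_smul, lp_complex_real_smul, inner_smul_left, norm_smul,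
      Complex.norm_real, mul_pow, Real.norm_eq_abs, sq_abs, Complex.conj_ofReal, mul_assoc]
    congr 3
    push_cast
    ring
  rw [e]
  have h2 : HasDerivAt (fun s : ℂ =>
      s * (⟪coefC u, coefC u'⟫_ℂ * Complex.exp (-(s ^ 2 * ((‖coefC u‖ ^ 2 / 2 : ℝ) : ℂ)))))
      ⟪coefC u, coefC u'⟫_ℂ ((0 : ℝ) : ℂ) := by
    have h3 : DifferentiableAt ℂ (fun s : ℂ =>
      ⟪coefC u, coefC u'⟫_ℂ * Complex.exp (-(s ^ 2 * ((‖coefC u‖ ^ 2 / 2 : ℝ) : ℂ)))) 0 := by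
      fun_prop
    have h4 := (hasDerivAt_id (0 : ℂ)).fun_mul h3.hasDerivAt
    simpa using h4
  exact h2.comp_ofReal

end PairSystem

/-! ### One-particle vectors and derivatives of the exponentials. -/

namespace PairSystem

variable {H : Type*} [NormedAddCommGroup H] [InnerProductSpace ℂ H] [CompleteSpace H]
  {W : PairSystem H} {ρ : DensityOp H}

/-- The directions `ξ k` suffice: by the same inner products the derivative along `η k` is `i` times
that along `ξ k`, as `γ k` annihilates the vacuum. -/
theorem orthonormal_excitation (hv : W.IsVacuum ρ) :
    Orthonormal ℂ fun k : ℕ => purifiedDeriv W ρ (Finsupp.single k (Pi.single 0 1)) := by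
  rw [orthonormal_iff_ite]
  intro j k
  rw [inner_purifiedDeriv hv, coefC_single, coefC_single, lp.inner_single_left, lp.single_apply]
  by_cases h : j = k
  · subst h
    simp [pairC]
  · rw [Pi.single_eq_of_ne h, if_neg h, inner_zero_right]

/-- The isometry that maps a sequence `z` to the one-particle vector generated by it. -/
def oneParticle (hv : W.IsVacuum ρ) : lp (fun _ : ℕ => ℂ) 2 →ₗᵢ[ℂ] lp (fun _ : ℕ => H) 2 :=
  (orthonormal_excitation hv).orthogonalFamily.linearIsometry

theorem hasSum_oneParticle (hv : W.IsVacuum ρ) (z : lp (fun _ : ℕ => ℂ) 2) :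
    HasSum (fun k => z k • purifiedDeriv W ρ (Finsupp.single k (Pi.single 0 1)))
      (oneParticle hv z) :=
  (orthonormal_excitation hv).orthogonalFamily.hasSum_linearIsometry z

theorem pairC_single_zero : pairC (Pi.single 0 1) = 1 := by simp [pairC]

theorem pairC_single_one : pairC (Pi.single 1 1) = Complex.I := by simp [pairC]

theorem inner_coefC_single_mul (u : SeqCoef) (z : lp (fun _ : ℕ => ℂ) 2) (k : ℕ) :
    z k * ⟪coefC u, coefC (Finsupp.single k (Pi.single 0 1))⟫_ℂ = ⟪coefC u k, z k⟫_ℂ := by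
  rw [coefC_single, lp.inner_single_right, pairC_single_zero]
  simp

theorem inner_purified_oneParticle (hv : W.IsVacuum ρ) (u : SeqCoef)
    (z : lp (fun _ : ℕ => ℂ) 2) :
    ⟪purified W ρ u, oneParticle hv z⟫_ℂ
      = ⟪coefC u, z⟫_ℂ * Complex.exp (-((‖coefC u‖ ^ 2 / 2 : ℝ) : ℂ)) := by
  have h1 : HasSum (fun k => ⟪purified W ρ u,
      z k • purifiedDeriv W ρ (Finsupp.single k (Pi.single 0 1))⟫_ℂ)
      ⟪purified W ρ u, oneParticle hv z⟫_ℂ :=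
    (hasSum_oneParticle hv z).mapL (innerSL ℂ (purified W ρ u))
  have h2 := (lp.hasSum_inner (coefC u) z).mul_right
    (Complex.exp (-((‖coefC u‖ ^ 2 / 2 : ℝ) : ℂ)))
  have e : (fun k => ⟪purified W ρ u,
      z k • purifiedDeriv W ρ (Finsupp.single k (Pi.single 0 1))⟫_ℂ)
      = fun k => ⟪coefC u k, z k⟫_ℂ * Complex.exp (-((‖coefC u‖ ^ 2 / 2 : ℝ) : ℂ)) := by
    funext k
    rw [inner_smul_right, inner_purified_purifiedDeriv hv, ← mul_assoc, inner_coefC_single_mul]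
  rw [e] at h1
  exact h1.unique h2

theorem coefC_zero_eq : coefC 0 = 0 := map_zero _

/-- The sequence `u` enters the bound through its `ℓ²` norm only, hence uniformity over the
truncations of a fixed sequence. -/
theorem norm_purified_sub_le (hv : W.IsVacuum ρ) (u : SeqCoef) (s : ℝ) :
    ‖purified W ρ (s • u) - purified W ρ 0 - s • oneParticle hv (coefC u)‖
      ≤ s ^ 2 * ‖coefC u‖ ^ 2 := by
  have hn : ∀ u, ‖purified W ρ u‖ = 1 := by
    intro u
    have h := inner_purified hv u u
    rw [inner_self_eq_norm_sq_to_K, inner_self_eq_norm_sq_to_K] at h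
    have e : ((‖coefC u‖ : ℂ)) ^ 2 - ((‖coefC u‖ ^ 2 / 2 : ℝ) : ℂ) - ((‖coefC u‖ ^ 2 / 2 : ℝ) : ℂ)
        = 0 := by push_cast; ring
    have h2 : (‖purified W ρ u‖ : ℂ) ^ 2 = 1 := by
      rw [← Complex.exp_zero, ← e]
      exact h
    have h3 : ‖purified W ρ u‖ ^ 2 = 1 := by exact_mod_cast h2
    exact (pow_eq_one_iff_of_nonneg (norm_nonneg _) two_ne_zero).1 h3
  have hs : ‖coefC (s • u)‖ ^ 2 = s ^ 2 * ‖coefC u‖ ^ 2 := by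
    rw [map_smul, lp_complex_real_smul, norm_smul, Complex.norm_real, mul_pow, Real.norm_eq_abs,
      sq_abs]
  refine norm_sub_smul_sq_le (sq_nonneg _) (hn _) (hn _) ?_ ?_ ?_ ?_
  · rw [inner_purified hv, coefC_zero_eq, inner_zero_right, norm_zero, hs, Complex.ofReal_exp]
    congr 1
    push_cast
    ring
  · rw [inner_purified_oneParticle, hs, map_smul, lp_complex_real_smul, inner_smul_left,
      inner_self_eq_norm_sq_to_K, Complex.conj_ofReal]
    push_cast
    rfl
  · rw [inner_purified_oneParticle, coefC_zero_eq, inner_zero_left, zero_mul]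
  · rw [LinearIsometry.norm_map]

/-- The derivative of `s ↦ exp(i s Φ(z))` at the `j`-th vector of the ensemble. -/
def fieldAt (hv : W.IsVacuum ρ) (j : ℕ) : lp (fun _ : ℕ => ℂ) 2 →L[ℂ] H :=
  (((√(ρ.w j))⁻¹ : ℝ) : ℂ) • ((lp.evalCLM ℂ (fun _ : ℕ => H) 2 j).comp
    (oneParticle hv).toContinuousLinearMap)

theorem fieldAt_apply (hv : W.IsVacuum ρ) (j : ℕ) (z : lp (fun _ : ℕ => ℂ) 2) :
    fieldAt hv j z = (((√(ρ.w j))⁻¹ : ℝ) : ℂ) • oneParticle hv z j := rfl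

theorem sqrt_weight_ne_zero {j : ℕ} (hj : ρ.w j ≠ 0) : √(ρ.w j) ≠ 0 :=
  (Real.sqrt_pos.2 (lt_of_le_of_ne (ρ.w_nonneg j) (Ne.symm hj))).ne'

theorem sqrt_weight_smul_fieldAt (hv : W.IsVacuum ρ) {j : ℕ} (hj : ρ.w j ≠ 0)
    (z : lp (fun _ : ℕ => ℂ) 2) :
    ((√(ρ.w j) : ℝ) : ℂ) • fieldAt hv j z = oneParticle hv z j := by
  rw [fieldAt_apply, smul_smul, ← Complex.ofReal_mul, mul_inv_cancel₀ (sqrt_weight_ne_zero hj),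
    Complex.ofReal_one, one_smul]

/-- The `j`-th component of the purified estimate, at the price of the factor `w_j^(-1/2)`. -/
theorem norm_op_sub_le (hv : W.IsVacuum ρ) {j : ℕ} (hj : ρ.w j ≠ 0) (u : SeqCoef) (s : ℝ) :
    ‖W.op (s • u) (ρ.v j) - ρ.v j - s • fieldAt hv j (coefC u)‖
      ≤ (√(ρ.w j))⁻¹ * (s ^ 2 * ‖coefC u‖ ^ 2) := by
  have h1 := (lp.norm_apply_le_norm two_ne_zero
    (purified W ρ (s • u) - purified W ρ 0 - s • oneParticle hv (coefC u)) j).trans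
    (norm_purified_sub_le hv u s)
  have h2 : (purified W ρ (s • u) - purified W ρ 0 - s • oneParticle hv (coefC u)) j
      = ((√(ρ.w j) : ℝ) : ℂ) • (W.op (s • u) (ρ.v j) - ρ.v j - s • fieldAt hv j (coefC u)) := by
    rw [smul_sub, smul_sub, lp_real_smul, ← Complex.coe_smul s (fieldAt hv j (coefC u)),
      smul_comm _ (s : ℂ), sqrt_weight_smul_fieldAt hv hj]
    simp only [lp.coeFn_sub, Pi.sub_apply, lp.coeFn_smul, Pi.smul_apply, purified_apply,
      W.op_zero_apply (seqForm_self 0)]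
  rw [h2, norm_smul, Complex.norm_real, Real.norm_eq_abs, abs_of_nonneg (Real.sqrt_nonneg _)] at h1
  have hpos := lt_of_le_of_ne (Real.sqrt_nonneg (ρ.w j)) (Ne.symm (sqrt_weight_ne_zero hj))
  rw [← div_eq_inv_mul, le_div_iff₀ hpos, mul_comm]
  exact h1

theorem hasDerivAt_of_norm_le {E : Type*} [NormedAddCommGroup E] [NormedSpace ℝ E] {f : ℝ → E}
    {v d : E} {C : ℝ} (h0 : f 0 = v) (h : ∀ s, ‖f s - v - s • d‖ ≤ C * s ^ 2) :
    HasDerivAt f d 0 := by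
  rw [hasDerivAt_iff_isLittleO_nhds_zero]
  have h1 : (fun s : ℝ => f (0 + s) - f 0 - s • d) =O[𝓝 0] fun s : ℝ => s ^ 2 := by
    refine Asymptotics.IsBigO.of_bound C (Eventually.of_forall fun s => ?_)
    rw [zero_add, h0, Real.norm_eq_abs, abs_of_nonneg (sq_nonneg s)]
    exact h s
  exact h1.trans_isLittleO (by simpa using Asymptotics.isLittleO_pow_pow (𝕜 := ℝ) one_lt_two)

/-- The derivative of `s ↦ exp(i s Φ(z))` at the vector `op u (v j)`. -/
def fieldOn (hv : W.IsVacuum ρ) (u : SeqCoef) (j : ℕ) : lp (fun _ : ℕ => ℂ) 2 →L[ℝ] H :=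
  ((W.op u).comp (fieldAt hv j)).restrictScalars ℝ +
    (Complex.imCLM.comp ((innerSL ℂ (coefC u)).restrictScalars ℝ)).smulRight
      ((2 * Complex.I) • W.op u (ρ.v j))

theorem fieldOn_apply (hv : W.IsVacuum ρ) (u : SeqCoef) (j : ℕ) (z : lp (fun _ : ℕ => ℂ) 2) :
    fieldOn hv u j z = W.op u (fieldAt hv j z)
      + (⟪coefC u, z⟫_ℂ).im • ((2 * Complex.I) • W.op u (ρ.v j)) := rfl

/-- Weyl operators commute up to a scalar phase, so facts about the ensemble vectors carry over to
all vectors of `coherent`. -/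
theorem op_op_comm (W : PairSystem H) (a u : SeqCoef) (x : H) :
    W.op a (W.op u x)
      = Complex.exp (2 * Complex.I * ((⟪coefC u, coefC a⟫_ℂ).im : ℂ)) • W.op u (W.op a x) := by
  rw [W.op_op, W.op_op, smul_smul, ← Complex.exp_add, add_comm a u, seqForm_eq_im_inner,
    seqForm_eq_im_inner, ← inner_conj_symm (coefC a), Complex.conj_im]
  congr 2
  push_cast
  ring

theorem hasDerivAt_exp_smul_op (W : PairSystem H) (u : SeqCoef) {g : ℝ → H} {g' v : H} (m : ℝ)
    (hg : HasDerivAt g g' 0) (h0 : g 0 = v) :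
    HasDerivAt (fun s : ℝ => Complex.exp (2 * Complex.I * ((s * m : ℝ) : ℂ)) • W.op u (g s))
      (W.op u g' + m • ((2 * Complex.I) • W.op u v)) 0 := by
  have h1 : HasDerivAt (fun s : ℝ => Complex.exp (2 * Complex.I * ((s * m : ℝ) : ℂ)))
      (m * (2 * Complex.I)) 0 := by
    have h2 : HasDerivAt (fun s : ℂ => Complex.exp (2 * Complex.I * (s * m)))
        (m * (2 * Complex.I)) ((0 : ℝ) : ℂ) := by
      have := (((hasDerivAt_id (0 : ℂ)).mul_const (m : ℂ)).const_mul (2 * Complex.I)).cexp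
      simpa [mul_comm] using this
    have h3 := h2.comp_ofReal
    simpa using h3
  have h4 : HasDerivAt (fun s : ℝ => W.op u (g s)) (W.op u g') 0 :=
    ((W.op u).restrictScalars ℝ).hasFDerivAt.comp_hasDerivAt (0 : ℝ) hg
  have h5 := h1.fun_smul h4
  simpa [h0, smul_smul, ← Complex.coe_smul] using h5

theorem hasDerivAt_op_op (hv : W.IsVacuum ρ) {j : ℕ} (hj : ρ.w j ≠ 0) (u a : SeqCoef) :
    HasDerivAt (fun s : ℝ => W.op (s • a) (W.op u (ρ.v j))) (fieldOn hv u j (coefC a)) 0 := by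
  have h0 : HasDerivAt (fun s : ℝ => W.op (s • a) (ρ.v j)) (fieldAt hv j (coefC a)) 0 := by
    refine hasDerivAt_of_norm_le (v := ρ.v j) (C := (√(ρ.w j))⁻¹ * ‖coefC a‖ ^ 2) ?_ fun s => ?_
    · rw [zero_smul, W.op_zero_apply (seqForm_self 0)]
    · refine (norm_op_sub_le hv hj a s).trans_eq (by ring)
  have h1 := hasDerivAt_exp_smul_op W u (v := ρ.v j) (⟪coefC u, coefC a⟫_ℂ).im h0
    (by rw [zero_smul, W.op_zero_apply (seqForm_self 0)])
  refine h1.congr_of_eventuallyEq (Eventually.of_forall fun s => ?_)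
  dsimp only
  rw [op_op_comm, map_smul, lp_complex_real_smul, inner_smul_right, Complex.im_ofReal_mul]

end PairSystem

/-! ### Exponentials of infinite series. -/

namespace PairSystem

variable {H : Type*} [NormedAddCommGroup H] [InnerProductSpace ℂ H] [CompleteSpace H]
  {W : PairSystem H} {ρ : DensityOp H} {c d : ℕ → Fin 2 → ℝ} {z w : lp (fun _ : ℕ => ℂ) 2}

theorem op_mem_space (a : SeqCoef) {x : H} (hx : x ∈ space W ρ) : W.op a x ∈ space W ρ := by
  refine map_mem_closure (W.op a).continuous hx fun y hy => ?_
  change y ∈ Submodule.span ℂ (coherent W ρ) at hy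
  change W.op a y ∈ Submodule.span ℂ (coherent W ρ)
  induction hy using Submodule.span_induction with
  | mem y hy =>
    obtain ⟨u, j, hj, rfl⟩ := hy
    rw [W.op_op]
    exact Submodule.smul_mem _ _ (Submodule.subset_span ⟨a + u, j, hj, rfl⟩)
  | zero => rw [map_zero]; exact Submodule.zero_mem _
  | add x y _ _ hx hy => rw [map_add]; exact Submodule.add_mem _ hx hy
  | smul c x _ hx => rw [map_smul]; exact Submodule.smul_mem _ _ hx

theorem coherent_subset_space {x : H} (hx : x ∈ coherent W ρ) : x ∈ space W ρ :=
  (Submodule.span ℂ (coherent W ρ)).le_topologicalClosure (Submodule.subset_span hx)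

theorem op_mem_coherent (u : SeqCoef) {j : ℕ} (hj : ρ.w j ≠ 0) :
    W.op u (ρ.v j) ∈ coherent W ρ := ⟨u, j, hj, rfl⟩

theorem mem_space (W : PairSystem H) {j : ℕ} (hj : ρ.w j ≠ 0) : ρ.v j ∈ space W ρ := by
  have h := coherent_subset_space (op_mem_coherent (W := W) 0 hj)
  rwa [W.op_zero_apply (seqForm_self 0)] at h

/-- The Gram matrix of the purified truncations is a continuous function of their coefficients,
which converge in `ℓ²`; then take the `j`-th component. -/
theorem exists_tendsto_op_trunc_vec (hv : W.IsVacuum ρ) (hc : IsCoef c z) {j : ℕ}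
    (hj : ρ.w j ≠ 0) : ∃ y, Tendsto (fun N => W.op (trunc c N) (ρ.v j)) atTop (𝓝 y) := by
  have hz := hc.tendsto
  have h1 : Tendsto (fun p : ℕ × ℕ => ⟪purified W ρ (trunc c p.1), purified W ρ (trunc c p.2)⟫_ℂ)
      (atTop ×ˢ atTop) (𝓝 (Complex.exp (⟪z, z⟫_ℂ - ((‖z‖ ^ 2 / 2 : ℝ) : ℂ)
          - ((‖z‖ ^ 2 / 2 : ℝ) : ℂ)))) := by
    simp_rw [inner_purified hv]
    have ha := hz.comp (tendsto_fst (f := (atTop : Filter ℕ)) (g := (atTop : Filter ℕ)))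
    have hb := hz.comp (tendsto_snd (f := (atTop : Filter ℕ)) (g := (atTop : Filter ℕ)))
    have hn : ∀ {l : Filter (ℕ × ℕ)} {f : ℕ × ℕ → lp (fun _ : ℕ => ℂ) 2}, Tendsto f l (𝓝 z) →
        Tendsto (fun p => ((‖f p‖ ^ 2 / 2 : ℝ) : ℂ)) l (𝓝 ((‖z‖ ^ 2 / 2 : ℝ) : ℂ)) :=
      fun hf => (Complex.continuous_ofReal.tendsto _).comp ((hf.norm.pow 2).div_const 2)
    exact (Complex.continuous_exp.tendsto _).comp (((ha.inner hb).sub (hn ha)).sub (hn hb))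
  obtain ⟨y, hy⟩ := exists_tendsto_of_tendsto_inner (x := fun N => purified W ρ (trunc c N)) h1
  have h2 := (((lp.evalCLM ℂ (fun _ : ℕ => H) 2 j).continuous.tendsto y).comp hy).const_smul
    (((√(ρ.w j))⁻¹ : ℝ) : ℂ)
  refine ⟨_, h2.congr fun N => ?_⟩
  change (((√(ρ.w j))⁻¹ : ℝ) : ℂ) • (((√(ρ.w j) : ℝ) : ℂ) • W.op (trunc c N) (ρ.v j)) = _
  rw [smul_smul, ← Complex.ofReal_mul, inv_mul_cancel₀ (sqrt_weight_ne_zero hj),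
    Complex.ofReal_one, one_smul]

theorem tendsto_phase (hc : IsCoef c z) (u : SeqCoef) :
    Tendsto (fun N => Complex.exp (2 * Complex.I *
        ((⟪coefC u, coefC (trunc c N)⟫_ℂ).im : ℂ))) atTop
      (𝓝 (Complex.exp (2 * Complex.I * ((⟪coefC u, z⟫_ℂ).im : ℂ)))) := by
  have h : Continuous fun y : lp (fun _ : ℕ => ℂ) 2 =>
      Complex.exp (2 * Complex.I * ((⟪coefC u, y⟫_ℂ).im : ℂ)) := by fun_prop
  exact (h.tendsto z).comp hc.tendsto

theorem exists_tendsto_op_trunc (hv : W.IsVacuum ρ) (hc : IsCoef c z) :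
    ∀ x ∈ space W ρ, ∃ y, Tendsto (fun N => W.op (trunc c N) x) atTop (𝓝 y) := by
  refine exists_tendsto_of_span (U := fun N x => W.op (trunc c N) x)
    (fun _ _ _ _ _ => map_add _ _ _) (fun _ _ _ _ => map_smul _ _ _)
    (fun _ _ _ => (W.norm_op _ _).le) ?_
  rintro x ⟨u, j, hj, rfl⟩
  obtain ⟨y, hy⟩ := exists_tendsto_op_trunc_vec hv hc hj
  refine ⟨_, ((tendsto_phase hc u).smul (((W.op u).continuous.tendsto y).comp hy)).congr
    fun N => ?_⟩
  exact (op_op_comm W _ _ _).symm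

theorem tendsto_expSeries (hv : W.IsVacuum ρ) (hc : IsCoef c z) {x : H} (hx : x ∈ space W ρ) :
    Tendsto (fun N => W.op (trunc c N) x) atTop (𝓝 (expSeries W c x)) :=
  tendsto_nhds_limUnder (exists_tendsto_op_trunc hv hc x hx)

theorem expSeries_mem (hv : W.IsVacuum ρ) (hc : IsCoef c z) {x : H} (hx : x ∈ space W ρ) :
    expSeries W c x ∈ space W ρ :=
  (Submodule.isClosed_topologicalClosure _).mem_of_tendsto (tendsto_expSeries hv hc hx)
    (Eventually.of_forall fun _ => op_mem_space _ hx)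

theorem norm_expSeries (hv : W.IsVacuum ρ) (hc : IsCoef c z) {x : H} (hx : x ∈ space W ρ) :
    ‖expSeries W c x‖ = ‖x‖ := by
  refine tendsto_nhds_unique (tendsto_expSeries hv hc hx).norm ?_
  simp_rw [W.norm_op]
  exact tendsto_const_nhds

theorem expSeries_add (hv : W.IsVacuum ρ) (hc : IsCoef c z) {x y : H} (hx : x ∈ space W ρ)
    (hy : y ∈ space W ρ) : expSeries W c (x + y) = expSeries W c x + expSeries W c y := by
  refine tendsto_nhds_unique (tendsto_expSeries hv hc (Submodule.add_mem _ hx hy)) ?_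
  simp_rw [map_add]
  exact (tendsto_expSeries hv hc hx).add (tendsto_expSeries hv hc hy)

theorem expSeries_smul (hv : W.IsVacuum ρ) (hc : IsCoef c z) (a : ℂ) {x : H}
    (hx : x ∈ space W ρ) : expSeries W c (a • x) = a • expSeries W c x := by
  refine tendsto_nhds_unique (tendsto_expSeries hv hc (Submodule.smul_mem _ a hx)) ?_
  simp_rw [map_smul]
  exact (tendsto_expSeries hv hc hx).const_smul a

theorem expSeries_expSeries (hv : W.IsVacuum ρ) (hc : IsCoef c z) (hd : IsCoef d w) {x : H}
    (hx : x ∈ space W ρ) :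
    expSeries W c (expSeries W d x)
      = Complex.exp (-(Complex.I * ((⟪z, w⟫_ℂ).im : ℂ))) • expSeries W (c + d) x := by
  have hy := expSeries_mem hv hd hx
  have h1 : Tendsto (fun N => W.op (trunc c N) (W.op (trunc d N) x)) atTop
      (𝓝 (expSeries W c (expSeries W d x))) := by
    -- Both factors vary with `N`, but the left one is isometric, so that the error of the right one
    -- is not amplified.
    have h0 : Tendsto (fun N => W.op (trunc c N) (W.op (trunc d N) x - expSeries W d x)) atTop
        (𝓝 0) := by
      rw [tendsto_zero_iff_norm_tendsto_zero]
      simp_rw [W.norm_op]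
      exact (tendsto_iff_norm_sub_tendsto_zero).1 (tendsto_expSeries hv hd hx)
    have h2 := h0.add (tendsto_expSeries hv hc hy)
    rw [zero_add] at h2
    refine h2.congr fun N => ?_
    rw [map_sub, sub_add_cancel]
  refine tendsto_nhds_unique h1 ?_
  have h3 : Tendsto (fun N => Complex.exp (-(Complex.I *
      ((⟪coefC (trunc c N), coefC (trunc d N)⟫_ℂ).im : ℂ)))) atTop
      (𝓝 (Complex.exp (-(Complex.I * ((⟪z, w⟫_ℂ).im : ℂ))))) := by
    have hcont : Continuous fun y : ℂ => Complex.exp (-(Complex.I * (y.im : ℂ))) := by fun_prop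
    exact (hcont.tendsto _).comp (hc.tendsto.inner hd.tendsto)
  refine (h3.smul (tendsto_expSeries hv (hc.add hd) hx)).congr fun N => ?_
  rw [W.op_op, seqForm_eq_im_inner, trunc_add]

theorem expSeries_zero (W : PairSystem H) (x : H) : expSeries W 0 x = x := by
  refine Tendsto.limUnder_eq (tendsto_const_nhds.congr fun N => ?_)
  have : trunc 0 N = 0 := by simp [trunc]
  rw [this, W.op_zero_apply (seqForm_self 0)]

/-- At the ensemble vectors the quadratic remainder passes to the limit of the truncations; the
other vectors of `coherent` follow by commuting with `W.op u`. -/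
theorem hasDerivAt_expSeries (hv : W.IsVacuum ρ) (hc : IsCoef c z) (u : SeqCoef) {j : ℕ}
    (hj : ρ.w j ≠ 0) :
    HasDerivAt (fun s : ℝ => expSeries W (s • c) (W.op u (ρ.v j))) (fieldOn hv u j z) 0 := by
  have h0 : HasDerivAt (fun s : ℝ => expSeries W (s • c) (ρ.v j)) (fieldAt hv j z) 0 := by
    refine hasDerivAt_of_norm_le (v := ρ.v j) (C := (√(ρ.w j))⁻¹ * ‖z‖ ^ 2) ?_ fun s => ?_
    · rw [zero_smul, expSeries_zero]
    · have h1 := (((tendsto_expSeries hv (hc.smul s) (mem_space W hj)).sub_const (ρ.v j)).sub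
        ((((fieldAt hv j).continuous.tendsto z).comp hc.tendsto).const_smul s)).norm
      have h2 := ((hc.tendsto.norm.pow 2).const_mul (s ^ 2)).const_mul (√(ρ.w j))⁻¹
      refine (le_of_tendsto_of_tendsto' h1 h2 fun N => ?_).trans_eq (by ring)
      rw [trunc_smul]
      exact norm_op_sub_le hv hj _ s
  have h1 := hasDerivAt_exp_smul_op W u (v := ρ.v j) (⟪coefC u, z⟫_ℂ).im h0
    (by rw [zero_smul, expSeries_zero])
  refine h1.congr_of_eventuallyEq (Eventually.of_forall fun s => ?_)
  refine tendsto_nhds_unique (tendsto_expSeries hv (hc.smul s) (op_mem_space u (mem_space W hj))) ?_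
  have h2 := (tendsto_phase (hc.smul s) u).smul (((W.op u).continuous.tendsto _).comp
    (tendsto_expSeries hv (hc.smul s) (mem_space W hj)))
  rw [lp_complex_real_smul, inner_smul_right, Complex.im_ofReal_mul] at h2
  exact h2.congr fun N => (op_op_comm W _ _ _).symm

theorem expSeries_group (hv : W.IsVacuum ρ) (hc : IsCoef c z) (s t : ℝ) {x : H}
    (hx : x ∈ space W ρ) :
    expSeries W ((s + t) • c) x = expSeries W (s • c) (expSeries W (t • c) x) := by
  rw [expSeries_expSeries hv (hc.smul s) (hc.smul t) hx, add_smul, lp_complex_real_smul,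
    lp_complex_real_smul, inner_smul_left, inner_smul_right, Complex.conj_ofReal,
    Complex.im_ofReal_mul, Complex.im_ofReal_mul]
  have : (⟪z, z⟫_ℂ).im = 0 := inner_self_im (𝕜 := ℂ) z
  rw [this, mul_zero, mul_zero, Complex.ofReal_zero, mul_zero, neg_zero, Complex.exp_zero, one_smul]

/-- By the group law continuity at zero suffices. There it follows from differentiability on
`coherent` and extends to the closed span by isometry. -/
theorem continuous_expSeries (hv : W.IsVacuum ρ) (hc : IsCoef c z) {x : H}
    (hx : x ∈ space W ρ) : Continuous fun s : ℝ => expSeries W (s • c) x := by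
  have h0 : ∀ x ∈ space W ρ, ∃ y, Tendsto (fun s : ℝ => expSeries W (s • c) x) (𝓝 0) (𝓝 y) := by
    refine exists_tendsto_of_span (U := fun (s : ℝ) x => expSeries W (s • c) x)
      (fun s x hx y hy => expSeries_add hv (hc.smul s) hx hy)
      (fun s a x hx => expSeries_smul hv (hc.smul s) a hx)
      (fun s x hx => (norm_expSeries hv (hc.smul s) hx).le) ?_
    rintro x ⟨u, j, hj, rfl⟩
    exact ⟨_, (hasDerivAt_expSeries hv hc u hj).continuousAt⟩
  rw [continuous_iff_continuousAt]
  intro s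
  obtain ⟨y, hy⟩ := h0 _ (expSeries_mem hv (hc.smul s) hx)
  have hy0 : y = expSeries W (s • c) x := by
    -- The neighbourhood filter is not punctured, so the limit must be the value at zero.
    have h1 := tendsto_pure_nhds (fun r : ℝ => expSeries W (r • c) (expSeries W (s • c) x)) 0
    have h2 := tendsto_nhds_unique (hy.mono_left (pure_le_nhds 0)) h1
    rw [h2, zero_smul, expSeries_zero]
  rw [hy0] at hy
  have h3 : Tendsto (fun r : ℝ => r - s) (𝓝 s) (𝓝 0) := by
    have : Continuous fun r : ℝ => r - s := by fun_prop
    simpa using this.tendsto s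
  refine (hy.comp h3).congr fun r => ?_
  simp only [Function.comp]
  rw [← expSeries_group hv hc _ _ hx, sub_add_cancel]

theorem exponentiates (hv : W.IsVacuum ρ) (hc : IsCoef c z) {Y : H → H}
    (hY : ∀ u j, ρ.w j ≠ 0 → Complex.I • Y (W.op u (ρ.v j)) = fieldOn hv u j z) :
    W.Exponentiates ρ c Y where
  tendsto s _ hx := tendsto_expSeries hv (hc.smul s) hx
  maps s _ hx := expSeries_mem hv (hc.smul s) hx
  norm s _ hx := norm_expSeries hv (hc.smul s) hx
  group s t _ hx := expSeries_group hv hc s t hx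
  cont _ hx := continuous_expSeries hv hc hx
  gen := by
    rintro x ⟨u, j, hj, rfl⟩
    rw [hY u j hj]
    exact hasDerivAt_expSeries hv hc u hj

theorem expect_expSeries (hv : W.IsVacuum ρ) (hc : IsCoef c z) :
    ρ.expect (expSeries W c) = Complex.exp (-((‖z‖ ^ 2 / 2 : ℝ) : ℂ)) := by
  have h1 : Tendsto (fun N => ρ.expect (W.op (trunc c N))) atTop (𝓝 (ρ.expect (expSeries W c))) :=
    ρ.tendsto_expect (fun N j _ => (W.norm_op _ _).le)
      (fun j hj => tendsto_expSeries hv hc (mem_space W hj))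
  refine tendsto_nhds_unique h1 ?_
  simp_rw [hv _]
  have hcont : Continuous fun y : lp (fun _ : ℕ => ℂ) 2 =>
      Complex.exp (-((‖y‖ ^ 2 / 2 : ℝ) : ℂ)) := by fun_prop
  exact (hcont.tendsto z).comp hc.tendsto

end PairSystem

/-! ### Values of partially defined operators. -/

section EvalsTo

variable {H : Type*} [NormedAddCommGroup H] [InnerProductSpace ℂ H]

/-- The vector `x` is in the domain of `Y`, and `Y x = y`. -/
def EvalsTo (Y : H →ₗ.[ℂ] H) (x y : H) : Prop := ∃ hx : x ∈ Y.domain, Y ⟨x, hx⟩ = y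

variable {Y Z : H →ₗ.[ℂ] H} {x y z : H}

theorem EvalsTo.evalAt (h : EvalsTo Y x y) : evalAt Y x = y := by
  obtain ⟨hx, hy⟩ := h
  unfold _root_.evalAt
  rw [dif_pos hx, hy]

theorem EvalsTo.add (hY : EvalsTo Y x y) (hZ : EvalsTo Z x z) : EvalsTo (Y + Z) x (y + z) := by
  obtain ⟨h1, rfl⟩ := hY
  obtain ⟨h2, rfl⟩ := hZ
  exact ⟨⟨h1, h2⟩, rfl⟩

theorem EvalsTo.smul (c : ℂ) (hY : EvalsTo Y x y) : EvalsTo (c • Y) x (c • y) := by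
  obtain ⟨h1, rfl⟩ := hY
  exact ⟨h1, rfl⟩

theorem EvalsTo.sum {ι : Type*} {Y : ι → H →ₗ.[ℂ] H} {y : ι → H} (s : Finset ι)
    (h : ∀ k, EvalsTo (Y k) x (y k)) : EvalsTo (∑ k ∈ s, Y k) x (∑ k ∈ s, y k) := by
  classical
  induction s using Finset.induction_on with
  | empty => exact ⟨trivial, rfl⟩
  | insert k s hk ih =>
    rw [Finset.sum_insert hk, Finset.sum_insert hk]
    exact (h k).add ih

theorem EvalsTo.opSeries {Y : ℕ → H →ₗ.[ℂ] H} {y : ℕ → H} (h : ∀ k, EvalsTo (Y k) x (y k))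
    (hz : Tendsto (fun N => ∑ k ∈ Finset.range N, y k) atTop (𝓝 z)) :
    EvalsTo (opSeries Y) x z := by
  have h1 : Tendsto (fun N => ∑ k ∈ Finset.range N, _root_.evalAt (Y k) x) atTop (𝓝 z) :=
    hz.congr fun N => Finset.sum_congr rfl fun k _ => (h k).evalAt.symm
  exact ⟨⟨fun k => (h k).1, z, h1⟩, h1.limUnder_eq⟩

end EvalsTo

/-! ### The series for the process: domain, mean, covariance, mean square convergence. -/

namespace PairSystem

variable {H : Type*} [NormedAddCommGroup H] [InnerProductSpace ℂ H] [CompleteSpace H]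
  {W : PairSystem H} {ρ : DensityOp H} {n : ℕ}

theorem evalsTo_gen (hv : W.IsVacuum ρ) (a u : SeqCoef) {j : ℕ} (hj : ρ.w j ≠ 0) :
    EvalsTo (W.gen a) (W.op u (ρ.v j)) ((-Complex.I) • fieldOn hv u j (coefC a)) := by
  have h := hasDerivAt_op_op hv hj u a
  exact ⟨h.differentiableAt, congrArg ((-Complex.I) • ·) h.deriv⟩

theorem single_sqrt_mul_conj (k : ℕ) (r : ℝ) (c : ℂ) :
    lp.single (E := fun _ : ℕ => ℂ) 2 k (r * conj c)
      = (r * c.re) • lp.single (E := fun _ : ℕ => ℂ) 2 k 1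
        + (-(r * c.im)) • lp.single (E := fun _ : ℕ => ℂ) 2 k Complex.I := by
  rw [lp_complex_real_smul, lp_complex_real_smul, ← lp.single_smul, ← lp.single_smul,
    ← lp.single_add]
  congr 1
  simp only [smul_eq_mul]
  conv_lhs => rw [← Complex.re_add_im (conj c), Complex.conj_re, Complex.conj_im]
  push_cast
  ring

/-- `Re (c γ) = Re c · ξ - Im c · η` has the complex coefficient `conj c`. The computation goes
through the real-linearity of `fieldOn`. -/
theorem evalsTo_qklTerm (hv : W.IsVacuum ρ) (μ : ℕ → ℝ) (h : ℕ → ℝ → Fin n → ℂ) (t : ℝ)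
    (a : Fin n) (k : ℕ) (u : SeqCoef) {j : ℕ} (hj : ρ.w j ≠ 0) :
    EvalsTo (W.qklTerm μ h t a k) (W.op u (ρ.v j))
      ((-Complex.I) • fieldOn hv u j (lp.single 2 k (√(μ k) * conj (h k t a)))) := by
  have h0 : EvalsTo (W.ζ k 0) (W.op u (ρ.v j)) ((-Complex.I) • fieldOn hv u j (lp.single 2 k 1)) := by
    have := evalsTo_gen hv (Finsupp.single k (Pi.single 0 1)) u hj
    rwa [coefC_single, pairC_single_zero] at this
  have h1 : EvalsTo (W.ζ k 1) (W.op u (ρ.v j))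
      ((-Complex.I) • fieldOn hv u j (lp.single 2 k Complex.I)) := by
    have := evalsTo_gen hv (Finsupp.single k (Pi.single 1 1)) u hj
    rwa [coefC_single, pairC_single_one] at this
  set c := h k t a
  have hγ := (h0.add (h1.smul Complex.I)).smul c
  have hγd := (h0.add (h1.smul (-Complex.I))).smul (conj c)
  have hre := ((hγ.add hγd).smul (1 / 2 : ℂ)).smul ((√(μ k) : ℝ) : ℂ)
  have e : (-Complex.I) • fieldOn hv u j (lp.single 2 k (√(μ k) * conj c))
      = ((√(μ k) : ℝ) : ℂ) • (1 / 2 : ℂ) •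
        (c • ((-Complex.I) • fieldOn hv u j (lp.single 2 k 1) + Complex.I • (-Complex.I) •
            fieldOn hv u j (lp.single 2 k Complex.I))
          + conj c • ((-Complex.I) • fieldOn hv u j (lp.single 2 k 1) + (-Complex.I) •
            (-Complex.I) • fieldOn hv u j (lp.single 2 k Complex.I))) := by
    rw [single_sqrt_mul_conj, map_add, map_smul, map_smul, ← Complex.coe_smul, ← Complex.coe_smul]
    set p := fieldOn hv u j (lp.single 2 k 1)
    set q := fieldOn hv u j (lp.single 2 k Complex.I)
    have hc : c = c.re + c.im * Complex.I := (Complex.re_add_im c).symm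
    have hcc : conj c = c.re - c.im * Complex.I := Complex.ext (by simp) (by simp)
    rw [hcc]
    nth_rewrite 3 [hc]
    have hI := Complex.I_mul_I
    push_cast
    match_scalars
    · ring
    · linear_combination (√(μ k) * c.im * Complex.I : ℂ) * hI
  rw [e]
  exact hre

section Series

variable {μ : ℕ → ℝ} {h : ℕ → ℝ → Fin n → ℂ} {t : ℝ} {a : Fin n}
  {z : lp (fun _ : ℕ => ℂ) 2}

/-- `fieldOn` is continuous and real-linear, so it maps the `ℓ²` expansion of `z` to the convergent
series. -/
theorem evalsTo_qkl (hv : W.IsVacuum ρ) (hz : ∀ k, z k = √(μ k) * conj (h k t a)) (u : SeqCoef)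
    {j : ℕ} (hj : ρ.w j ≠ 0) :
    EvalsTo (W.qkl μ h t a) (W.op u (ρ.v j)) ((-Complex.I) • fieldOn hv u j z) := by
  refine EvalsTo.opSeries (fun k => evalsTo_qklTerm hv μ h t a k u hj) ?_
  have h1 := ((lp.hasSum_single (p := 2) (by simp) z).mapL (fieldOn hv u j)).tendsto_sum_nat
  refine (h1.const_smul (-Complex.I)).congr fun N => ?_
  rw [Finset.smul_sum]
  refine Finset.sum_congr rfl fun k _ => ?_
  rw [hz]

theorem fieldOn_zero (hv : W.IsVacuum ρ) (j : ℕ) (z : lp (fun _ : ℕ => ℂ) 2) :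
    fieldOn hv 0 j z = fieldAt hv j z := by
  rw [fieldOn_apply, W.op_zero_apply (seqForm_self 0), coefC_zero_eq, inner_zero_left,
    Complex.zero_im, zero_smul, add_zero]

theorem evalsTo_qkl_vec (hv : W.IsVacuum ρ) (hz : ∀ k, z k = √(μ k) * conj (h k t a))
    {j : ℕ} (hj : ρ.w j ≠ 0) :
    EvalsTo (W.qkl μ h t a) (ρ.v j) ((-Complex.I) • fieldAt hv j z) := by
  have := evalsTo_qkl hv hz 0 hj
  rwa [fieldOn_zero, W.op_zero_apply (seqForm_self 0)] at this

theorem coherent_subset_domain (hv : W.IsVacuum ρ) (hz : ∀ k, z k = √(μ k) * conj (h k t a)) :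
    coherent W ρ ⊆ (W.qkl μ h t a).domain := by
  rintro x ⟨u, j, hj, rfl⟩
  exact (evalsTo_qkl hv hz u hj).1

/-- Sums over the ensemble run over all `j`, whereas the process is evaluated only at vectors of
nonzero weight; the remaining components contribute nothing. -/
theorem oneParticle_apply_eq_zero (hv : W.IsVacuum ρ) {j : ℕ} (hj : ρ.w j = 0)
    (z : lp (fun _ : ℕ => ℂ) 2) : oneParticle hv z j = 0 := by
  have h1 : ∀ u, purifiedDeriv W ρ u j = 0 := by
    intro u
    have h2 : HasDerivAt (fun s : ℝ => purified W ρ (s • u) j) (purifiedDeriv W ρ u j) 0 :=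
      ((lp.evalCLM ℂ (fun _ : ℕ => H) 2 j).restrictScalars ℝ).hasFDerivAt.comp_hasDerivAt (0 : ℝ)
        (hasDerivAt_purified hv u)
    refine h2.unique ?_
    simp only [purified_apply, hj, Real.sqrt_zero, Complex.ofReal_zero, zero_smul]
    exact hasDerivAt_const _ _
  have h2 : HasSum (fun k => z k • purifiedDeriv W ρ (Finsupp.single k (Pi.single 0 1)) j)
      (oneParticle hv z j) :=
    (hasSum_oneParticle hv z).mapL (lp.evalCLM ℂ (fun _ : ℕ => H) 2 j)
  simp only [h1, smul_zero] at h2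
  exact h2.unique hasSum_zero

/-- One-particle vectors are orthogonal to the vacuum. -/
theorem hasMean_qkl (hv : W.IsVacuum ρ) (hz : ∀ k, z k = √(μ k) * conj (h k t a)) :
    ρ.HasMean (W.qkl μ h t a) 0 := by
  refine ⟨fun j hj => (evalsTo_qkl_vec hv hz hj).1, ?_⟩
  have h1 := (lp.hasSum_inner (purified W ρ 0) (oneParticle hv z)).mul_left (-Complex.I)
  rw [inner_purified_oneParticle, coefC_zero_eq, inner_zero_left, zero_mul, mul_zero] at h1
  refine h1.congr_fun fun j => ?_
  by_cases hj : ρ.w j = 0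
  · rw [oneParticle_apply_eq_zero hv hj, hj]
    simp
  · rw [(evalsTo_qkl_vec hv hz hj).evalAt, ← sqrt_weight_smul_fieldAt hv hj, purified_apply,
      W.op_zero_apply (seqForm_self 0), inner_smul_left, inner_smul_right, inner_smul_right,
      Complex.conj_ofReal, ← ofReal_sqrt_mul_sqrt_weight]
    ring

/-- Summing the weighted inner products over the ensemble gives the inner product of two
one-particle vectors, and `oneParticle` is an isometry. -/
theorem hasCov_qkl (hv : W.IsVacuum ρ) {s : ℝ} {b : Fin n} {w : lp (fun _ : ℕ => ℂ) 2}
    (hz : ∀ k, z k = √(μ k) * conj (h k s a)) (hw : ∀ k, w k = √(μ k) * conj (h k t b)) :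
    ρ.HasCov (W.qkl μ h s a) (W.qkl μ h t b) ⟪z, w⟫_ℂ := by
  refine ⟨fun j hj => (evalsTo_qkl_vec hv hz hj).1, fun j hj => (evalsTo_qkl_vec hv hw hj).1, ?_⟩
  have h1 := lp.hasSum_inner (𝕜 := ℂ) (oneParticle hv z) (oneParticle hv w)
  rw [LinearIsometry.inner_map_map] at h1
  refine h1.congr_fun fun j => ?_
  by_cases hj : ρ.w j = 0
  · rw [oneParticle_apply_eq_zero hv hj, hj]
    simp
  · rw [(evalsTo_qkl_vec hv hz hj).evalAt, (evalsTo_qkl_vec hv hw hj).evalAt,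
      ← sqrt_weight_smul_fieldAt hv hj, ← sqrt_weight_smul_fieldAt hv hj, inner_smul_left,
      inner_smul_right, inner_smul_left, inner_smul_right, Complex.conj_ofReal,
      ← ofReal_sqrt_mul_sqrt_weight, map_neg, Complex.conj_I]
    linear_combination (-(((√(ρ.w j) : ℝ) : ℂ) * ((√(ρ.w j) : ℝ) : ℂ) *
      ⟪fieldAt hv j z, fieldAt hv j w⟫_ℂ)) * Complex.I_mul_I

theorem msTendsto_qkl (hv : W.IsVacuum ρ) (hz : ∀ k, z k = √(μ k) * conj (h k t a)) :
    ρ.MSTendsto (fun N => ∑ k ∈ Finset.range N, W.qklTerm μ h t a k) (W.qkl μ h t a) := by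
  set zN : ℕ → lp (fun _ : ℕ => ℂ) 2 := fun N => ∑ k ∈ Finset.range N, lp.single 2 k (z k)
    with hzN
  have hev : ∀ N j, ρ.w j ≠ 0 → EvalsTo (∑ k ∈ Finset.range N, W.qklTerm μ h t a k) (ρ.v j)
      ((-Complex.I) • fieldAt hv j (zN N)) := by
    intro N j hj
    have h1 := EvalsTo.sum (Finset.range N) (fun k => evalsTo_qklTerm hv μ h t a k 0 hj)
    rw [W.op_zero_apply (seqForm_self 0), ← Finset.smul_sum] at h1
    simp_rw [fieldOn_zero, ← hz] at h1
    rwa [← map_sum] at h1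
  refine ⟨fun N j hj => (hev N j hj).1, fun j hj => (evalsTo_qkl_vec hv hz hj).1,
    fun N => ‖zN N - z‖ ^ 2, fun N => ?_, ?_⟩
  · have h1 := (lp.hasSum_inner (oneParticle hv (zN N - z)) (oneParticle hv (zN N - z))).mapL
      Complex.reCLM
    have h2 : HasSum (fun j => ‖oneParticle hv (zN N - z) j‖ ^ 2) (‖zN N - z‖ ^ 2) := by
      rw [LinearIsometry.inner_map_map] at h1
      have e : Complex.reCLM ⟪zN N - z, zN N - z⟫_ℂ = ‖zN N - z‖ ^ 2 :=
        inner_self_eq_norm_sq (𝕜 := ℂ) _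
      rw [e] at h1
      refine h1.congr_fun fun j => ?_
      exact (inner_self_eq_norm_sq (𝕜 := ℂ) _).symm
    refine h2.congr_fun fun j => ?_
    by_cases hj : ρ.w j = 0
    · rw [oneParticle_apply_eq_zero hv hj, hj]
      simp
    · rw [(evalsTo_qkl_vec hv hz hj).evalAt, (hev N j hj).evalAt, ← smul_sub, ← map_sub,
        ← sqrt_weight_smul_fieldAt hv hj, norm_smul, norm_smul, mul_pow, mul_pow, norm_neg,
        Complex.norm_I, Complex.norm_real, Real.norm_eq_abs, sq_abs, Real.sq_sqrt (ρ.w_nonneg j)]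
      ring
  · have h1 := (lp.hasSum_single (p := 2) (by simp) z).tendsto_sum_nat
    have h2 := (tendsto_iff_norm_sub_tendsto_zero.1 h1).pow 2
    rwa [zero_pow two_ne_zero] at h2

end Series

end PairSystem

/-! ### Exponents and phases of ordered products. -/

section Lists

variable {α E : Type*} [NormedAddCommGroup E] [InnerProductSpace ℂ E] {n : ℕ}

theorem inner_list_map_sum (x : E) (z : α → E) (l : List α) :
    ⟪x, (l.map z).sum⟫_ℂ = (l.map fun q => ⟪x, z q⟫_ℂ).sum := by
  induction l with
  | nil => simp
  | cons p l ih => simp only [List.map_cons, List.sum_cons, inner_add_right, ih]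

theorem list_map_sum_inner (x : E) (z : α → E) (l : List α) :
    ⟪(l.map z).sum, x⟫_ℂ = (l.map fun q => ⟪z q, x⟫_ℂ).sum := by
  induction l with
  | nil => simp
  | cons p l ih => simp only [List.map_cons, List.sum_cons, inner_add_left, ih]

/-- The phase `∑_{j<k} Im ⟨z_j, z_k⟩` of an ordered product of exponentials. -/
def orderedPhase (z : α → E) : List α → ℝ
  | [] => 0
  | p :: l => (⟪z p, (l.map z).sum⟫_ℂ).im + orderedPhase z l

variable {K : ℝ → Matrix (Fin n) (Fin n) ℂ} {z : ℝ × (Fin n → ℝ) → E}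

theorem jointExponent_eq {l : List (ℝ × (Fin n → ℝ))}
    (hz : ∀ p ∈ l, ∀ q ∈ l, ⟪z p, z q⟫_ℂ = bil (K (p.1 - q.1)) p.2 q.2) :
    jointExponent K l = ((‖(l.map z).sum‖ ^ 2 / 2 : ℝ) : ℂ) := by
  have h1 : ((‖(l.map z).sum‖ ^ 2 : ℝ) : ℂ) = ⟪(l.map z).sum, (l.map z).sum⟫_ℂ := by
    rw [inner_self_eq_norm_sq_to_K]
    push_cast
    rfl
  unfold jointExponent
  rw [Complex.ofReal_div, h1, list_map_sum_inner, Complex.ofReal_ofNat]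
  congr 2
  refine List.map_congr_left fun p hp => ?_
  rw [inner_list_map_sum]
  congr 1
  exact List.map_congr_left fun q hq => (hz p hp q hq).symm

/-- Expanding the norm of the sum captures the real part of each cross term once; the imaginary
parts make up the phase. -/
theorem orderedExponent_eq {l : List (ℝ × (Fin n → ℝ))}
    (hz : ∀ p ∈ l, ∀ q ∈ l, ⟪z p, z q⟫_ℂ = bil (K (p.1 - q.1)) p.2 q.2) :
    orderedExponent K l
      = ((‖(l.map z).sum‖ ^ 2 / 2 : ℝ) : ℂ) + Complex.I * (orderedPhase z l : ℂ) := by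
  induction l with
  | nil => simp [orderedExponent, orderedPhase]
  | cons p l ih =>
    have h0 : bil (K 0) p.2 p.2 = ((‖z p‖ ^ 2 : ℝ) : ℂ) := by
      rw [← sub_self p.1, ← hz p (by simp) p (by simp), inner_self_eq_norm_sq_to_K]
      push_cast
      rfl
    have h1 : (l.map fun q => bil (K (p.1 - q.1)) p.2 q.2).sum = ⟪z p, (l.map z).sum⟫_ℂ := by
      rw [inner_list_map_sum]
      congr 1
      exact List.map_congr_left fun q hq => (hz p (by simp) q (by simp [hq])).symm
    have h2 := norm_add_sq (𝕜 := ℂ) (z p) (l.map z).sum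
    rw [orderedExponent, ih fun p hp q hq => hz p (by simp [hp]) q (by simp [hq]), h0, h1,
      List.map_cons, List.sum_cons, orderedPhase, h2]
    change _ = (((‖z p‖ ^ 2 + 2 * (⟪z p, (l.map z).sum⟫_ℂ).re + ‖(l.map z).sum‖ ^ 2) / 2 : ℝ) : ℂ)
      + _
    nth_rewrite 1 [← Complex.re_add_im ⟪z p, (l.map z).sum⟫_ℂ]
    push_cast
    ring

theorem orderedExponent_eq_joint {l : List (ℝ × (Fin n → ℝ))}
    (hz : ∀ p ∈ l, ∀ q ∈ l, ⟪z p, z q⟫_ℂ = bil (K (p.1 - q.1)) p.2 q.2) :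
    orderedExponent K l = jointExponent K l + Complex.I * (orderedPhase z l : ℂ) := by
  rw [orderedExponent_eq hz, jointExponent_eq hz]

/-- Each factor multiplied from the left contributes its phase with the sum of those on its right.
-/
theorem WeylSystem.foldr_op {F : Type*} [AddCommGroup F] [Module ℝ F] {σ : F → F → ℝ}
    {H : Type*} [NormedAddCommGroup H] [InnerProductSpace ℂ H] [CompleteSpace H]
    (W : WeylSystem F σ H) (Φ : F →ₗ[ℝ] E) (hσ : ∀ f g, (⟪Φ f, Φ g⟫_ℂ).im = σ f g)
    (e : α → F) (l : List α) (x : H) :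
    l.foldr (fun p y => W.op (e p) y) x
      = Complex.exp (-(Complex.I * (orderedPhase (fun p => Φ (e p)) l : ℂ))) •
        W.op (l.map e).sum x := by
  induction l with
  | nil =>
    have h0 : σ 0 0 = 0 := by rw [← hσ, map_zero, inner_zero_left, Complex.zero_im]
    simp [orderedPhase, W.op_zero_apply h0]
  | cons p l ih =>
    have h1 : (l.map fun p => Φ (e p)).sum = Φ (l.map e).sum := by
      rw [map_list_sum, List.map_map]
      rfl
    rw [List.foldr_cons, ih, map_smul, W.op_op, smul_smul, ← Complex.exp_add, List.map_cons,
      List.sum_cons, orderedPhase, h1, hσ]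
    congr 2
    push_cast
    ring

end Lists

/-! ### Multipoint functions and the quasi-characteristic functional. -/

namespace PairSystem

variable {H : Type*} [NormedAddCommGroup H] [InnerProductSpace ℂ H] [CompleteSpace H]
  {W : PairSystem H} {ρ : DensityOp H} {n : ℕ} {α : Type*}

theorem _root_.IsCoef.list_sum {c : α → ℕ → Fin 2 → ℝ} {z : α → lp (fun _ : ℕ => ℂ) 2}
    {l : List α} (hc : ∀ p ∈ l, IsCoef (c p) (z p)) : IsCoef (l.map c).sum (l.map z).sum := by
  induction l with
  | nil => exact IsCoef.zero
  | cons p l ih =>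
    exact (hc p (by simp)).add (ih fun q hq => hc q (by simp [hq]))

theorem foldr_expSeries (hv : W.IsVacuum ρ) {c : α → ℕ → Fin 2 → ℝ}
    {z : α → lp (fun _ : ℕ => ℂ) 2} {l : List α} (hc : ∀ p ∈ l, IsCoef (c p) (z p)) {x : H}
    (hx : x ∈ space W ρ) :
    l.foldr (fun p y => expSeries W (c p) y) x
      = Complex.exp (-(Complex.I * (orderedPhase z l : ℂ))) • expSeries W (l.map c).sum x := by
  induction l with
  | nil => simp [orderedPhase, expSeries_zero]
  | cons p l ih =>
    have hl := IsCoef.list_sum fun q hq => hc q (List.mem_cons_of_mem p hq)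
    have hp := hc p (by simp)
    have hexp : ∀ r s : ℝ, Complex.exp (-(Complex.I * (r : ℂ))) *
        Complex.exp (-(Complex.I * (s : ℂ))) = Complex.exp (-(Complex.I * ((s + r : ℝ) : ℂ))) := by
      intro r s
      rw [← Complex.exp_add]
      congr 1
      push_cast
      ring
    rw [List.foldr_cons, ih fun q hq => hc q (List.mem_cons_of_mem p hq),
      expSeries_smul hv hp _ (expSeries_mem hv hl hx), expSeries_expSeries hv hp hl hx, smul_smul,
      hexp, List.map_cons, List.sum_cons, orderedPhase]

theorem orderedQCF_eq (hv : W.IsVacuum ρ) {K : ℝ → Matrix (Fin n) (Fin n) ℂ}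
    {c : ℝ → (Fin n → ℝ) → ℕ → Fin 2 → ℝ} {z : ℝ × (Fin n → ℝ) → lp (fun _ : ℕ => ℂ) 2}
    {l : List (ℝ × (Fin n → ℝ))} (hc : ∀ p ∈ l, IsCoef (c p.1 p.2) (z p))
    (hz : ∀ p ∈ l, ∀ q ∈ l, ⟪z p, z q⟫_ℂ = bil (K (p.1 - q.1)) p.2 q.2) :
    orderedQCF ρ (fun t u => expSeries W (c t u)) l = Complex.exp (-orderedExponent K l) := by
  have h1 := ρ.expect_congr (F := fun x => l.foldr (fun p y => expSeries W (c p.1 p.2) y) x)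
    (G := fun x => Complex.exp (-(Complex.I * (orderedPhase z l : ℂ))) •
      expSeries W (l.map fun p => c p.1 p.2).sum x)
    fun j hj => foldr_expSeries (α := ℝ × (Fin n → ℝ)) hv (c := fun p => c p.1 p.2) hc
      (mem_space W hj)
  unfold orderedQCF
  rw [h1, ρ.expect_const_smul,
    expect_expSeries hv (IsCoef.list_sum (α := ℝ × (Fin n → ℝ)) (c := fun p => c p.1 p.2) hc),
    orderedExponent_eq hz,
    ← Complex.exp_add]
  congr 1
  ring

variable {μ : ℕ → ℝ} {h : ℕ → ℝ → Fin n → ℂ} {ζ : ℝ → Fin n → lp (fun _ : ℕ => ℂ) 2}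

theorem qklCoef_isCoef {t : ℝ} (hζ : ∀ a k, ζ t a k = √(μ k) * conj (h k t a)) (u : Fin n → ℝ) :
    IsCoef (qklCoef μ h t u) (∑ a, u a • ζ t a) := by
  intro k
  have : (∑ a, u a • ζ t a) k = ∑ a, (u a : ℂ) * (√(μ k) * conj (h k t a)) := by
    rw [lp.coeFn_sum, Finset.sum_apply]
    refine Finset.sum_congr rfl fun a _ => ?_
    rw [← hζ]
    rfl
  rw [this]
  simp only [pairC, qklCoef, Matrix.cons_val_zero, Matrix.cons_val_one]
  apply Complex.ext
  · simp [Finset.mul_sum]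
    exact Finset.sum_congr rfl fun a _ => by ring
  · simp [Finset.mul_sum]
    exact Finset.sum_congr rfl fun a _ => by ring

theorem evalAt_combination (hv : W.IsVacuum ρ) {t : ℝ}
    (hζ : ∀ a k, ζ t a k = √(μ k) * conj (h k t a)) (u : Fin n → ℝ) (v : SeqCoef) {j : ℕ}
    (hj : ρ.w j ≠ 0) :
    ∑ a, (u a : ℂ) • evalAt (W.qkl μ h t a) (W.op v (ρ.v j))
      = (-Complex.I) • fieldOn hv v j (∑ a, u a • ζ t a) := by
  rw [map_sum, Finset.smul_sum]
  refine Finset.sum_congr rfl fun a _ => ?_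
  rw [(evalsTo_qkl hv (hζ a) v hj).evalAt, map_smul, smul_comm, Complex.coe_smul]

theorem I_smul_evalAt_list (hv : W.IsVacuum ρ) {l : List (ℝ × (Fin n → ℝ))}
    (hζ : ∀ p ∈ l, ∀ a k, ζ p.1 a k = √(μ k) * conj (h k p.1 a)) (v : SeqCoef) {j : ℕ}
    (hj : ρ.w j ≠ 0) :
    Complex.I • (l.map fun p => ∑ a, (p.2 a : ℂ) •
        evalAt (W.qkl μ h p.1 a) (W.op v (ρ.v j))).sum
      = fieldOn hv v j (l.map fun p => ∑ a, p.2 a • ζ p.1 a).sum := by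
  induction l with
  | nil => simp
  | cons p l ih =>
    simp only [List.map_cons, List.sum_cons, map_add, smul_add]
    rw [ih fun q hq => hζ q (List.mem_cons_of_mem p hq),
      evalAt_combination hv (hζ p (by simp)) _ _ hj, smul_smul]
    simp

theorem inner_combination {K : ℝ → Matrix (Fin n) (Fin n) ℂ} {E : Type*} [NormedAddCommGroup E]
    [InnerProductSpace ℂ E] {F : ℝ → Fin n → E} {s t : ℝ}
    (hK : ∀ a b, ⟪F s a, F t b⟫_ℂ = K (s - t) a b) (u v : Fin n → ℝ) :
    ⟪∑ a, u a • F s a, ∑ b, v b • F t b⟫_ℂ = bil (K (s - t)) u v := by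
  simp_rw [bil, sum_inner, inner_sum, ← Complex.coe_smul, inner_smul_left, inner_smul_right, hK,
    dotProduct, Matrix.mulVec, dotProduct, cvec, Finset.mul_sum, Complex.conj_ofReal]
  refine Finset.sum_congr rfl fun a _ => Finset.sum_congr rfl fun b _ => ?_
  ring

section Integral

variable {T : ℝ} {f : ℝ → Fin n → ℝ}

theorem _root_.SqInt.cvec (hf : SqInt T f) : SqInt T fun t => cvec (f t) := by
  refine MemLp.of_le hf ?_ (ae_of_all _ fun t => ?_)
  · have : Continuous fun x : Fin n → ℝ => _root_.cvec x :=
      continuous_pi fun a => Complex.continuous_ofReal.comp (continuous_apply a)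
    exact this.comp_aestronglyMeasurable hf.aestronglyMeasurable
  · rw [pi_norm_le_iff_of_nonneg (norm_nonneg _)]
    intro a
    simpa [_root_.cvec] using norm_le_pi_norm (f t) a

/-- The Bochner integral in `ℓ²` may be evaluated coordinatewise, as coordinates are continuous
functionals. -/
theorem qklIntCoef_isCoef (hF : ∀ a, ContinuousOn (fun t => ζ t a) (Set.Icc 0 T))
    (hζ : ∀ t ∈ Set.Icc 0 T, ∀ a k, ζ t a k = √(μ k) * conj (h k t a)) (hf : SqInt T f) :
    IsCoef (qklIntCoef T μ h f) (synthesis T ζ fun t => cvec (f t)) := by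
  intro k
  have hi := integrableOn_synthesis hF (SqInt.cvec hf)
  have h1 := (lp.evalCLM ℂ (fun _ : ℕ => ℂ) 2 k).integral_comp_comm hi
  have hk := (lp.evalCLM ℂ (fun _ : ℕ => ℂ) 2 k).integrable_comp hi
  change _ = (synthesis T ζ fun t => cvec (f t)) k at h1
  rw [← h1]
  have hpt : ∀ t ∈ Set.Icc 0 T, lp.evalCLM ℂ (fun _ : ℕ => ℂ) 2 k (∑ a, cvec (f t) a • ζ t a)
      = pairC (qklCoef μ h t (f t) k) := fun t ht => qklCoef_isCoef (hζ t ht) (f t) k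
  have hre := Complex.reCLM.integral_comp_comm hk
  have him := Complex.imCLM.integral_comp_comm hk
  simp only [pairC, qklIntCoef]
  refine Complex.ext ?_ ?_
  · simp only [Complex.add_re, Complex.ofReal_re, Complex.mul_re, Complex.I_re, Complex.I_im,
      Complex.ofReal_im, mul_zero, mul_one, sub_self, add_zero]
    refine hre.symm.trans (setIntegral_congr_fun measurableSet_Icc fun t ht => ?_)
    change (lp.evalCLM ℂ (fun _ : ℕ => ℂ) 2 k (∑ a, cvec (f t) a • ζ t a)).re = _
    rw [hpt t ht]
    simp [pairC]
  · simp only [Complex.add_im, Complex.ofReal_im, Complex.mul_im, Complex.I_re, Complex.I_im,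
      Complex.ofReal_re, mul_zero, mul_one, zero_add, add_zero]
    refine him.symm.trans (setIntegral_congr_fun measurableSet_Icc fun t ht => ?_)
    change (lp.evalCLM ℂ (fun _ : ℕ => ℂ) 2 k (∑ a, cvec (f t) a • ζ t a)).im = _
    rw [hpt t ht]
    simp [pairC]

theorem evalAt_combination_ae (hv : W.IsVacuum ρ)
    (hζ : ∀ t ∈ Set.Icc 0 T, ∀ a k, ζ t a k = √(μ k) * conj (h k t a)) (v : SeqCoef) {j : ℕ}
    (hj : ρ.w j ≠ 0) :
    (fun t => (-Complex.I) • fieldOn hv v j (∑ a, cvec (f t) a • ζ t a))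
      =ᵐ[volume.restrict (Set.Icc 0 T)]
      fun t => ∑ a, (f t a : ℂ) • evalAt (W.qkl μ h t a) (W.op v (ρ.v j)) := by
  filter_upwards [ae_restrict_mem measurableSet_Icc] with t ht
  exact (evalAt_combination hv (hζ t ht) (f t) v hj).symm

theorem integrableOn_evalAt (hv : W.IsVacuum ρ)
    (hF : ∀ a, ContinuousOn (fun t => ζ t a) (Set.Icc 0 T))
    (hζ : ∀ t ∈ Set.Icc 0 T, ∀ a k, ζ t a k = √(μ k) * conj (h k t a)) (hf : SqInt T f)
    (v : SeqCoef) {j : ℕ} (hj : ρ.w j ≠ 0) :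
    IntegrableOn (fun t => ∑ a, (f t a : ℂ) • evalAt (W.qkl μ h t a) (W.op v (ρ.v j)))
      (Set.Icc 0 T) := by
  have h1 := (fieldOn hv v j).integrable_comp (integrableOn_synthesis hF (SqInt.cvec hf))
  exact (h1.smul (-Complex.I)).congr (evalAt_combination_ae hv hζ v hj)

theorem I_smul_integral_evalAt (hv : W.IsVacuum ρ)
    (hF : ∀ a, ContinuousOn (fun t => ζ t a) (Set.Icc 0 T))
    (hζ : ∀ t ∈ Set.Icc 0 T, ∀ a k, ζ t a k = √(μ k) * conj (h k t a)) (hf : SqInt T f)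
    (v : SeqCoef) {j : ℕ} (hj : ρ.w j ≠ 0) :
    Complex.I • ∫ t in Set.Icc 0 T,
        ∑ a, (f t a : ℂ) • evalAt (W.qkl μ h t a) (W.op v (ρ.v j))
      = fieldOn hv v j (synthesis T ζ fun t => cvec (f t)) := by
  rw [← integral_congr_ae (evalAt_combination_ae hv hζ v hj), integral_smul, smul_smul,
    (fieldOn hv v j).integral_comp_comm (integrableOn_synthesis hF (SqInt.cvec hf)), mul_neg,
    Complex.I_mul_I, neg_neg, one_smul]
  rfl

end Integral

end PairSystem

/-! ### The invariant state of the oscillator. -/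

section InvariantState

variable {E F G : Type*} [NormedAddCommGroup E] [InnerProductSpace ℂ E] [AddCommGroup F]
  [Module ℝ F] [NormedAddCommGroup G] [InnerProductSpace ℂ G] [CompleteSpace G]

/-- Weyl systems are continuous along lines by definition. For finitely many directions, the
operator of a sum is a product of operators along lines, up to phases that tend to one. -/
theorem WeylSystem.tendsto_op_sum {σ : F → F → ℝ} (W : WeylSystem F σ G) (Φ : F →ₗ[ℝ] E)
    (hσ : ∀ f g, (⟪Φ f, Φ g⟫_ℂ).im = σ f g) {α ι : Type*} {l : Filter ι} (e : α → F)
    (s : Finset α) {c : ι → α → ℝ} (hc : ∀ a, Tendsto (fun i => c i a) l (𝓝 0)) (y : G) :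
    Tendsto (fun i => W.op (∑ a ∈ s, c i a • e a) y) l (𝓝 y) := by
  classical
  have h0 : σ 0 0 = 0 := by rw [← hσ, map_zero, inner_zero_left, Complex.zero_im]
  induction s using Finset.induction_on with
  | empty =>
    simp only [Finset.sum_empty, W.op_zero_apply h0]
    exact tendsto_const_nhds
  | insert a s ha ih =>
    set q : ι → F := fun i => ∑ b ∈ s, c i b • e b
    have hΦ : Tendsto (fun i => Φ (q i)) l (𝓝 0) := by
      have h1 : Tendsto (fun i => ∑ b ∈ s, c i b • Φ (e b)) l (𝓝 (∑ b ∈ s, (0 : ℝ) • Φ (e b))) :=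
        tendsto_finsetSum _ fun b _ => (hc b).smul_const _
      simp only [zero_smul, Finset.sum_const_zero] at h1
      refine h1.congr fun i => ?_
      simp only [q, map_sum, map_smul]
    have hphase : Tendsto (fun i => Complex.exp (Complex.I * (σ (c i a • e a) (q i) : ℂ))) l
        (𝓝 1) := by
      have hcont : Continuous fun p : E × E =>
          Complex.exp (Complex.I * ((⟪p.1, p.2⟫_ℂ).im : ℂ)) := by fun_prop
      have h1 : Tendsto (fun i => (Φ (c i a • e a), Φ (q i))) l (𝓝 ((0 : ℝ) • Φ (e a), 0)) := by
        simp_rw [map_smul]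
        exact ((hc a).smul_const _).prodMk_nhds hΦ
      have h2 := (hcont.tendsto _).comp h1
      simp only [inner_zero_right, Complex.zero_im, Complex.ofReal_zero, mul_zero,
        Complex.exp_zero] at h2
      refine h2.congr fun i => ?_
      simp only [Function.comp, hσ]
    have hline : Tendsto (fun i => W.op (c i a • e a) y) l (𝓝 y) := by
      have h1 := ((W.continuous_op (e a) y).tendsto 0).comp (hc a)
      rwa [zero_smul, W.op_zero_apply h0] at h1
    have hcomp : Tendsto (fun i => W.op (c i a • e a) (W.op (q i) y)) l (𝓝 y) := by
      have h1 : Tendsto (fun i => W.op (c i a • e a) (W.op (q i) y - y)) l (𝓝 0) := by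
        rw [tendsto_zero_iff_norm_tendsto_zero]
        simp_rw [W.norm_op]
        exact tendsto_iff_norm_sub_tendsto_zero.1 ih
      have h2 := h1.add hline
      rw [zero_add] at h2
      refine h2.congr fun i => ?_
      rw [map_sub, sub_add_cancel]
    have h3 := hphase.smul hcomp
    rw [one_smul] at h3
    refine h3.congr fun i => ?_
    rw [W.op_op, smul_smul, ← Complex.exp_add, add_neg_cancel, Complex.exp_zero, one_smul,
      Finset.sum_insert ha]

variable {n ν : ℕ} {S : OQHO n ν} {V : Matrix (Fin n) (Fin n) ℂ}

theorem tendsto_exp_transpose_mulVec {A : Matrix (Fin n) (Fin n) ℝ} (hA : IsHurwitz A)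
    (u : Fin n → ℝ) : Tendsto (fun t : ℝ => NormedSpace.exp (t • Aᵀ) *ᵥ u) atTop (𝓝 0) := by
  rw [tendsto_pi_nhds]
  intro a
  have hc : Continuous fun M : Matrix (Fin n) (Fin n) ℂ => ((Mᵀ *ᵥ cvec u) a).re := by fun_prop
  have h1 := (hc.tendsto 0).comp (tendsto_cexpm hA)
  simp only [Matrix.transpose_zero, Matrix.zero_mulVec, Pi.zero_apply, Complex.zero_re] at h1
  refine h1.congr fun t => ?_
  simp only [Function.comp]
  rw [← cmat_exp_transpose, cmat_mulVec_cvec]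
  rfl

theorem norm_sq_feature {D : Matrix (Fin n) (Fin n) ℂ} (hD : V = Dᴴ * D)
    (f : (Fin n → ℝ) × FieldSpace ν) :
    ‖feature D ν f‖ ^ 2 = (bil V f.1 f.1).re + ‖f.2‖ ^ 2 := by
  have h1 := congrArg Complex.re (inner_feature (ν := ν) hD f f)
  rw [inner_compLp_itoRoot', Complex.add_re, Complex.add_re, Complex.ofReal_re,
    Complex.re_ofReal_mul, Complex.I_re, mul_zero, add_zero, real_inner_self_eq_norm_sq] at h1
  rw [← h1]
  exact (inner_self_eq_norm_sq (𝕜 := ℂ) _).symm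

theorem covKernel_zero (A : Matrix (Fin n) (Fin n) ℝ) (V : Matrix (Fin n) (Fin n) ℂ) :
    covKernel A V 0 = V := by
  have h := covKernel_eq A V 0 0
  rw [min_self, sub_self, cexpm_zero, Matrix.transpose_one, Matrix.mul_one, Matrix.one_mul] at h
  exact h

/-- Equal-time stationarity: the noise variance makes up for the decayed part of the initial
variance. -/
theorem norm_sq_elem {D : Matrix (Fin n) (Fin n) ℂ} (hD : V = Dᴴ * D)
    (hV : cmat S.A * V + V * (cmat S.A)ᵀ + cmat S.B * itoMatrix ν * (cmat S.B)ᵀ = 0)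
    {t : ℝ} (ht : 0 ≤ t) (u : Fin n → ℝ) :
    ‖(S.elem t u).2‖ ^ 2 = (bil V u u).re - (bil V (S.elem t u).1 (S.elem t u).1).re := by
  have h1 := congrArg Complex.re (inner_feature_elem hD hV ht ht u u)
  rw [sub_self, covKernel_zero] at h1
  have h2 : (⟪feature D ν (S.elem t u), feature D ν (S.elem t u)⟫_ℂ).re
      = ‖feature D ν (S.elem t u)‖ ^ 2 :=
    inner_self_eq_norm_sq (𝕜 := ℂ) (feature D ν (S.elem t u))
  rw [← h1, h2, norm_sq_feature hD]
  ring

variable {Z : S.Model G} {ϱ : DensityOp G}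

/-- By the product property and invariance, the initial characteristic function at `u` is its value
at `exp(tAᵀ) u` times the Gaussian factor of the noise. As `t → ∞` the first factor tends to one and
the second to the Gaussian with covariance `V`. No Gaussianity of the initial state is assumed. -/
theorem expect_op_initial {D : Matrix (Fin n) (Fin n) ℂ} (hD : V = Dᴴ * D) (hA : IsHurwitz S.A)
    (hV : cmat S.A * V + V * (cmat S.A)ᵀ + cmat S.B * itoMatrix ν * (cmat S.B)ᵀ = 0)
    (hi : S.IsInvariantVacuum Z ϱ) (u : Fin n → ℝ) :
    ϱ.expect (Z.op (u, 0)) = Complex.exp (-(((bil V u u).re / 2 : ℝ) : ℂ)) := by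
  have hfac : ∀ t : ℝ, 0 ≤ t → ϱ.expect (Z.op (S.elem t u))
      = ϱ.expect (Z.op ((S.elem t u).1, 0)) * Complex.exp (-((((bil V u u).re
        - (bil V (S.elem t u).1 (S.elem t u).1).re) / 2 : ℝ) : ℂ)) := by
    intro t ht
    rw [← norm_sq_elem hD hV ht]
    have h1 := hi.product (S.elem t u).1 (S.elem t u).2
    rw [hi.vacuum] at h1
    rw [Complex.ofReal_div, Complex.ofReal_pow, Complex.ofReal_ofNat]
    exact h1
  have hzero : (S.elem 0 u).1 = u := by
    change NormedSpace.exp ((0 : ℝ) • S.Aᵀ) *ᵥ u = u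
    rw [zero_smul, NormedSpace.exp_zero, Matrix.one_mulVec]
  have hinit : ϱ.expect (Z.op (S.elem 0 u)) = ϱ.expect (Z.op (u, 0)) := by
    rw [hfac 0 le_rfl, hzero, sub_self, zero_div, Complex.ofReal_zero, neg_zero, Complex.exp_zero,
      mul_one]
  have hx : Tendsto (fun t => (S.elem t u).1) atTop (𝓝 0) := tendsto_exp_transpose_mulVec hA u
  have hχ : Tendsto (fun t => ϱ.expect (Z.op ((S.elem t u).1, 0))) atTop (𝓝 1) := by
    have h1 : Tendsto (fun t => ϱ.expect (Z.op ((S.elem t u).1, 0))) atTop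
        (𝓝 (ϱ.expect fun y => y)) := by
      refine ϱ.tendsto_expect (fun t j _ => (Z.norm_op _ _).le) fun j _ => ?_
      refine (Z.tendsto_op_sum (feature D ν) (im_inner_feature hD hA hV)
        (fun a : Fin n => (Pi.single a 1, 0)) Finset.univ (tendsto_pi_nhds.1 hx) (ϱ.v j)).congr
        fun t => ?_
      congr 2
      refine Prod.ext ?_ ?_
      · rw [Prod.fst_sum]
        ext b
        simp [Finset.sum_apply, Pi.single_apply]
      · rw [Prod.snd_sum]
        simp
    have h2 : (ϱ.expect fun y => y) = 1 := by
      refine (ϱ.hasSum_expect fun j _ => le_rfl).unique ?_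
      have h3 := ϱ.w_sum.mapL Complex.ofRealCLM
      refine h3.congr_fun fun j => ?_
      simp [inner_self_eq_norm_sq_to_K, ϱ.v_unit]
    rwa [h2] at h1
  have hq : Tendsto (fun t => Complex.exp (-((((bil V u u).re
      - (bil V (S.elem t u).1 (S.elem t u).1).re) / 2 : ℝ) : ℂ))) atTop
      (𝓝 (Complex.exp (-(((bil V u u).re / 2 : ℝ) : ℂ)))) := by
    have hc : Continuous fun x : Fin n → ℝ =>
        Complex.exp (-((((bil V u u).re - (bil V x x).re) / 2 : ℝ) : ℂ)) := by
      unfold bil cvec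
      fun_prop
    have h1 := (hc.tendsto 0).comp hx
    have h2 : bil V (0 : Fin n → ℝ) 0 = 0 := by
      have : cvec (0 : Fin n → ℝ) = 0 := by ext; simp [cvec]
      rw [bil, this, zero_dotProduct]
    rw [h2, Complex.zero_re, sub_zero] at h1
    exact h1
  have hlim := hχ.mul hq
  rw [one_mul] at hlim
  refine tendsto_nhds_unique (tendsto_const_nhds.congr' ?_) hlim
  filter_upwards [eventually_ge_atTop 0] with t ht
  rw [← hfac t ht, hi.invariant t ht, hinit]

theorem expect_op {D : Matrix (Fin n) (Fin n) ℂ} (hD : V = Dᴴ * D) (hA : IsHurwitz S.A)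
    (hV : cmat S.A * V + V * (cmat S.A)ᵀ + cmat S.B * itoMatrix ν * (cmat S.B)ᵀ = 0)
    (hi : S.IsInvariantVacuum Z ϱ) (f : (Fin n → ℝ) × FieldSpace ν) :
    ϱ.expect (Z.op f) = Complex.exp (-((‖feature D ν f‖ ^ 2 / 2 : ℝ) : ℂ)) := by
  have h1 := hi.product f.1 f.2
  rw [hi.vacuum, expect_op_initial hD hA hV hi, ← Complex.exp_add] at h1
  rw [norm_sq_feature hD]
  refine h1.trans ?_
  congr 1
  push_cast
  ring

/-- The feature vectors have the kernel as Gram matrix, so both functions reduce to the norm of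
their sum and, for the ordered one, the phase. -/
theorem expect_op_elem {D : Matrix (Fin n) (Fin n) ℂ} (hD : V = Dᴴ * D) (hA : IsHurwitz S.A)
    (hV : cmat S.A * V + V * (cmat S.A)ᵀ + cmat S.B * itoMatrix ν * (cmat S.B)ᵀ = 0)
    (hi : S.IsInvariantVacuum Z ϱ) {l : List (ℝ × (Fin n → ℝ))} (hl : ∀ p ∈ l, 0 ≤ p.1) :
    ϱ.expect (Z.op (l.map fun p => S.elem p.1 p.2).sum)
        = Complex.exp (-jointExponent (covKernel S.A V) l) ∧
      orderedQCF ϱ (fun t u => Z.op (S.elem t u)) l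
        = Complex.exp (-orderedExponent (covKernel S.A V) l) := by
  have hz : ∀ p ∈ l, ∀ q ∈ l, ⟪feature D ν (S.elem p.1 p.2), feature D ν (S.elem q.1 q.2)⟫_ℂ
      = bil (covKernel S.A V (p.1 - q.1)) p.2 q.2 :=
    fun p hp q hq => inner_feature_elem hD hV (hl p hp) (hl q hq) p.2 q.2
  have hsum : feature D ν (l.map fun p => S.elem p.1 p.2).sum
      = (l.map fun p => feature D ν (S.elem p.1 p.2)).sum := by
    rw [map_list_sum, List.map_map]
    rfl
  have h1 : ϱ.expect (Z.op (l.map fun p => S.elem p.1 p.2).sum)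
      = Complex.exp (-jointExponent (covKernel S.A V) l) := by
    rw [expect_op hD hA hV hi, hsum,
      jointExponent_eq (z := fun p => feature D ν (S.elem p.1 p.2)) hz]
  refine ⟨h1, ?_⟩
  unfold orderedQCF
  rw [funext (Z.foldr_op (feature D ν) (im_inner_feature hD hA hV)
    (fun p : ℝ × (Fin n → ℝ) => S.elem p.1 p.2) l), ϱ.expect_const_smul, h1,
    orderedExponent_eq_joint (z := fun p => feature D ν (S.elem p.1 p.2)) hz, neg_add_rev,
    Complex.exp_add]
  rfl

end InvariantState

/-! ### Combination of the two representations. -/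

open scoped ComplexOrder MatrixOrder Matrix.Norms.L2Operator in
theorem exists_root_of_lyapunov {n ν : ℕ} {S : OQHO n ν} (hA : IsHurwitz S.A)
    {V : Matrix (Fin n) (Fin n) ℂ}
    (hV : cmat S.A * V + V * (cmat S.A)ᵀ + cmat S.B * itoMatrix ν * (cmat S.B)ᵀ = 0) :
    ∃ D : Matrix (Fin n) (Fin n) ℂ, V = Dᴴ * D :=
  CStarAlgebra.nonneg_iff_eq_star_mul_self.mp (posSemidef_of_lyapunov hA hV).nonneg

/-- The coefficients of the series for the entries of `X(t)`, as vectors with the covariance of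
the oscillator. -/
theorem OQHO.exists_coefficients {n ν : ℕ} {S : OQHO n ν}
    {V : Matrix (Fin n) (Fin n) ℂ} {D : Matrix (Fin n) (Fin n) ℂ} (hD : V = Dᴴ * D)
    (hV : cmat S.A * V + V * (cmat S.A)ᵀ + cmat S.B * itoMatrix ν * (cmat S.B)ᵀ = 0)
    {T : ℝ} (hT : 0 < T) {μ : ℕ → ℝ} {h : ℕ → ℝ → Fin n → ℂ}
    (hμh : IsEigenSystem T (covKernel S.A V) μ h) :
    ∃ ζ : ℝ → Fin n → lp (fun _ : ℕ => ℂ) 2,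
      (∀ a, ContinuousOn (fun t => ζ t a) (Set.Icc 0 T)) ∧
      (∀ t ∈ Set.Icc 0 T, ∀ a k, ζ t a k = √(μ k) * conj (h k t a)) ∧
      ∀ s ∈ Set.Icc 0 T, ∀ t ∈ Set.Icc 0 T, ∀ a b,
        ⟪ζ s a, ζ t b⟫_ℂ = covKernel S.A V (s - t) a b := by
  refine _root_.exists_coefficients hT
    (F := fun t a => feature D ν (S.elem t (Pi.single a 1))) (fun a b => ?_) ?_ hμh
  · exact (continuous_apply b).comp ((continuous_apply a).comp (continuous_covKernel S.A V))
  · intro s hs t ht a b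
    rw [inner_feature_elem hD hV hs.1 ht.1]
    have hc : ∀ a : Fin n, cvec (Pi.single a 1) = Pi.single a 1 := by
      intro a
      ext b
      by_cases hb : b = a
      · subst hb; simp [cvec]
      · simp [cvec, hb]
    rw [bil, hc, hc, Matrix.mulVec_single_one, single_one_dotProduct]
    rfl

end

theorem theorem3 {n ν : ℕ}
    -- the oscillator, with a Hurwitz matrix, and its one-point covariance matrix
    (S : OQHO n ν) (hA : IsHurwitz S.A) (V : Matrix (Fin n) (Fin n) ℂ)
    (hV : cmat S.A * V + V * (cmat S.A)ᵀ + cmat S.B * itoMatrix ν * (cmat S.B)ᵀ = 0)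
    -- eigenvalues and eigenfunctions of the covariance kernel
    (T : ℝ) (hT : 0 < T) (μ : ℕ → ℝ) (h : ℕ → ℝ → Fin n → ℂ)
    (hμh : IsEigenSystem T (covKernel S.A V) μ h)
    -- independent Gaussian position-momentum pairs
    {H : Type*} [NormedAddCommGroup H] [InnerProductSpace ℂ H] [CompleteSpace H]
    (W : PairSystem H) (ρ : DensityOp H) (hind : W.Independent ρ)
    (hgauss : ∀ k, W.IsGaussian ρ pairCov k) :
    -- the series converges to operators with zero mean and the two-point covariance `K(s - t)`
    (∀ t ∈ Set.Icc 0 T, ∀ a,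
      PairSystem.coherent W ρ ⊆ (W.qkl μ h t a).domain ∧
      ρ.MSTendsto (fun N => ∑ k ∈ Finset.range N, W.qklTerm μ h t a k) (W.qkl μ h t a) ∧
      ρ.HasMean (W.qkl μ h t a) 0) ∧
    (∀ s ∈ Set.Icc 0 T, ∀ t ∈ Set.Icc 0 T, ∀ a b,
      ρ.HasCov (W.qkl μ h s a) (W.qkl μ h t b) (covKernel S.A V (s - t) a b)) ∧
    -- the multipoint characteristic functions are those of the Gaussian state
    (∀ l : List (ℝ × (Fin n → ℝ)), (∀ p ∈ l, p.1 ∈ Set.Icc 0 T) →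
      W.Exponentiates ρ (l.map fun p => qklCoef μ h p.1 p.2).sum
        (fun x => (l.map fun p => ∑ a, (p.2 a : ℂ) • evalAt (W.qkl μ h p.1 a) x).sum) ∧
      ρ.expect (W.expSeries (l.map fun p => qklCoef μ h p.1 p.2).sum) =
        Complex.exp (-jointExponent (covKernel S.A V) l) ∧
      orderedQCF ρ (fun t u => W.expSeries (qklCoef μ h t u)) l =
        Complex.exp (-orderedExponent (covKernel S.A V) l)) ∧
    -- they coincide with those of the oscillator driven by vacuum fields in its invariant state
    (∀ (G : Type*) [NormedAddCommGroup G] [InnerProductSpace ℂ G] [CompleteSpace G]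
      (Z : S.Model G) (ϱ : DensityOp G), S.IsInvariantVacuum Z ϱ →
      ∀ l : List (ℝ × (Fin n → ℝ)), (∀ p ∈ l, p.1 ∈ Set.Icc 0 T) →
        ρ.expect (W.expSeries (l.map fun p => qklCoef μ h p.1 p.2).sum) =
          ϱ.expect (Z.op (l.map fun p => S.elem p.1 p.2).sum) ∧
        orderedQCF ρ (fun t u => W.expSeries (qklCoef μ h t u)) l =
          orderedQCF ϱ (fun t u => Z.op (S.elem t u)) l) ∧
    -- the quasi-characteristic functional
    (∀ f : ℝ → Fin n → ℝ, SqInt T f →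
      (∀ x ∈ PairSystem.coherent W ρ, IntegrableOn
        (fun t => ∑ a, (f t a : ℂ) • evalAt (W.qkl μ h t a) x) (Set.Icc 0 T)) ∧
      W.Exponentiates ρ (qklIntCoef T μ h f)
        (fun x => ∫ t in Set.Icc 0 T, ∑ a, (f t a : ℂ) • evalAt (W.qkl μ h t a) x) ∧
      ρ.expect (W.expSeries (qklIntCoef T μ h f)) =
        Complex.exp (-(ipT T (fun t => cvec (f t))
          (covOp T (covKernel S.A V) (fun t => cvec (f t))) / 2))) := by
  obtain ⟨D, hD⟩ := exists_root_of_lyapunov hA hV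
  obtain ⟨ζ, hF, hζ, hK⟩ := OQHO.exists_coefficients hD hV hT hμh
  have hv : W.IsVacuum ρ := PairSystem.isVacuum_of_independent hind hgauss
  have hcoef : ∀ l : List (ℝ × (Fin n → ℝ)), (∀ p ∈ l, p.1 ∈ Set.Icc 0 T) → ∀ p ∈ l,
      IsCoef (qklCoef μ h p.1 p.2) (∑ a, p.2 a • ζ p.1 a) :=
    fun l hl p hp => PairSystem.qklCoef_isCoef (hζ p.1 (hl p hp)) p.2
  have hinner : ∀ l : List (ℝ × (Fin n → ℝ)), (∀ p ∈ l, p.1 ∈ Set.Icc 0 T) → ∀ p ∈ l, ∀ q ∈ l,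
      ⟪∑ a, p.2 a • ζ p.1 a, ∑ a, q.2 a • ζ q.1 a⟫_ℂ
        = bil (covKernel S.A V (p.1 - q.1)) p.2 q.2 :=
    fun l hl p hp q hq => PairSystem.inner_combination
      (hK p.1 (hl p hp) q.1 (hl q hq)) p.2 q.2
  have hexp : ∀ l : List (ℝ × (Fin n → ℝ)), (∀ p ∈ l, p.1 ∈ Set.Icc 0 T) →
      ρ.expect (W.expSeries (l.map fun p => qklCoef μ h p.1 p.2).sum) =
        Complex.exp (-jointExponent (covKernel S.A V) l) ∧
      orderedQCF ρ (fun t u => W.expSeries (qklCoef μ h t u)) l =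
        Complex.exp (-orderedExponent (covKernel S.A V) l) := by
    intro l hl
    refine ⟨?_, PairSystem.orderedQCF_eq hv (z := fun p => ∑ a, p.2 a • ζ p.1 a) (hcoef l hl)
      (hinner l hl)⟩
    rw [PairSystem.expect_expSeries hv (IsCoef.list_sum
        (z := fun p : ℝ × (Fin n → ℝ) => ∑ a, p.2 a • ζ p.1 a) (hcoef l hl)),
      jointExponent_eq (z := fun p : ℝ × (Fin n → ℝ) => ∑ a, p.2 a • ζ p.1 a) (hinner l hl)]
  refine ⟨fun t ht a => ⟨PairSystem.coherent_subset_domain hv (hζ t ht a),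
      PairSystem.msTendsto_qkl hv (hζ t ht a), PairSystem.hasMean_qkl hv (hζ t ht a)⟩,
    fun s hs t ht a b => ?_, fun l hl => ⟨?_, hexp l hl⟩, ?_, fun f hf => ⟨?_, ?_, ?_⟩⟩
  · rw [← hK s hs t ht a b]
    exact PairSystem.hasCov_qkl hv (hζ s hs a) (hζ t ht b)
  · exact PairSystem.exponentiates hv (IsCoef.list_sum
      (z := fun p : ℝ × (Fin n → ℝ) => ∑ a, p.2 a • ζ p.1 a) (hcoef l hl))
      fun u j hj => PairSystem.I_smul_evalAt_list hv (fun p hp => hζ p.1 (hl p hp)) u hj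
  -- Both sides have already been computed as the same function of the kernel; no map between the
  -- two Hilbert spaces is needed.
  · intro G _ _ _ Z ϱ hi l hl
    obtain ⟨h1, h2⟩ := hexp l hl
    obtain ⟨h3, h4⟩ := expect_op_elem hD hA hV hi fun p hp => (hl p hp).1
    exact ⟨h1.trans h3.symm, h2.trans h4.symm⟩
  · rintro x ⟨u, j, hj, rfl⟩
    exact PairSystem.integrableOn_evalAt hv hF hζ hf u hj
  · exact PairSystem.exponentiates hv (PairSystem.qklIntCoef_isCoef hF hζ hf)
      fun u j hj => PairSystem.I_smul_integral_evalAt hv hF hζ hf u hj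
  · rw [PairSystem.expect_expSeries hv (PairSystem.qklIntCoef_isCoef hF hζ hf),
      ← inner_synthesis_synthesis hF hK (SqInt.cvec hf) (SqInt.cvec hf),
      inner_self_eq_norm_sq_to_K]
    congr 1
    push_cast
    rfl
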